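/- Let $K$ be a field and let $(\mathfrak g,[\cdot,\cdot],\triangleright)$ be a post-Lie algebra over $K$, i.e. a Lie algebra with a bilinear product satisfying $[x,y]\triangleright z=x\triangleright(y\triangleright z)-(x\triangleright y)\triangleright z-y\triangleright(x\triangleright z)+(y\triangleright x)\triangleright z$ and $x\triangleright[y,z]=[x\triangleright y,z]+[y,x\triangleright z]$. Let $\Delta(A)=A_{(1)}\otimes A_{(2)}$ be the (unshuffle) coproduct of $\mathcal U(\mathfrak g)$ for which the elements of $\mathfrak g$ are primitive. (1) The product $\triangleright$ extends in exactly one way to a bilinear product on $\mathcal U(\mathfrak g)$ such that $1\triangleright A=A$, $\ xA\triangleright y=x\triangleright(A\triangleright y)-(x\triangleright A)\triangleright y$ and $A\triangleright BC=(A_{(1)}\triangleright B)(A_{(2)}\triangleright C)$ for $x,y\in\mathfrak g$, $A,B,C\in\mathcal U(\mathfrak g)$. Put $A\ast B=A_{(1)}\cdot(A_{(2)}\triangleright B)$. (2) Suppose that $\mathfrak g=\bigoplus_{n\ge1}\mathfrak g_n$ is graded, with all $\mathfrak g_n$ finite-dimensional and $[\mathfrak g_m,\mathfrak g_n]\subseteq\mathfrak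 g_{m+n}$, $\mathfrak g_m\triangleright\mathfrak g_n\subseteq\mathfrak g_{m+n}$, and give $\mathcal U(\mathfrak g)$ the induced grading. Then the graded dual $\mathcal U(\mathfrak g)^*$ carries two Hopf algebra structures: $\mathcal H_T^*$, the dual of $(\mathcal U(\mathfrak g),\cdot,\Delta)$, and $\mathcal H^*$, the dual of $(\mathcal U(\mathfrak g),\ast,\Delta)$. There is a unique linear map $\rho_\triangleright:\mathcal H_T^*\to\mathcal H^*\otimes\mathcal H_T^*$ with $\langle A\triangleright B,x\rangle=\langle A\otimes B,\rho_\triangleright(x)\rangle$ for all $A,B\in\mathcal U(\mathfrak g)$, $x\in\mathcal H_T^*$, and it puts $\mathcal H^*$ and $\mathcal H_T^*$ in cointeraction. That is, with $\mathcal A=\mathcal H_T^*$, $\mathcal B=\mathcal H^*$ and $\rho=\rho_\triangleright$: $\rho$ is a coaction, $(\mathrm{id}\otimes\rho)\rho=(\Delta_{\mathcal B}\otimes\mathrm{id})\rho$ and $(\epsilon_{\mathcal B}\otimes\mathrm{id})\rho=\mathrm{id}$; moreover $\rho(1)=1\otimes1$, $\ \rho(xy)=\rho(x)\rho(y)$,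 $\ (\mathrm{id}\otimes\epsilon_{\mathcal A})\rho=1_{\mathcal B}\,\epsilon_{\mathcal A}$ and $(\mathrm{id}\otimes\Delta_{\mathcal A})\rho=m_{\mathcal B}^{1,3}(\rho\otimes\rho)\Delta_{\mathcal A}$, where $m_{\mathcal B}^{1,3}(a\otimes b\otimes c\otimes d)=ac\otimes b\otimes d$. (3) (Free case.) Let $C$ be a set and let $\mathcal{PT}^C$ be spanned by the planar rooted trees with vertices decorated by $C$. There is exactly one post-Lie product on the free Lie algebra $Lie(\mathcal{PT}^C)$ for which $\tau_1\triangleright\tau_2$, for trees $\tau_1,\tau_2$, is the sum of all trees obtained by grafting the root of $\tau_1$ as leftmost branch onto a vertex of $\tau_2$ (this is the free post-Lie algebra on $C$). The ordered forests (words in planar trees, read as products) form a basis of $\mathcal U(Lie(\mathcal{PT}^C))$, and for forests $\omega_1,\omega_2$ the extended product $\omega_1\triangleright\omega_2$ is the sum over all ways of grafting all roots of $\omega_1$ onto vertices of $\omega_2$, to the left of the branches already there, such that roots grafted onto the same vertex keep their order. On the space spanned by ordered forests, let $\mathcal H_{Sh}$ be the shuffle Hopf algebra over the alphabet of planar trees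 (shuffle product, deconcatenation coproduct) and let $\mathcal H_{MKW}$ be the Munthe-Kaas--Wright Hopf algebra: shuffle product, and coproduct dual, in the basis of forests, to the planar Grossman--Larson product $\omega_1\ast\omega_2=\omega_{1(1)}\cdot(\omega_{1(2)}\triangleright\omega_2)$. Both are Hopf algebras, and the map $\rho:\mathcal H_{Sh}\to\mathcal H_{MKW}\otimes\mathcal H_{Sh}$, in which the coefficient of $\omega_1\otimes\omega_2$ in $\rho(\omega)$ is the coefficient of $\omega$ in $\omega_1\triangleright\omega_2$, puts $\mathcal H_{MKW}$ and $\mathcal H_{Sh}$ in cointeraction in the sense of (2). -/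

import Mathlib

universe u v w

open scoped TensorProduct

attribute [local instance 100] LieRing.ofAssociativeRing

noncomputable section

namespace PostLieCointeraction

/-! ### Bialgebras in cointeraction -/

section Cointeraction

variable {K : Type*} [Field K] {A B : Type*} [Ring A] [Bialgebra K A] [Ring B] [Bialgebra K B]

/-- The map `m^{1,3} : (a ⊗ b) ⊗ (c ⊗ d) ↦ ac ⊗ (b ⊗ d)`. -/
def mulOneThree (K A B : Type*) [Field K] [Ring A] [Bialgebra K A] [Ring B] [Bialgebra K B] :
    (B ⊗[K] A) ⊗[K] (B ⊗[K] A) →ₗ[K] B ⊗[K] (A ⊗[K] A) :=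
  (LinearMap.mul' K B).rTensor (A ⊗[K] A) ∘ₗ
    (TensorProduct.tensorTensorTensorComm K B A B A).toLinearMap

/-- `ρ : A → B ⊗ A` is a (left) coaction of the bialgebra `B` on the vector space `A`. -/
structure IsCoaction (ρ : A →ₗ[K] B ⊗[K] A) : Prop where
  coassoc : ρ.lTensor B ∘ₗ ρ =
    (TensorProduct.assoc K B B A).toLinearMap ∘ₗ
      (Coalgebra.comul (R := K) (A := B)).rTensor A ∘ₗ ρ
  counit : (TensorProduct.lid K A).toLinearMap ∘ₗ
    (Coalgebra.counit (R := K) (A := B)).rTensor A ∘ₗ ρ = LinearMap.id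

/-- The bialgebras `A` and `B` are in cointeraction via `ρ : A → B ⊗ A`. -/
structure IsCointeraction (ρ : A →ₗ[K] B ⊗[K] A) : Prop extends IsCoaction ρ where
  map_one : ρ 1 = 1 ⊗ₜ[K] 1
  map_mul : ∀ x y : A, ρ (x * y) = ρ x * ρ y
  comp_counit : ∀ x : A,
    (TensorProduct.rid K B) ((Coalgebra.counit (R := K) (A := A)).lTensor B (ρ x)) =
      Coalgebra.counit (R := K) x • (1 : B)
  comp_comul : (Coalgebra.comul (R := K) (A := A)).lTensor B ∘ₗ ρ =
    mulOneThree K A B ∘ₗ TensorProduct.map ρ ρ ∘ₗ Coalgebra.comul (R := K) (A := A)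

end Cointeraction

/-! ### Post-Lie algebras and the Guin-Oudom construction -/

section GuinOudom

variable {K : Type*} [Field K] {L : Type*} [LieRing L] [LieAlgebra K L]

/-- The bilinear product `t x y = x ▷ y` makes the Lie algebra `L` a post-Lie algebra. -/
structure IsPostLie (t : L →ₗ[K] L →ₗ[K] L) : Prop where
  lie_left : ∀ x y z : L,
    t ⁅x, y⁆ z = t x (t y z) - t (t x y) z - t y (t x z) + t (t y x) z
  lie_right : ∀ x y z : L, t x ⁅y, z⁆ = ⁅t x y, z⁆ + ⁅y, t x z⁆

/-- The enveloping algebra `𝒰(𝔤)`. -/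
local notation "𝓤" => UniversalEnvelopingAlgebra

/-- The unshuffle coproduct of `𝒰(𝔤)`: the algebra morphism with `x ↦ x ⊗ 1 + 1 ⊗ x` on `𝔤`. -/
def unshuffleCoproduct (K L : Type*) [Field K] [LieRing L] [LieAlgebra K L] :
    𝓤 K L →ₐ[K] 𝓤 K L ⊗[K] 𝓤 K L :=
  UniversalEnvelopingAlgebra.lift K
    { toFun := fun x => UniversalEnvelopingAlgebra.ι K x ⊗ₜ 1 +
        1 ⊗ₜ UniversalEnvelopingAlgebra.ι K x
      map_add' := fun x y => by
        simp only [map_add, TensorProduct.add_tmul, TensorProduct.tmul_add]; abel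
      map_smul' := fun c x => by
        simp only [map_smul, TensorProduct.smul_tmul', TensorProduct.tmul_smul, smul_add,
          RingHom.id_apply]
      map_lie' := fun {x y} => by
        simp only [LieHom.map_lie, LieRing.of_associative_ring_bracket, mul_add, add_mul,
          Algebra.TensorProduct.tmul_mul_tmul, one_mul, mul_one, TensorProduct.sub_tmul,
          TensorProduct.tmul_sub]
        abel }

/-- The counit of `𝒰(𝔤)`: the algebra morphism vanishing on `𝔤`. -/
def envelopingCounit (K L : Type*) [Field K] [LieRing L] [LieAlgebra K L] : 𝓤 K L →ₐ[K] K :=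
  UniversalEnvelopingAlgebra.lift K 0

/-- `g` is an extension of the post-Lie product `t` to `𝒰(𝔤)` satisfying the
Guin-Oudom identities. -/
structure IsGuinOudomExtension (t : L →ₗ[K] L →ₗ[K] L) (g : 𝓤 K L →ₗ[K] 𝓤 K L →ₗ[K] 𝓤 K L) :
    Prop where
  extends_product : ∀ x y : L, g (UniversalEnvelopingAlgebra.ι K x)
    (UniversalEnvelopingAlgebra.ι K y) = UniversalEnvelopingAlgebra.ι K (t x y)
  one_graft : ∀ A : 𝓤 K L, g 1 A = A
  mul_graft : ∀ (x y : L) (A : 𝓤 K L),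
    g (UniversalEnvelopingAlgebra.ι K x * A) (UniversalEnvelopingAlgebra.ι K y) =
      g (UniversalEnvelopingAlgebra.ι K x) (g A (UniversalEnvelopingAlgebra.ι K y)) -
        g (g (UniversalEnvelopingAlgebra.ι K x) A) (UniversalEnvelopingAlgebra.ι K y)
  graft_mul : ∀ A B C : 𝓤 K L, g A (B * C) =
    LinearMap.mul' K (𝓤 K L)
      (TensorProduct.map (g.flip B) (g.flip C) (unshuffleCoproduct K L A))

/-- The product `A ∗ B = A₍₁₎ · (A₍₂₎ ▷ B)` on `𝒰(𝔤)`. -/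
def starProduct (g : 𝓤 K L →ₗ[K] 𝓤 K L →ₗ[K] 𝓤 K L) (A B : 𝓤 K L) : 𝓤 K L :=
  LinearMap.mul' K (𝓤 K L) ((g.flip B).lTensor (𝓤 K L) (unshuffleCoproduct K L A))

/-- A grading `𝔤 = ⨁_{n ≥ 1} 𝔤ₙ` of a post-Lie algebra by finite-dimensional subspaces, compatible
with the Lie bracket and the post-Lie product. -/
structure IsPostLieGrading (t : L →ₗ[K] L →ₗ[K] L) (𝒢 : ℕ → Submodule K L) : Prop where
  isInternal : DirectSum.IsInternal 𝒢
  zero : 𝒢 0 = ⊥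
  finite : ∀ n, Module.Finite K (𝒢 n)
  lie_mem : ∀ m n x y, x ∈ 𝒢 m → y ∈ 𝒢 n → ⁅x, y⁆ ∈ 𝒢 (m + n)
  graft_mem : ∀ m n x y, x ∈ 𝒢 m → y ∈ 𝒢 n → t x y ∈ 𝒢 (m + n)

/-- The homogeneous component `𝒰(𝔤)ₙ`: the span of all products `x₁ ⋯ xₖ` of homogeneous elements
of `𝔤` whose degrees add up to `n`. -/
def envelopingComponent (𝒢 : ℕ → Submodule K L) (n : ℕ) : Submodule K (𝓤 K L) :=
  Submodule.span K {a | ∃ l : List (ℕ × L), (∀ p ∈ l, p.2 ∈ 𝒢 p.1) ∧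
    (l.map Prod.fst).sum = n ∧
    a = (l.map fun p => UniversalEnvelopingAlgebra.ι K p.2).prod}

/-- The graded dual of `𝒰(𝔤)`: the linear forms that vanish on all but finitely many homogeneous
components. -/
def gradedDual (𝒢 : ℕ → Submodule K L) : Submodule K (Module.Dual K (𝓤 K L)) where
  carrier := {f | ∃ N, ∀ n, N ≤ n → ∀ a ∈ envelopingComponent 𝒢 n, f a = 0}
  zero_mem' := ⟨0, fun _ _ _ _ => rfl⟩
  add_mem' := by
    rintro f f' ⟨N, hN⟩ ⟨N', hN'⟩
    refine ⟨max N N', fun n hn a ha => ?_⟩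
    rw [LinearMap.add_apply, hN n (le_trans (le_max_left _ _) hn) a ha,
      hN' n (le_trans (le_max_right _ _) hn) a ha, add_zero]
  smul_mem' := by
    rintro c f ⟨N, hN⟩
    exact ⟨N, fun n hn a ha => by rw [LinearMap.smul_apply, hN n hn a ha, smul_zero]⟩

/-- The pairing `⟨A ⊗ B, z⟩` induced by two pairings with `𝒰(𝔤)`. -/
def tensorPairing {H H' : Type*} [AddCommGroup H] [Module K H] [AddCommGroup H'] [Module K H']
    (p : H →ₗ[K] Module.Dual K (𝓤 K L)) (p' : H' →ₗ[K] Module.Dual K (𝓤 K L)) (A B : 𝓤 K L)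
    (z : H ⊗[K] H') : K :=
  TensorProduct.dualDistrib K (𝓤 K L) (𝓤 K L) (TensorProduct.map p p' z) (A ⊗ₜ[K] B)

/-- The Hopf algebra `H` is, via `p`, the graded dual of `𝒰(𝔤)` equipped with the product `mul`,
the unit `1`, the unshuffle coproduct and its counit: `p` identifies `H` with the graded dual as a
vector space, and all structure maps of `H` are the transposes of those of `𝒰(𝔤)`. In
particular the product of `H` is the shuffle product. -/
structure IsGradedDualHopfAlgebra (𝒢 : ℕ → Submodule K L) (mul : 𝓤 K L → 𝓤 K L → 𝓤 K L)
    {H : Type*} [Ring H] [HopfAlgebra K H] (p : H →ₗ[K] Module.Dual K (𝓤 K L)) : Prop where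
  injective : Function.Injective p
  range_eq : LinearMap.range p = gradedDual 𝒢
  one_apply : ∀ A, p 1 A = envelopingCounit K L A
  mul_apply : ∀ x y A, p (x * y) A =
    TensorProduct.dualDistrib K (𝓤 K L) (𝓤 K L) (p x ⊗ₜ[K] p y) (unshuffleCoproduct K L A)
  counit_apply : ∀ x, Coalgebra.counit (R := K) x = p x 1
  comul_apply : ∀ x A B, tensorPairing p p A B (Coalgebra.comul (R := K) x) = p x (mul A B)

/-- `ρ` is the transpose of the extended post-Lie product:
`⟨A ▷ B, x⟩ = ⟨A ⊗ B, ρ x⟩`. -/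
def IsGraftCoaction (g : 𝓤 K L →ₗ[K] 𝓤 K L →ₗ[K] 𝓤 K L)
    {HT H : Type*} [AddCommGroup HT] [Module K HT] [AddCommGroup H] [Module K H]
    (pT : HT →ₗ[K] Module.Dual K (𝓤 K L)) (p : H →ₗ[K] Module.Dual K (𝓤 K L))
    (ρ : HT →ₗ[K] H ⊗[K] HT) : Prop :=
  ∀ x A B, pT x (g A B) = tensorPairing p pT A B (ρ x)

end GuinOudom

/-! ### Planar rooted trees and ordered forests -/

/-- Planar rooted trees with vertices decorated by `C`: a root and the ordered list (from left to
right) of the branches attached to it. -/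
inductive PlanarTree (C : Type u) : Type u
  | node : C → List (PlanarTree C) → PlanarTree C

/-- All ways to split a word into two complementary subwords. -/
def unshuffles {α : Type*} : List α → List (List α × List α)
  | [] => [([], [])]
  | a :: l => (unshuffles l).flatMap fun p => [(a :: p.1, p.2), (p.1, a :: p.2)]

/-- All shuffles of two words, with multiplicity. -/
def shuffles {α : Type*} : List α → List α → List (List α)
  | [], m => [m]
  | a :: l, [] => [a :: l]
  | a :: l, b :: m =>
    (shuffles l (b :: m)).map (fun w => a :: w) ++ (shuffles (a :: l) m).map (fun w => b :: w)
termination_by l m => l.length + m.length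

mutual

/-- All ways, with multiplicity, of grafting the roots of the ordered forest `ω` onto vertices of a
planar tree, to the left of the branches already there, such that roots grafted onto the same
vertex keep their order. -/
def graftTree {C : Type u} (τ : PlanarTree C) (ω : List (PlanarTree C)) : List (PlanarTree C) :=
  match τ with
  | .node c ts => (unshuffles ω).flatMap fun p =>
      (graftForest ts p.2).map fun ts' => .node c (p.1 ++ ts')

/-- All ways, with multiplicity, of grafting the roots of the ordered forest `ω` onto vertices of an
ordered forest, to the left of the branches already there, such that roots grafted onto the same
vertex keep their order. -/
def graftForest {C : Type u} (σ : List (PlanarTree C)) (ω : List (PlanarTree C)) :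
    List (List (PlanarTree C)) :=
  match σ with
  | [] => match ω with
    | [] => [[]]
    | _ :: _ => []
  | τ :: σ' => (unshuffles ω).flatMap fun p =>
      (graftTree τ p.1).flatMap fun τ' => (graftForest σ' p.2).map fun σ'' => τ' :: σ''

end

/-- The planar Grossman-Larson product `ω₁ ∗ ω₂ = ω₁₍₁₎ · (ω₁₍₂₎ ▷ ω₂)` of two ordered forests, as a
list of forests with multiplicity. -/
def grossmanLarson {C : Type u} (ω₁ ω₂ : List (PlanarTree C)) : List (List (PlanarTree C)) :=
  (unshuffles ω₁).flatMap fun p => (graftForest ω₂ p.2).map fun ω => p.1 ++ ω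

section Forests

variable {K : Type*} [Field K]

/-- The multiplicity of a word in a list of words, as a scalar. -/
def multiplicity (K : Type*) [Field K] {α : Type*} (ω : List α) (l : List (List α)) : K :=
  open scoped Classical in (l.count ω : K)

/-- The Hopf algebra `H`, with a basis indexed by the words in `α`, is the shuffle Hopf algebra over
the alphabet `α`: shuffle product and deconcatenation coproduct. -/
structure IsShuffleHopfAlgebra {α : Type*} {H : Type*} [Ring H] [HopfAlgebra K H]
    (b : Module.Basis (List α) K H) : Prop where
  one_eq : b [] = 1
  mul_eq : ∀ l m, b l * b m = ((shuffles l m).map b).sum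
  counit_eq : ∀ l, Coalgebra.counit (R := K) (b l) = if l.isEmpty then 1 else 0
  comul_eq : ∀ l, Coalgebra.comul (R := K) (b l) =
    ∑ i ∈ Finset.range (l.length + 1), b (l.take i) ⊗ₜ[K] b (l.drop i)

/-- The Hopf algebra `H`, with a basis indexed by the ordered forests, is the Munthe-Kaas-Wright
Hopf algebra: shuffle product, and the coproduct dual to the planar Grossman-Larson product. -/
structure IsMKWHopfAlgebra {C : Type u} {H : Type*} [Ring H] [HopfAlgebra K H]
    (b : Module.Basis (List (PlanarTree C)) K H) : Prop where
  one_eq : b [] = 1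
  mul_eq : ∀ l m, b l * b m = ((shuffles l m).map b).sum
  counit_eq : ∀ l, Coalgebra.counit (R := K) (b l) = if l.isEmpty then 1 else 0
  comul_eq : ∀ ω ω₁ ω₂, (b.tensorProduct b).repr (Coalgebra.comul (R := K) (b ω)) (ω₁, ω₂) =
    multiplicity K ω (grossmanLarson ω₁ ω₂)

/-- `ρ` is the transpose of left grafting of ordered forests, in the dual forest bases. -/
def IsForestGraftCoaction {C : Type u} {HT H : Type*} [AddCommGroup HT] [Module K HT]
    [AddCommGroup H] [Module K H] (bT : Module.Basis (List (PlanarTree C)) K HT)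
    (b : Module.Basis (List (PlanarTree C)) K H) (ρ : HT →ₗ[K] H ⊗[K] HT) : Prop :=
  ∀ ω ω₁ ω₂, (b.tensorProduct bT).repr (ρ (bT ω)) (ω₁, ω₂) =
    multiplicity K ω (graftForest ω₂ ω₁)

/-- The free Lie algebra on planar trees, the underlying Lie algebra of the free post-Lie algebra
generated by `C`. -/
abbrev LieTrees (K : Type v) [Field K] (C : Type u) := FreeLieAlgebra K (PlanarTree C)

/-- `t` is the post-Lie product on `Lie(𝒫𝒯)` extending left grafting of planar trees. -/
structure IsFreePostLieProduct {C : Type u}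
    (t : LieTrees K C →ₗ[K] LieTrees K C →ₗ[K] LieTrees K C) : Prop extends IsPostLie t where
  of_of : ∀ τ₁ τ₂ : PlanarTree C, t (FreeLieAlgebra.of K τ₁) (FreeLieAlgebra.of K τ₂) =
    ((graftTree τ₂ [τ₁]).map (FreeLieAlgebra.of K)).sum

/-- The ordered forest `τ₁ ⋯ τₖ` as the product of its trees in `𝒰(Lie(𝒫𝒯))`. -/
def forestElement (K : Type*) [Field K] {C : Type u} (ω : List (PlanarTree C)) :
    UniversalEnvelopingAlgebra K (LieTrees K C) :=
  (ω.map fun τ => UniversalEnvelopingAlgebra.ι K (FreeLieAlgebra.of K τ)).prod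

end Forests

end PostLieCointeraction

end

open PostLieCointeraction

-- Everything rests on the sub-adjacent Lie algebra, which is 𝔤 with the bracket ⟦x, y⟧ = [x, y] + x
-- ▷ y − y ▷ x. The two post-Lie identities say that x ↦ x ▷ · represents it by derivations of 𝔤.
-- Hence 𝒰(`SubAdjacent`) acts on 𝒰(𝔤) (`envAct`) and makes it a module bialgebra. It also acts by x
-- · A = xA + x ▷ A, and the orbit map Φ(a) = a · 1 is an isomorphism of coalgebras onto 𝒰(𝔤)
-- (`bijective_orbitMap`). Its inverse solves Φ⁻¹(xA) = x Φ⁻¹(A) − Φ⁻¹(x ▷ A), a well-founded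
-- recursion because x ▷ · preserves word length. The recursion is solved on the tensor algebra
-- (`graftRec`) and shown to respect the relations of 𝒰(𝔤) (`graftRec_lieRelation`).
--
-- The extension is then A ▷ B = Φ⁻¹(A) acting on B, and A ∗ B = Φ(Φ⁻¹(A) Φ⁻¹(B))
-- (`starProduct_guinOudom`), so (𝒰(𝔤), ∗, Δ) is 𝒰(`SubAdjacent`) in disguise. For uniqueness, A ▷ 1
-- = ε(A) 1 is forced by a convolution idempotent argument (`IsGuinOudomExtension.graft_one`). After
-- that xA ▷ B = x ▷ (A ▷ B) − (x ▷ A) ▷ B holds for every B, and induction on word length in A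
-- finishes.
--
-- For the duals, a `RestrictedDual` is a space of linear forms to which all structure maps
-- transpose; it is a Hopf algebra. The axioms of a cointeraction are the transposes of the axioms
-- of a module bialgebra (`RestrictedDual.isCointeraction_of_action`), so only finiteness remains: a
-- form supported in finitely many degrees, composed with a degree-preserving bilinear map, has
-- finitely many nonzero coefficients (`exists_list_gradedForms`).
--
-- In the free case the orbit construction is run before any post-Lie product is known: freeness
-- provides the derivations and the twisted action from their values on trees, and the product is
-- read off from the inverse orbit map (`isPostLie_freePostLieProduct`). Grafting on forests is
-- computed from A ▷ B₊(F) = B₊(A ∗ F) (`guinOudom_rootMap`), where B₊ attaches a forest to a new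
-- root. Degrees are multisets of decorations, which keeps the components finite-dimensional for
-- every C.

attribute [-simp] UniversalEnvelopingAlgebra.ι_apply UniversalEnvelopingAlgebra.lift_ι_apply'
attribute [simp] UniversalEnvelopingAlgebra.lift_ι_apply

open PostLieCointeraction

noncomputable section

namespace PostLieCointeraction

local notation "𝓤" => UniversalEnvelopingAlgebra
local notation "ιᵤ" => UniversalEnvelopingAlgebra.ι

-- The Hopf algebra structure of the enveloping algebra

section Enveloping

variable {K : Type*} [Field K] {L : Type*} [LieRing L] [LieAlgebra K L]

theorem enveloping_algHom_ext {A : Type*} [Ring A] [Algebra K A] {f g : 𝓤 K L →ₐ[K] A}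
    (h : ∀ x, f (ιᵤ K x) = g (ιᵤ K x)) : f = g :=
  UniversalEnvelopingAlgebra.hom_ext K (LieHom.ext h)

/-- The universal property lifts 𝔤 → S to 𝒰(𝔤) → S. Followed by the inclusion it is the identity on
𝔤, hence everywhere. -/
theorem adjoin_range_ι :
    Algebra.adjoin K (Set.range (ιᵤ K : L → 𝓤 K L)) = ⊤ := by
  set S := Algebra.adjoin K (Set.range (ιᵤ K : L → 𝓤 K L))
  have hmem : ∀ x : L, ιᵤ K x ∈ S := fun x => Algebra.subset_adjoin ⟨x, rfl⟩
  let f : L →ₗ⁅K⁆ S :=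
    { toFun := fun x => ⟨ιᵤ K x, hmem x⟩
      map_add' := fun x y => Subtype.ext (by simp)
      map_smul' := fun c x => Subtype.ext (by simp)
      map_lie' := fun {x y} => Subtype.ext (by
        simp [LieRing.of_associative_ring_bracket]) }
  have h : S.val.comp (UniversalEnvelopingAlgebra.lift K f) = AlgHom.id K _ := by
    ext x
    simp [f]
  refine eq_top_iff.2 fun a _ => ?_
  have := DFunLike.congr_fun h a
  simp only [AlgHom.comp_apply, AlgHom.id_apply] at this
  rw [← this]
  exact (UniversalEnvelopingAlgebra.lift K f a).2

/-- Induction along left multiplications by elements of the Lie algebra. -/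
theorem enveloping_induction {p : 𝓤 K L → Prop} (one : p 1)
    (add : ∀ a b, p a → p b → p (a + b)) (smul : ∀ (c : K) a, p a → p (c • a))
    (ι_mul : ∀ x a, p a → p (ιᵤ K x * a)) (a : 𝓤 K L) : p a := by
  have key : ∀ a ∈ Algebra.adjoin K (Set.range (ιᵤ K : L → 𝓤 K L)), ∀ b, p b → p (a * b) := by
    intro a ha
    induction ha using Algebra.adjoin_induction with
    | mem x hx => obtain ⟨x, rfl⟩ := hx; exact ι_mul x
    | algebraMap r => intro b hb; rw [← Algebra.smul_def]; exact smul r b hb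
    | add x y _ _ hx hy => intro b hb; rw [add_mul]; exact add _ _ (hx b hb) (hy b hb)
    | mul x y _ _ hx hy => intro b hb; rw [mul_assoc]; exact hx _ (hy _ hb)
  have := key a (by rw [adjoin_range_ι]; trivial) 1 one
  rwa [mul_one] at this

theorem enveloping_linearMap_ext {V : Type*} [AddCommGroup V] [Module K V]
    {f g : 𝓤 K L →ₗ[K] V} (one : f 1 = g 1)
    (ι_mul : ∀ x a, f a = g a → f (ιᵤ K x * a) = g (ιᵤ K x * a)) : f = g := by
  ext a
  induction a using enveloping_induction with
  | one => exact one
  | add a b ha hb => rw [map_add, map_add, ha, hb]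
  | smul c a ha => rw [map_smul, map_smul, ha]
  | ι_mul x a ha => exact ι_mul x a ha

@[simp]
theorem unshuffleCoproduct_ι (x : L) :
    unshuffleCoproduct K L (ιᵤ K x) = ιᵤ K x ⊗ₜ 1 + 1 ⊗ₜ ιᵤ K x := by
  simp [unshuffleCoproduct]

@[simp]
theorem envelopingCounit_ι (x : L) : envelopingCounit K L (ιᵤ K x) = 0 := by
  simp [envelopingCounit]

instance : Bialgebra K (𝓤 K L) :=
  Bialgebra.ofAlgHom (unshuffleCoproduct K L) (envelopingCounit K L)
    (by
      ext x
      simp [TensorProduct.add_tmul, TensorProduct.tmul_add, Algebra.TensorProduct.one_def,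
        add_assoc])
    (enveloping_algHom_ext fun x => by simp)
    (enveloping_algHom_ext fun x => by simp)

theorem comul_eq_unshuffleCoproduct (a : 𝓤 K L) :
    Coalgebra.comul (R := K) a = unshuffleCoproduct K L a := rfl

@[simp]
theorem comul_ι (x : L) :
    Coalgebra.comul (R := K) (ιᵤ K x) = ιᵤ K x ⊗ₜ 1 + 1 ⊗ₜ ιᵤ K x :=
  unshuffleCoproduct_ι x

@[simp]
theorem counit_ι (x : L) : Coalgebra.counit (R := K) (ιᵤ K x) = 0 :=
  envelopingCounit_ι x

/-- The antipode of an enveloping algebra, as a morphism to the opposite algebra. -/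
def envelopingAntipode (K L : Type*) [Field K] [LieRing L] [LieAlgebra K L] :
    𝓤 K L →ₐ[K] (𝓤 K L)ᵐᵒᵖ :=
  UniversalEnvelopingAlgebra.lift K
    { toFun := fun x => MulOpposite.op (-ιᵤ K x)
      map_add' := fun x y => by simp [add_comm]
      map_smul' := fun c x => by simp
      map_lie' := fun {x y} => by
        simp [LieRing.of_associative_ring_bracket, ← MulOpposite.op_mul, ← MulOpposite.op_sub] }

instance : HopfAlgebra K (𝓤 K L) where
  antipode := (MulOpposite.opLinearEquiv K).symm.toLinearMap ∘ₗ (envelopingAntipode K L).toLinearMap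
  mul_antipode_rTensor_comul := by
    apply enveloping_linearMap_ext
    · simp [Algebra.TensorProduct.one_def]
    · intro x a _
      simp only [LinearMap.comp_apply, Bialgebra.comul_mul, comul_ι, Bialgebra.counit_mul,
        counit_ι, zero_mul, map_zero]
      -- For every b ⊗ c the two contributions S(xb)c + S(b)xc cancel, so no induction hypothesis is
      -- needed on this side.
      induction (Coalgebra.comul a : 𝓤 K L ⊗[K] 𝓤 K L) using TensorProduct.induction_on with
      | zero => simp
      | tmul b c => simp [add_mul, mul_assoc, envelopingAntipode]
      | add b c hb hc => rw [mul_add, map_add, map_add, hb, hc, add_zero]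
  mul_antipode_lTensor_comul := by
    apply enveloping_linearMap_ext
    · simp [Algebra.TensorProduct.one_def]
    · intro x a ha
      simp only [LinearMap.comp_apply, Bialgebra.comul_mul, comul_ι, Algebra.linearMap_apply,
        Bialgebra.counit_mul, counit_ι, zero_mul, map_zero] at ha ⊢
      -- On this side, multiplying a by x replaces the value by its commutator with x, and that
      -- vanishes because the induction hypothesis makes the value a scalar.
      have key : ∀ z : 𝓤 K L ⊗[K] 𝓤 K L, ∀ S : 𝓤 K L →ₗ[K] 𝓤 K L,
          (∀ b, S (ιᵤ K x * b) = - S b * ιᵤ K x) →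
          LinearMap.mul' K (𝓤 K L) (S.lTensor (𝓤 K L)
            ((ιᵤ K x ⊗ₜ 1 + 1 ⊗ₜ ιᵤ K x) * z)) =
          ιᵤ K x * LinearMap.mul' K (𝓤 K L) (S.lTensor (𝓤 K L) z) -
          LinearMap.mul' K (𝓤 K L) (S.lTensor (𝓤 K L) z) * ιᵤ K x := by
        intro z S hS
        induction z using TensorProduct.induction_on with
        | zero => simp
        | tmul b c => simp [add_mul, mul_assoc, hS, sub_eq_add_neg]
        | add b c hb hc => rw [mul_add, map_add, map_add, hb, hc]; simp only [map_add]; noncomm_ring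
      rw [key, ha, Algebra.commutes, sub_self]
      intro b
      simp [envelopingAntipode]

theorem antipode_ι_mul (x : L) (a : 𝓤 K L) :
    HopfAlgebra.antipode K (ιᵤ K x * a) = - (HopfAlgebra.antipode K a * ιᵤ K x) := by
  change ((envelopingAntipode K L (ιᵤ K x * a)).unop : 𝓤 K L) =
    - ((envelopingAntipode K L a).unop * ιᵤ K x)
  simp [envelopingAntipode]

end Enveloping

-- Extending derivations of 𝔤 to 𝒰(𝔤), through dual numbers

section Derivations

variable {K : Type*} [Field K] {L : Type*} [LieRing L] [LieAlgebra K L]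

/-- The Lie algebra morphism `x ↦ x + δ x ε` to the dual numbers over `𝒰(𝔤)`. -/
def envelopingDerivationAux (δ : LieDerivation K L L) :
    𝓤 K L →ₐ[K] TrivSqZeroExt (𝓤 K L) (𝓤 K L) :=
  UniversalEnvelopingAlgebra.lift K
    { toFun := fun x => TrivSqZeroExt.inl (ιᵤ K x) + TrivSqZeroExt.inr (ιᵤ K (δ x))
      map_add' := fun x y => by ext <;> simp
      map_smul' := fun c x => by ext <;> simp
      map_lie' := fun {x y} => by
        ext <;> simp [LieRing.of_associative_ring_bracket]
        abel }

theorem fst_envelopingDerivationAux (δ : LieDerivation K L L) (a : 𝓤 K L) :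
    (envelopingDerivationAux δ a).fst = a := by
  have : (TrivSqZeroExt.fstHom K (𝓤 K L) (𝓤 K L)).comp (envelopingDerivationAux δ) =
      AlgHom.id K _ := by
    ext x; simp [envelopingDerivationAux]
  exact DFunLike.congr_fun this a

/-- The derivation of `𝒰(𝔤)` extending a derivation of `𝔤`. -/
def envelopingDerivation (δ : LieDerivation K L L) : Module.End K (𝓤 K L) :=
  TrivSqZeroExt.sndHom (𝓤 K L) (𝓤 K L) |>.restrictScalars K |>.comp
    (envelopingDerivationAux δ).toLinearMap

@[simp]
theorem envelopingDerivation_ι (δ : LieDerivation K L L) (x : L) :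
    envelopingDerivation δ (ιᵤ K x) = ιᵤ K (δ x) := by
  simp [envelopingDerivation, envelopingDerivationAux]

theorem envelopingDerivation_mul (δ : LieDerivation K L L) (a b : 𝓤 K L) :
    envelopingDerivation δ (a * b) =
      envelopingDerivation δ a * b + a * envelopingDerivation δ b := by
  simp [envelopingDerivation, fst_envelopingDerivationAux, add_comm]

@[simp]
theorem envelopingDerivation_one (δ : LieDerivation K L L) : envelopingDerivation δ 1 = 0 := by
  simp [envelopingDerivation]

/-- `𝒰` on derivations is a morphism of Lie algebras. -/
def envelopingDerivationHom (K L : Type*) [Field K] [LieRing L] [LieAlgebra K L] :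
    LieDerivation K L L →ₗ⁅K⁆ Module.End K (𝓤 K L) where
  toFun := envelopingDerivation
  map_add' δ δ' := enveloping_linearMap_ext (by simp) fun x a ha => by
    simp only [LinearMap.add_apply] at ha ⊢
    simp [envelopingDerivation_mul, ha]; noncomm_ring
  map_smul' c δ := enveloping_linearMap_ext (by simp) fun x a ha => by
    simp only [LinearMap.smul_apply, RingHom.id_apply] at ha ⊢
    simp [envelopingDerivation_mul, ha]
  map_lie' {δ δ'} := enveloping_linearMap_ext (by
      simp [LieRing.of_associative_ring_bracket]) fun x a ha => by
    simp only [LieRing.of_associative_ring_bracket, LinearMap.sub_apply,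
      Module.End.mul_apply] at ha ⊢
    simp [envelopingDerivation_mul, ha]; noncomm_ring

@[simp]
theorem envelopingDerivationHom_apply (δ : LieDerivation K L L) :
    envelopingDerivationHom K L δ = envelopingDerivation δ := rfl

end Derivations

-- Recursion on word length in a tensor algebra

section TensorRecursion

variable {K : Type*} [Field K] {P : Type*} [AddCommGroup P] [Module K P]

local notation "ιₜ" => TensorAlgebra.ι

/-- Induction along left multiplications by vectors. -/
theorem tensorAlgebra_induction {p : TensorAlgebra K P → Prop} (one : p 1)
    (add : ∀ a b, p a → p b → p (a + b)) (smul : ∀ (c : K) a, p a → p (c • a))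
    (ι_mul : ∀ x a, p a → p (ιₜ K x * a)) (a : TensorAlgebra K P) : p a := by
  have key : ∀ a : TensorAlgebra K P, ∀ b, p b → p (a * b) := by
    intro a
    induction a using TensorAlgebra.induction with
    | algebraMap r => intro b hb; rw [← Algebra.smul_def]; exact smul r b hb
    | ι x => exact ι_mul x
    | mul x y hx hy => intro b hb; rw [mul_assoc]; exact hx _ (hy _ hb)
    | add x y hx hy => intro b hb; rw [add_mul]; exact add _ _ (hx b hb) (hy b hb)
  simpa using key a 1 one

section Recursor

variable {F : Type*} [AddCommGroup F] [Module K F]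

/-- The auxiliary action defining `tensorRec`. -/
def tensorRecAux (G : P →ₗ[K] (TensorAlgebra K P × F) →ₗ[K] F) :
    TensorAlgebra K P →ₐ[K] Module.End K (TensorAlgebra K P × F) :=
  TensorAlgebra.lift K
    { toFun := fun x => (LinearMap.mulLeft K (ιₜ K x) ∘ₗ LinearMap.fst K _ _).prod (G x)
      map_add' := fun x y => by ext <;> simp [add_mul]
      map_smul' := fun c x => by ext <;> simp }

/-- The first component carries the word itself along, so the step `G` may use both the shorter word
and the value already computed on it. -/
theorem fst_tensorRecAux (G : P →ₗ[K] (TensorAlgebra K P × F) →ₗ[K] F) (e : F)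
    (a : TensorAlgebra K P) : (tensorRecAux G a (1, e)).1 = a := by
  induction a using tensorAlgebra_induction with
  | one => simp
  | add a b ha hb => simp [ha, hb]
  | smul c a ha => simp [ha]
  | ι_mul x a ha =>
    rw [map_mul, Module.End.mul_apply]
    conv_rhs => rw [← ha]
    simp [tensorRecAux]

/-- The linear map on the tensor algebra defined by recursion: `1 ↦ e` and
`x ⊗ A ↦ G x (A, f A)`. -/
def tensorRec (e : F) (G : P →ₗ[K] (TensorAlgebra K P × F) →ₗ[K] F) : TensorAlgebra K P →ₗ[K] F :=
  LinearMap.snd K _ _ ∘ₗ LinearMap.applyₗ (1, e) ∘ₗ (tensorRecAux G).toLinearMap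

@[simp]
theorem tensorRec_one (e : F) (G : P →ₗ[K] (TensorAlgebra K P × F) →ₗ[K] F) :
    tensorRec e G 1 = e := by
  simp [tensorRec]

theorem tensorRec_ι_mul (e : F) (G : P →ₗ[K] (TensorAlgebra K P × F) →ₗ[K] F) (x : P)
    (a : TensorAlgebra K P) : tensorRec e G (ιₜ K x * a) = G x (a, tensorRec e G a) := by
  have h : tensorRecAux G a (1, e) = (a, tensorRec e G a) :=
    Prod.ext (fst_tensorRecAux G e a) rfl
  simp only [tensorRec, LinearMap.comp_apply, AlgHom.toLinearMap_apply, map_mul,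
    LinearMap.applyₗ_apply_apply, Module.End.mul_apply] at h ⊢
  rw [h]
  simp [tensorRecAux]

end Recursor

/-- The derivations `D x` of the tensor algebra with `D x y = t x y`. -/
def tensorDerivation (t : P →ₗ[K] P →ₗ[K] P) :
    P →ₗ[K] TensorAlgebra K P →ₗ[K] TensorAlgebra K P :=
  LinearMap.flip (tensorRec (F := P →ₗ[K] TensorAlgebra K P) 0
    (LinearMap.mk₂ K (fun y p => LinearMap.mulRight K p.1 ∘ₗ ιₜ K ∘ₗ t.flip y +
        LinearMap.mulLeft K (ιₜ K y) ∘ₗ p.2)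
      (fun _ _ _ => by ext; simp [add_mul]; abel)
      (fun _ _ _ => by ext; simp)
      (fun _ _ _ => by ext; simp [mul_add]; abel)
      (fun _ _ _ => by ext; simp)))

@[simp]
theorem tensorDerivation_one (t : P →ₗ[K] P →ₗ[K] P) (x : P) : tensorDerivation t x 1 = 0 := by
  simp [tensorDerivation]

theorem tensorDerivation_ι_mul (t : P →ₗ[K] P →ₗ[K] P) (x y : P) (a : TensorAlgebra K P) :
    tensorDerivation t x (ιₜ K y * a) = ιₜ K (t x y) * a + ιₜ K y * tensorDerivation t x a := by
  simp [tensorDerivation, tensorRec_ι_mul]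

theorem tensorDerivation_mul (t : P →ₗ[K] P →ₗ[K] P) (x : P) (a b : TensorAlgebra K P) :
    tensorDerivation t x (a * b) = tensorDerivation t x a * b + a * tensorDerivation t x b := by
  induction a using tensorAlgebra_induction with
  | one => simp
  | add a a' ha ha' => simp only [add_mul, map_add, ha, ha']; abel
  | smul c a ha => simp [ha]
  | ι_mul y a ha => rw [mul_assoc, tensorDerivation_ι_mul, ha, tensorDerivation_ι_mul]; noncomm_ring

@[simp]
theorem tensorDerivation_ι (t : P →ₗ[K] P →ₗ[K] P) (x y : P) :
    tensorDerivation t x (ιₜ K y) = ιₜ K (t x y) := by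
  simpa using tensorDerivation_ι_mul t x y 1

/-- Preservation of word length is what makes the recursion φ(xA) = m x (φ A) − φ(D x A) terminate.
-/
theorem tensorDerivation_mem (t : P →ₗ[K] P →ₗ[K] P) (x : P) (n : ℕ) (a : TensorAlgebra K P)
    (ha : a ∈ LinearMap.range (ιₜ K (M := P)) ^ n) :
    tensorDerivation t x a ∈ LinearMap.range (ιₜ K (M := P)) ^ n := by
  induction n generalizing a with
  | zero =>
    rw [pow_zero, Submodule.mem_one] at ha
    obtain ⟨c, rfl⟩ := ha
    rw [Algebra.algebraMap_eq_smul_one, map_smul, tensorDerivation_one, smul_zero]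
    exact zero_mem _
  | succ n ih =>
    rw [pow_succ'] at ha ⊢
    induction ha using Submodule.mul_induction_on' with
    | mem_mul_mem y hy b hb =>
      obtain ⟨y, rfl⟩ := hy
      rw [tensorDerivation_ι_mul]
      exact add_mem (Submodule.mul_mem_mul ⟨_, rfl⟩ hb) (Submodule.mul_mem_mul ⟨_, rfl⟩ (ih b hb))
    | add a _ b _ ha hb => rw [map_add]; exact add_mem ha hb

variable {E : Type*} [AddCommGroup E] [Module K E]

/-- The approximations of `graftRec`: the `n`-th one is correct on words of length less than `n`. -/
def graftRecApprox (t : P →ₗ[K] P →ₗ[K] P) (m : P →ₗ[K] Module.End K E) (e : E) :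
    ℕ → TensorAlgebra K P →ₗ[K] E
  | 0 => 0
  | n + 1 => tensorRec e
      (LinearMap.mk₂ K (fun x p => m x (graftRecApprox t m e n p.1) -
          graftRecApprox t m e n (tensorDerivation t x p.1))
        (fun _ _ _ => by simp; abel)
        (fun _ _ _ => by simp [smul_sub])
        (fun _ _ _ => by simp; abel)
        (fun _ _ _ => by simp [smul_sub]))

theorem graftRecApprox_one (t : P →ₗ[K] P →ₗ[K] P) (m : P →ₗ[K] Module.End K E) (e : E) (n : ℕ) :
    graftRecApprox t m e (n + 1) 1 = e := by
  simp [graftRecApprox]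

theorem graftRecApprox_ι_mul (t : P →ₗ[K] P →ₗ[K] P) (m : P →ₗ[K] Module.End K E) (e : E) (n : ℕ)
    (x : P) (a : TensorAlgebra K P) :
    graftRecApprox t m e (n + 1) (ιₜ K x * a) = m x (graftRecApprox t m e n a) -
      graftRecApprox t m e n (tensorDerivation t x a) := by
  simp [graftRecApprox, tensorRec_ι_mul]

/-- The solution of the recursion `φ 1 = e`, `φ (x ⊗ A) = m x (φ A) - φ (D x A)`. -/
def graftRec (t : P →ₗ[K] P →ₗ[K] P) (m : P →ₗ[K] Module.End K E) (e : E) :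
    TensorAlgebra K P →ₗ[K] E :=
  DirectSum.toModule K ℕ E (fun k => graftRecApprox t m e (k + 1) ∘ₗ
      (LinearMap.range (ιₜ K (M := P)) ^ k).subtype) ∘ₗ
    (DirectSum.decomposeLinearEquiv
      ((LinearMap.range (ιₜ K (M := P)) ^ ·) : ℕ → Submodule K (TensorAlgebra K P))).toLinearMap

theorem graftRec_of_mem (t : P →ₗ[K] P →ₗ[K] P) (m : P →ₗ[K] Module.End K E) (e : E) {k : ℕ}
    {a : TensorAlgebra K P} (ha : a ∈ LinearMap.range (ιₜ K (M := P)) ^ k) :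
    graftRec t m e a = graftRecApprox t m e (k + 1) a := by
  simp only [graftRec, LinearMap.comp_apply, LinearEquiv.coe_coe,
    DirectSum.decomposeLinearEquiv_apply]
  rw [DirectSum.decompose_of_mem _ ha]
  exact DirectSum.toModule_lof K k _

@[simp]
theorem graftRec_one (t : P →ₗ[K] P →ₗ[K] P) (m : P →ₗ[K] Module.End K E) (e : E) :
    graftRec t m e 1 = e := by
  rw [graftRec_of_mem t m e (k := 0) (by simp), graftRecApprox_one]

/-- For A of length k, the left side is given by approximation k + 2, whose definition calls
approximation k + 1 on A and on D x A. Both have length k, so that approximation is the right one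
for them. -/
theorem graftRec_ι_mul (t : P →ₗ[K] P →ₗ[K] P) (m : P →ₗ[K] Module.End K E) (e : E) (x : P)
    (a : TensorAlgebra K P) : graftRec t m e (ιₜ K x * a) =
      m x (graftRec t m e a) - graftRec t m e (tensorDerivation t x a) := by
  induction a using DirectSum.Decomposition.inductionOn
    ((LinearMap.range (ιₜ K (M := P)) ^ ·) : ℕ → Submodule K (TensorAlgebra K P)) with
  | zero => simp
  | @homogeneous k a =>
    obtain ⟨a, ha⟩ := a
    have h : ιₜ K x * a ∈ LinearMap.range (ιₜ K (M := P)) ^ (k + 1) := by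
      rw [pow_succ']; exact Submodule.mul_mem_mul ⟨_, rfl⟩ ha
    rw [graftRec_of_mem t m e h, graftRecApprox_ι_mul, graftRec_of_mem t m e ha,
      graftRec_of_mem t m e (tensorDerivation_mem t x k a ha)]
  | add a b ha hb => simp only [mul_add, map_add, ha, hb]; abel

end TensorRecursion

-- Actions of an enveloping algebra on another one, and twisted actions

section Actions

open Coalgebra (comul counit)

variable {K : Type*} [Field K] {L N : Type*} [LieRing L] [LieAlgebra K L] [LieRing N]
  [LieAlgebra K N]

/-- The extended derivation is also a coderivation, because it sends the primitive elements of 𝔤 to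
primitive elements. -/
theorem comul_envelopingDerivation (δ : LieDerivation K L L) (A : 𝓤 K L) :
    comul (R := K) (envelopingDerivation δ A) =
      (envelopingDerivation δ).rTensor (𝓤 K L) (comul A) +
        (envelopingDerivation δ).lTensor (𝓤 K L) (comul A) := by
  induction A using enveloping_induction with
  | one => simp [Algebra.TensorProduct.one_def]
  | add a b ha hb => simp only [map_add, ha, hb]; abel
  | smul c a ha => simp only [map_smul, ha, smul_add]
  | ι_mul x a ha =>
    rw [envelopingDerivation_mul, envelopingDerivation_ι, map_add, Bialgebra.comul_mul,
      Bialgebra.comul_mul, ha, Bialgebra.comul_mul, comul_ι, comul_ι]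
    generalize (comul (R := K) a) = z
    induction z using TensorProduct.induction_on with
    | zero => simp
    | tmul b c =>
      simp only [add_mul, Algebra.TensorProduct.tmul_mul_tmul, one_mul, map_add,
        LinearMap.rTensor_tmul, LinearMap.lTensor_tmul, mul_add, envelopingDerivation_mul,
        envelopingDerivation_ι, TensorProduct.add_tmul, TensorProduct.tmul_add]
      abel
    | add z z' hz hz' =>
      simp only [mul_add, map_add] at hz hz' ⊢
      linear_combination (norm := abel) hz + hz'

@[simp]
theorem counit_envelopingDerivation (δ : LieDerivation K L L) (A : 𝓤 K L) :
    counit (R := K) (envelopingDerivation δ A) = 0 := by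
  induction A using enveloping_induction with
  | one => simp
  | add a b ha hb => simp [ha, hb]
  | smul c a ha => simp [ha]
  | ι_mul x a ha => simp [envelopingDerivation_mul, ha]

section

variable (d : N →ₗ⁅K⁆ LieDerivation K L L)

/-- The action of `𝒰(𝔫)` on `𝔤` extending an action of `𝔫` by derivations. -/
def lieAct : 𝓤 K N →ₐ[K] Module.End K L :=
  UniversalEnvelopingAlgebra.lift K ((LieDerivation.toLinearMapLieHom K L).comp d)

/-- The action of `𝒰(𝔫)` on `𝒰(𝔤)` extending an action of `𝔫` on `𝔤` by derivations. -/
def envAct : 𝓤 K N →ₐ[K] Module.End K (𝓤 K L) :=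
  UniversalEnvelopingAlgebra.lift K ((envelopingDerivationHom K L).comp d)

@[simp]
theorem lieAct_ι (n : N) (x : L) : lieAct d (ιᵤ K n) x = d n x := by
  simp [lieAct]; rfl

@[simp]
theorem envAct_ι (n : N) (A : 𝓤 K L) :
    envAct d (ιᵤ K n) A = envelopingDerivation (d n) A := by
  simp [envAct]

theorem envAct_ι_right (a : 𝓤 K N) (x : L) : envAct d a (ιᵤ K x) = ιᵤ K (lieAct d a x) := by
  induction a using enveloping_induction generalizing x with
  | one => simp
  | add a b ha hb => simp [ha, hb]
  | smul c a ha => simp [ha]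
  | ι_mul n a ha => simp [ha]

theorem lieAct_lie (a : 𝓤 K N) (x y : L) : lieAct d a ⁅x, y⁆ =
    TensorProduct.lift (LieModule.toEnd K L L).toLinearMap (TensorProduct.map
      ((lieAct d).toLinearMap.flip x) ((lieAct d).toLinearMap.flip y) (comul a)) := by
  induction a using enveloping_induction with
  | one => simp [Algebra.TensorProduct.one_def]
  | add a b ha hb => simp [ha, hb]
  | smul c a ha => simp [ha]
  | ι_mul n a ha =>
    rw [map_mul, Module.End.mul_apply, ha, lieAct_ι, Bialgebra.comul_mul, comul_ι]
    generalize (comul (R := K) a) = z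
    induction z using TensorProduct.induction_on with
    | zero => simp
    | tmul b c => simpa [add_mul] using (LieDerivation.apply_lie_eq_add (d n) _ _).trans (add_comm
        _ _)
    | add z z' hz hz' => simp only [map_add, mul_add, hz, hz']

/-- Leibniz rule for a primitive n, propagated to products through the coproduct. With `envAct_one`,
`counit_envAct` and `comul_envAct` it makes 𝒰(𝔤) a module bialgebra over 𝒰(𝔫). -/
theorem envAct_mul (a : 𝓤 K N) (A B : 𝓤 K L) : envAct d a (A * B) =
    LinearMap.mul' K (𝓤 K L) (TensorProduct.map
      ((envAct d).toLinearMap.flip A) ((envAct d).toLinearMap.flip B) (comul a)) := by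
  induction a using enveloping_induction with
  | one => simp [Algebra.TensorProduct.one_def]
  | add a b ha hb => simp [ha, hb]
  | smul c a ha => simp [ha]
  | ι_mul n a ha =>
    rw [map_mul (envAct d), Module.End.mul_apply, ha, envAct_ι, Bialgebra.comul_mul, comul_ι]
    generalize (comul (R := K) a) = z
    induction z using TensorProduct.induction_on with
    | zero => simp
    | tmul b c => simp [add_mul, envelopingDerivation_mul]
    | add z z' hz hz' => simp only [map_add, mul_add, hz, hz']

@[simp]
theorem envAct_one (a : 𝓤 K N) : envAct d a 1 = counit (R := K) a • 1 := by
  induction a using enveloping_induction with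
  | one => simp
  | add a b ha hb => simp [ha, hb, add_smul]
  | smul c a ha => simp [ha, smul_smul]
  | ι_mul n a ha => simp [ha]

@[simp]
theorem counit_envAct (a : 𝓤 K N) (A : 𝓤 K L) :
    counit (R := K) (envAct d a A) = counit (R := K) a * counit (R := K) A := by
  induction a using enveloping_induction with
  | one => simp
  | add a b ha hb => simp [ha, hb, add_mul]
  | smul c a ha => simp [ha, mul_assoc]
  | ι_mul n a ha => simp

theorem comul_envAct (a : 𝓤 K N) (A : 𝓤 K L) :
    comul (R := K) (envAct d a A) =
      TensorProduct.map₂ (envAct d).toLinearMap (envAct d).toLinearMap (comul a) (comul A) := by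
  induction a using enveloping_induction with
  | one =>
    simp only [map_one, Module.End.one_apply, Bialgebra.comul_one, Algebra.TensorProduct.one_def]
    generalize (comul (R := K) A) = z
    induction z using TensorProduct.induction_on with
    | zero => simp
    | tmul b c => simp
    | add z z' hz hz' => rw [map_add, ← hz, ← hz']
  | add a b ha hb => simp [ha, hb]
  | smul c a ha => simp [ha]
  | ι_mul n a ha =>
    rw [map_mul, Module.End.mul_apply, envAct_ι, comul_envelopingDerivation, ha,
      Bialgebra.comul_mul, comul_ι]
    generalize (comul (R := K) a) = z
    generalize (comul (R := K) A) = y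
    induction z using TensorProduct.induction_on with
    | zero => simp
    | tmul b c =>
      induction y using TensorProduct.induction_on with
      | zero => simp
      | tmul B C => simp [add_mul]
      | add z z' hz hz' => simp only [map_add] at hz hz' ⊢; rw [← hz, ← hz']; abel
    | add z z' hz hz' =>
      simp only [map_add, mul_add, LinearMap.add_apply] at hz hz' ⊢; rw [← hz, ← hz']; abel

end

variable {d : N →ₗ⁅K⁆ LieDerivation K L L} {M : N →ₗ⁅K⁆ Module.End K (𝓤 K L)}

/-- `M n` is the sum of the action of `n` by a derivation and of a left multiplication. -/
def IsTwistedAction (d : N →ₗ⁅K⁆ LieDerivation K L L) (M : N →ₗ⁅K⁆ Module.End K (𝓤 K L)) : Prop :=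
  ∀ n, ∃ x : L, ∀ A, M n A = ιᵤ K x * A + envelopingDerivation (d n) A

variable (M) in
/-- The orbit map of the unit. -/
def orbitMap : 𝓤 K N →ₗ[K] 𝓤 K L :=
  LinearMap.applyₗ (1 : 𝓤 K L) ∘ₗ (UniversalEnvelopingAlgebra.lift K M).toLinearMap

@[simp]
theorem orbitMap_one : orbitMap M 1 = 1 := by simp [orbitMap]

theorem orbitMap_mul (a b : 𝓤 K N) :
    orbitMap M (a * b) = UniversalEnvelopingAlgebra.lift K M a (orbitMap M b) := by
  simp [orbitMap]

theorem orbitMap_ι_mul (n : N) (b : 𝓤 K N) :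
    orbitMap M (ιᵤ K n * b) = M n (orbitMap M b) := by
  simp [orbitMap]

theorem IsTwistedAction.map_mul (h : IsTwistedAction d M) (n : N) (A B : 𝓤 K L) :
    M n (A * B) = M n A * B + A * envelopingDerivation (d n) B := by
  obtain ⟨x, hx⟩ := h n
  rw [hx, hx, envelopingDerivation_mul]; noncomm_ring

/-- Left multiplication by a primitive element and the derivation part are both coderivations. -/
theorem IsTwistedAction.comul_apply (h : IsTwistedAction d M) (n : N) (A : 𝓤 K L) :
    comul (R := K) (M n A) = (M n).rTensor (𝓤 K L) (comul A) + (M n).lTensor (𝓤 K L) (comul A) := by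
  obtain ⟨x, hx⟩ := h n
  have hM : M n = LinearMap.mulLeft K (ιᵤ K x) + envelopingDerivation (d n) :=
    LinearMap.ext hx
  rw [hx, map_add, comul_envelopingDerivation, Bialgebra.comul_mul, comul_ι, hM,
    LinearMap.rTensor_add, LinearMap.lTensor_add, LinearMap.add_apply, LinearMap.add_apply]
  generalize (comul (R := K) A) = z
  induction z using TensorProduct.induction_on with
  | zero => simp
  | tmul b c => simp [add_mul]; abel
  | add z z' hz hz' =>
    simp only [map_add, mul_add] at hz hz' ⊢
    linear_combination (norm := abel) hz + hz'

theorem IsTwistedAction.counit_apply (h : IsTwistedAction d M) (n : N) (A : 𝓤 K L) :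
    counit (R := K) (M n A) = 0 := by
  obtain ⟨x, hx⟩ := h n
  simp [hx]

theorem IsTwistedAction.lift_mul (h : IsTwistedAction d M) (a : 𝓤 K N) (A B : 𝓤 K L) :
    UniversalEnvelopingAlgebra.lift K M a (A * B) =
    LinearMap.mul' K (𝓤 K L) (TensorProduct.map
      ((UniversalEnvelopingAlgebra.lift K M).toLinearMap.flip A)
      ((envAct d).toLinearMap.flip B) (comul a)) := by
  induction a using enveloping_induction with
  | one => simp [Algebra.TensorProduct.one_def]
  | add a b ha hb => simp [ha, hb]
  | smul c a ha => simp [ha]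
  | ι_mul n a ha =>
    rw [_root_.map_mul (UniversalEnvelopingAlgebra.lift K M), Module.End.mul_apply, ha,
        UniversalEnvelopingAlgebra.lift_ι_apply,
      Bialgebra.comul_mul, comul_ι]
    generalize (comul (R := K) a) = z
    induction z using TensorProduct.induction_on with
    | zero => simp
    | tmul b c => simp [add_mul, h.map_mul]
    | add z z' hz hz' => simp only [map_add, mul_add, hz, hz']

/-- The case A = 1 of `IsTwistedAction.lift_mul`. Read through the orbit map, this is the formula A
∗ B = A₍₁₎ (A₍₂₎ ▷ B). -/
theorem IsTwistedAction.lift_apply (h : IsTwistedAction d M) (a : 𝓤 K N) (B : 𝓤 K L) :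
    UniversalEnvelopingAlgebra.lift K M a B =
    LinearMap.mul' K (𝓤 K L) (TensorProduct.map (orbitMap M)
      ((envAct d).toLinearMap.flip B) (comul a)) := by
  have := h.lift_mul a 1 B
  rw [one_mul] at this
  exact this

/-- The unit is group-like and each n acts by a coderivation, so the orbit map respects coproducts.
-/
theorem IsTwistedAction.comul_orbitMap (h : IsTwistedAction d M) (a : 𝓤 K N) :
    comul (R := K) (orbitMap M a) = TensorProduct.map (orbitMap M) (orbitMap M) (comul a) := by
  induction a using enveloping_induction with
  | one => simp [Algebra.TensorProduct.one_def]
  | add a b ha hb => simp [ha, hb]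
  | smul c a ha => simp [ha]
  | ι_mul n a ha =>
    rw [orbitMap_ι_mul, h.comul_apply, ha, Bialgebra.comul_mul, comul_ι]
    generalize (comul (R := K) a) = z
    induction z using TensorProduct.induction_on with
    | zero => simp
    | tmul b c => simp [add_mul, orbitMap_ι_mul]
    | add z z' hz hz' =>
      simp only [map_add, mul_add] at hz hz' ⊢; rw [← hz, ← hz']; abel

theorem IsTwistedAction.counit_orbitMap (h : IsTwistedAction d M) (a : 𝓤 K N) :
    counit (R := K) (orbitMap M a) = counit (R := K) a := by
  induction a using enveloping_induction with
  | one => simp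
  | add a b ha hb => simp [ha, hb]
  | smul c a ha => simp [ha]
  | ι_mul n a ha => simp [orbitMap_ι_mul, h.counit_apply]

end Actions

-- The sub-adjacent Lie algebra and the recursion on 𝒰(𝔤)

section SubAdjacentLieAlgebra

variable {K : Type*} [Field K] {L : Type*} [LieRing L] [LieAlgebra K L]

/-- The underlying space of a post-Lie algebra, with the bracket
`⟦x, y⟧ = [x, y] + x ▷ y - y ▷ x`. -/
def SubAdjacent {t : L →ₗ[K] L →ₗ[K] L} (_ : IsPostLie t) : Type _ := L

variable {t : L →ₗ[K] L →ₗ[K] L} (ht : IsPostLie t)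

instance : AddCommGroup (SubAdjacent ht) := inferInstanceAs (AddCommGroup L)

instance : Module K (SubAdjacent ht) := inferInstanceAs (Module K L)

/-- The identity, from a post-Lie algebra to its sub-adjacent Lie algebra. -/
def toSubAdjacent : L ≃ₗ[K] SubAdjacent ht := LinearEquiv.refl K L

instance : Bracket (SubAdjacent ht) (SubAdjacent ht) where
  bracket x y := toSubAdjacent ht (⁅(toSubAdjacent ht).symm x, (toSubAdjacent ht).symm y⁆ +
    t ((toSubAdjacent ht).symm x) ((toSubAdjacent ht).symm y) -
    t ((toSubAdjacent ht).symm y) ((toSubAdjacent ht).symm x))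

theorem toSubAdjacent_symm_lie (x y : SubAdjacent ht) : (toSubAdjacent ht).symm ⁅x, y⁆ =
    ⁅(toSubAdjacent ht).symm x, (toSubAdjacent ht).symm y⁆ +
    t ((toSubAdjacent ht).symm x) ((toSubAdjacent ht).symm y) -
    t ((toSubAdjacent ht).symm y) ((toSubAdjacent ht).symm x) := rfl

instance : LieRing (SubAdjacent ht) where
  add_lie x y z := (toSubAdjacent ht).symm.injective (by
    simp only [toSubAdjacent_symm_lie, map_add, add_lie, LinearMap.add_apply]; abel)
  lie_add x y z := (toSubAdjacent ht).symm.injective (by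
    simp only [toSubAdjacent_symm_lie, map_add, lie_add, LinearMap.add_apply]; abel)
  lie_self x := (toSubAdjacent ht).symm.injective (by simp [toSubAdjacent_symm_lie])
  leibniz_lie x y z := (toSubAdjacent ht).symm.injective (by
    simp only [toSubAdjacent_symm_lie, map_add, map_sub, lie_add, lie_sub, add_lie, sub_lie,
      LinearMap.add_apply, LinearMap.sub_apply, ht.lie_left, ht.lie_right]
    generalize (toSubAdjacent ht).symm x = a
    generalize (toSubAdjacent ht).symm y = b
    generalize (toSubAdjacent ht).symm z = c
    -- Once the post-Lie identities have been expanded, only the Jacobi identity of the original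
    -- bracket and one antisymmetry are missing.
    rw [leibniz_lie a b c, ← lie_skew (t c a) b]
    abel)

instance : LieAlgebra K (SubAdjacent ht) where
  lie_smul c x y := (toSubAdjacent ht).symm.injective (by
    simp [toSubAdjacent_symm_lie, smul_sub])

/-- The action of the sub-adjacent Lie algebra by left post-Lie multiplications. -/
def leftDerivation : SubAdjacent ht →ₗ⁅K⁆ LieDerivation K L L where
  toFun x := ⟨t ((toSubAdjacent ht).symm x), fun y z => by
    rw [ht.lie_right, ← lie_skew _ z]; abel⟩
  map_add' x y := by ext z; simp
  map_smul' c x := by ext z; simp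
  map_lie' {x y} := by
    ext z
    simp [toSubAdjacent_symm_lie, ht.lie_left]
    abel

theorem leftDerivation_apply (x : SubAdjacent ht) (y : L) :
    leftDerivation ht x y = t ((toSubAdjacent ht).symm x) y := rfl

/-- The action `x ∗ A = x A + x ▷ A` of the sub-adjacent Lie algebra on `𝒰(𝔤)`. -/
def twistedAction : SubAdjacent ht →ₗ⁅K⁆ Module.End K (𝓤 K L) where
  toFun x := LinearMap.mulLeft K (ιᵤ K ((toSubAdjacent ht).symm x)) +
    envelopingDerivationHom K L (leftDerivation ht x)
  map_add' x y := by
    ext A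
    rw [map_add (leftDerivation ht), map_add (envelopingDerivationHom K L)]
    simp [add_mul]; abel
  map_smul' c x := by
    ext A
    rw [map_smul (leftDerivation ht), map_smul (envelopingDerivationHom K L)]
    simp
  map_lie' {x y} := by
    ext A
    rw [LieHom.map_lie, LieHom.map_lie]
    simp [LieRing.of_associative_ring_bracket, toSubAdjacent_symm_lie, envelopingDerivation_mul,
      leftDerivation_apply]
    noncomm_ring

theorem twistedAction_apply (x : SubAdjacent ht) (A : 𝓤 K L) :
    twistedAction ht x A = ιᵤ K ((toSubAdjacent ht).symm x) * A +
      envelopingDerivation (leftDerivation ht x) A := rfl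

theorem isTwistedAction_twistedAction :
    IsTwistedAction (leftDerivation ht) (twistedAction ht) :=
  fun x => ⟨_, twistedAction_apply ht x⟩

local notation "ιₜ" => TensorAlgebra.ι

/-- The defining relations of `𝒰(𝔤)` inside the tensor algebra. -/
def lieRelation (K : Type*) [Field K] {L : Type*} [LieRing L] [LieAlgebra K L] (x y : L) :
    TensorAlgebra K L :=
  ιₜ K x * ιₜ K y - ιₜ K y * ιₜ K x - ιₜ K ⁅x, y⁆

/-- Since x ▷ · is a derivation of the bracket, it sends defining relations to sums of defining
relations. -/
theorem tensorDerivation_lieRelation (ht : IsPostLie t) (x y z : L) :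
    tensorDerivation t x (lieRelation K y z) =
      lieRelation K (t x y) z + lieRelation K y (t x z) := by
  simp only [lieRelation, map_sub, tensorDerivation_mul, tensorDerivation_ι, ht.lie_right, map_add]
  noncomm_ring

section Descent

variable {E : Type*} [AddCommGroup E] [Module K E] (m : SubAdjacent ht →ₗ⁅K⁆ Module.End K E) (e : E)

/-- Induction on the length k of the prefix B standing before the relation. The statement is kept
general in B, y, z and A because peeling off a letter x applies D x to each of these factors. -/
theorem graftRec_lieRelation (k : ℕ) (B : TensorAlgebra K L)
    (hB : B ∈ LinearMap.range (ιₜ K (M := L)) ^ k) (y z : L) (A : TensorAlgebra K L) :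
    graftRec t ((m : SubAdjacent ht →ₗ[K] Module.End K E) ∘ₗ (toSubAdjacent ht).toLinearMap) e
      (B * lieRelation K y z * A) = 0 := by
  set f := graftRec t ((m : SubAdjacent ht →ₗ[K] Module.End K E) ∘ₗ
    (toSubAdjacent ht).toLinearMap) e with hf
  have hrec : ∀ x A, f (ιₜ K x * A) = m (toSubAdjacent ht x) (f A) - f (tensorDerivation t x A) :=
    fun x A => by rw [hf, graftRec_ι_mul]; rfl
  have hm : ∀ x y A, m (toSubAdjacent ht ⁅x, y⁆) A =
      m (toSubAdjacent ht x) (m (toSubAdjacent ht y) A) -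
      m (toSubAdjacent ht y) (m (toSubAdjacent ht x) A) - m (toSubAdjacent ht (t x y)) A +
      m (toSubAdjacent ht (t y x)) A := fun x y A => by
    have h : toSubAdjacent ht ⁅x, y⁆ = ⁅toSubAdjacent ht x, toSubAdjacent ht y⁆ -
        toSubAdjacent ht (t x y) + toSubAdjacent ht (t y x) :=
      (toSubAdjacent ht).symm.injective (by simp [toSubAdjacent_symm_lie]; abel)
    rw [h]
    simp [LieRing.of_associative_ring_bracket]
  -- The first post-Lie identity, extended from vectors to words: both sides are derivations of the
  -- tensor algebra.
  have hD : ∀ (x y : L) (A : TensorAlgebra K L), tensorDerivation t ⁅x, y⁆ A =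
      tensorDerivation t x (tensorDerivation t y A) - tensorDerivation t y (tensorDerivation t x A)
      - tensorDerivation t (t x y) A + tensorDerivation t (t y x) A := fun x y A => by
    induction A using tensorAlgebra_induction with
    | one => simp
    | add a b ha hb => simp only [map_add, ha, hb]; abel
    | smul c a ha => simp only [map_smul, ha, smul_add, smul_sub]
    | ι_mul z a ha =>
      simp only [tensorDerivation_ι_mul, ha, map_add, ht.lie_left, map_sub]
      noncomm_ring
  induction k generalizing B y z A with
  | zero =>
    rw [pow_zero, Submodule.mem_one] at hB
    obtain ⟨c, rfl⟩ := hB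
    rw [Algebra.algebraMap_eq_smul_one, smul_mul_assoc, smul_mul_assoc, one_mul, map_smul]
    convert smul_zero c
    -- Unfolding the recursion twice, the corrections x ▷ y and y ▷ x coming from the sub-adjacent
    -- bracket cancel those coming from D.
    simp only [lieRelation, sub_mul, mul_assoc, map_sub, hrec, tensorDerivation_ι_mul, map_add, hm,
      hD]
    abel
  | succ k ih =>
    rw [pow_succ'] at hB
    induction hB using Submodule.mul_induction_on' with
    | mem_mul_mem x hx b hb =>
      obtain ⟨x, rfl⟩ := hx
      rw [mul_assoc, mul_assoc, hrec, ← mul_assoc, ih b hb, map_zero, tensorDerivation_mul,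
        tensorDerivation_mul, tensorDerivation_lieRelation ht, add_mul, mul_add, add_mul,
        map_add, map_add, map_add, ih _ (tensorDerivation_mem t x k b hb), ih b hb, ih b hb,
        ih b hb]
      simp
    | add a _ b _ ha hb => rw [add_mul, add_mul, map_add, ha, hb, add_zero]

/-- The left ideal of words containing a defining relation of `𝒰(𝔤)`. -/
def lieRelationIdeal (K L : Type*) [Field K] [LieRing L] [LieAlgebra K L] :
    Submodule K (TensorAlgebra K L) :=
  Submodule.span K {a | ∃ B y z A, a = B * lieRelation K y z * A}

theorem mul_mem_lieRelationIdeal (a b : TensorAlgebra K L) (hb : b ∈ lieRelationIdeal K L) :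
    a * b ∈ lieRelationIdeal K L := by
  induction hb using Submodule.span_induction with
  | mem b hb =>
    obtain ⟨B, y, z, A, rfl⟩ := hb
    exact Submodule.subset_span ⟨a * B, y, z, A, by simp only [mul_assoc]⟩
  | zero => simp
  | add b c _ _ hb hc => rw [mul_add]; exact add_mem hb hc
  | smul c b _ hb => rw [mul_smul_comm]; exact Submodule.smul_mem _ _ hb

theorem lieRelation_mul_mem_lieRelationIdeal (y z : L) (A : TensorAlgebra K L) :
    lieRelation K y z * A ∈ lieRelationIdeal K L :=
  Submodule.subset_span ⟨1, y, z, A, by rw [one_mul]⟩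

theorem graftRec_eq_zero_of_mem (a : TensorAlgebra K L) (ha : a ∈ lieRelationIdeal K L) :
    graftRec t ((m : SubAdjacent ht →ₗ[K] Module.End K E) ∘ₗ (toSubAdjacent ht).toLinearMap) e
      a = 0 := by
  induction ha using Submodule.span_induction with
  | mem a ha =>
    obtain ⟨B, y, z, A, rfl⟩ := ha
    induction B using DirectSum.Decomposition.inductionOn
      ((LinearMap.range (ιₜ K (M := L)) ^ ·) : ℕ → Submodule K (TensorAlgebra K L)) with
    | zero => simp
    | @homogeneous k B => exact graftRec_lieRelation ht m e k B B.2 y z A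
    | add a b ha hb => rw [add_mul, add_mul, map_add, ha, hb, add_zero]
  | zero => simp
  | add b c _ _ hb hc => rw [map_add, hb, hc, add_zero]
  | smul c b _ hb => rw [map_smul, hb, smul_zero]

/-- Left multiplication on the quotient of the tensor algebra by the relations of `𝒰(𝔤)`. -/
def quotientMulLeft (a : TensorAlgebra K L) :
    Module.End K (TensorAlgebra K L ⧸ lieRelationIdeal K L) :=
  Submodule.mapQ _ _ (LinearMap.mulLeft K a) fun b hb => mul_mem_lieRelationIdeal a b hb

theorem quotientMulLeft_mk (a b : TensorAlgebra K L) :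
    quotientMulLeft a (Submodule.Quotient.mk b) = Submodule.Quotient.mk (a * b) := rfl

/-- The action of `𝒰(𝔤)` on the quotient of the tensor algebra by its relations. -/
def envelopingQuotientAction (K L : Type*) [Field K] [LieRing L] [LieAlgebra K L] :
    𝓤 K L →ₐ[K] Module.End K (TensorAlgebra K L ⧸ lieRelationIdeal K L) :=
  UniversalEnvelopingAlgebra.lift K
    { toFun := fun x => quotientMulLeft (ιₜ K x)
      map_add' := fun x y => by
        ext b
        change (Submodule.Quotient.mk (ιₜ K (x + y) * b) : TensorAlgebra K L ⧸ _) =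
          Submodule.Quotient.mk (ιₜ K x * b + ιₜ K y * b)
        rw [map_add, add_mul]
      map_smul' := fun c x => by
        ext b
        change (Submodule.Quotient.mk (ιₜ K (c • x) * b) : TensorAlgebra K L ⧸ _) =
          Submodule.Quotient.mk (c • (ιₜ K x * b))
        rw [map_smul, smul_mul_assoc]
      map_lie' := fun {x y} => by
        apply LinearMap.ext
        intro b
        obtain ⟨b, rfl⟩ := Submodule.Quotient.mk_surjective _ b
        simp only [LieRing.of_associative_ring_bracket, LinearMap.sub_apply, Module.End.mul_apply,
          quotientMulLeft_mk, ← Submodule.Quotient.mk_sub]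
        refine ((Submodule.Quotient.eq _).2 ?_).symm
        convert lieRelation_mul_mem_lieRelationIdeal x y b using 1
        simp only [lieRelation]; noncomm_ring }

/-- Acting on the class of 1 recovers the class of a word modulo the relations. This gives a linear
map from 𝒰(𝔤) back to the quotient, along which functions killing the relations descend. -/
theorem envelopingQuotientAction_mkAlgHom (a b : TensorAlgebra K L) :
    envelopingQuotientAction K L (UniversalEnvelopingAlgebra.mkAlgHom K L a)
      (Submodule.Quotient.mk b) = Submodule.Quotient.mk (a * b) := by
  induction a using tensorAlgebra_induction with
  | one => simp
  | add a a' ha hb => simp [ha, hb, add_mul]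
  | smul c a ha => simp [ha]
  | ι_mul x a ha =>
    have h : UniversalEnvelopingAlgebra.mkAlgHom K L (ιₜ K x) = ιᵤ K x := rfl
    rw [map_mul, map_mul, Module.End.mul_apply, ha, h]
    simp [envelopingQuotientAction, quotientMulLeft_mk, mul_assoc]

theorem tensorDerivation_mkAlgHom (x : L) (a : TensorAlgebra K L) :
    UniversalEnvelopingAlgebra.mkAlgHom K L (tensorDerivation t x a) =
      envelopingDerivation (leftDerivation ht (toSubAdjacent ht x))
        (UniversalEnvelopingAlgebra.mkAlgHom K L a) := by
  have h : ∀ x, UniversalEnvelopingAlgebra.mkAlgHom K L (ιₜ K x) = ιᵤ K x := fun _ => rfl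
  induction a using tensorAlgebra_induction with
  | one => simp
  | add a a' ha hb => simp [ha, hb]
  | smul c a ha => simp [ha]
  | ι_mul y a ha =>
    simp [tensorDerivation_ι_mul, h, ha, envelopingDerivation_mul, leftDerivation_apply]

theorem mkAlgHom_surjective (a : 𝓤 K L) : ∃ b, UniversalEnvelopingAlgebra.mkAlgHom K L b = a := by
  induction a using enveloping_induction with
  | one => exact ⟨1, map_one _⟩
  | add a b ha hb =>
    obtain ⟨a, rfl⟩ := ha
    obtain ⟨b, rfl⟩ := hb
    exact ⟨a + b, map_add _ _ _⟩
  | smul c a ha => obtain ⟨a, rfl⟩ := ha; exact ⟨c • a, map_smul _ _ _⟩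
  | ι_mul x a ha => obtain ⟨a, rfl⟩ := ha; exact ⟨ιₜ K x * a, map_mul _ _ _⟩

/-- The recursion `φ 1 = e`, `φ (x A) = m x (φ A) - φ (x ▷ A)` has a solution on `𝒰(𝔤)`. -/
theorem exists_graftRec : ∃ f : 𝓤 K L →ₗ[K] E, f 1 = e ∧ ∀ x A, f (ιᵤ K x * A) =
    m (toSubAdjacent ht x) (f A) -
      f (envelopingDerivation (leftDerivation ht (toSubAdjacent ht x)) A) := by
  let f₀ := graftRec t ((m : SubAdjacent ht →ₗ[K] Module.End K E) ∘ₗ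
    (toSubAdjacent ht).toLinearMap) e
  let f : 𝓤 K L →ₗ[K] E :=
    Submodule.liftQ (lieRelationIdeal K L) f₀ (fun a ha => graftRec_eq_zero_of_mem ht m e a ha) ∘ₗ
      LinearMap.applyₗ (Submodule.Quotient.mk 1) ∘ₗ (envelopingQuotientAction K L).toLinearMap
  have hf : ∀ a, f (UniversalEnvelopingAlgebra.mkAlgHom K L a) = f₀ a := fun a => by
    simp only [f, LinearMap.comp_apply, AlgHom.toLinearMap_apply, LinearMap.applyₗ_apply_apply,
      envelopingQuotientAction_mkAlgHom, mul_one]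
    exact Submodule.liftQ_apply _ _ _
  refine ⟨f, ?_, fun x A => ?_⟩
  · rw [← map_one (UniversalEnvelopingAlgebra.mkAlgHom K L), hf]
    exact graftRec_one _ _ _
  · obtain ⟨a, rfl⟩ := mkAlgHom_surjective A
    have h : UniversalEnvelopingAlgebra.mkAlgHom K L (ιₜ K x) = ιᵤ K x := rfl
    rw [← h, ← map_mul, hf, hf, ← tensorDerivation_mkAlgHom, hf]
    exact graftRec_ι_mul _ _ _ _ _

end Descent

end SubAdjacentLieAlgebra

-- Existence and uniqueness of the Guin-Oudom extension

section GuinOudomExtension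

open Coalgebra (comul counit)

variable {K : Type*} [Field K] {L : Type*} [LieRing L] [LieAlgebra K L]

/-- Induction on word length: in the step, the induction hypothesis is available for all derivatives
of the shorter word. -/
theorem enveloping_derivation_induction (S : Submodule K L)
    (hS : Algebra.adjoin K (ιᵤ K '' (S : Set L)) = ⊤) (p : Submodule K (𝓤 K L)) (one : 1 ∈ p)
    (mul : ∀ x ∈ S, ∀ A ∈ p, (∀ δ : LieDerivation K L L, (∀ y ∈ S, δ y ∈ S) →
      envelopingDerivation δ A ∈ p) → ιᵤ K x * A ∈ p) (A : 𝓤 K L) : A ∈ p := by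
  set R : Submodule K (𝓤 K L) := S.map ((ιᵤ K : L →ₗ⁅K⁆ 𝓤 K L) : L →ₗ[K] 𝓤 K L)
  -- The words of length n in S span R ^ n, which these derivations preserve; hence an induction on
  -- n can supply the derivatives as well.
  have hδ : ∀ δ : LieDerivation K L L, (∀ y ∈ S, δ y ∈ S) → ∀ n, ∀ A ∈ R ^ n,
      envelopingDerivation δ A ∈ R ^ n := by
    intro δ hδ n
    induction n with
    | zero =>
      intro A hA
      rw [pow_zero, Submodule.mem_one] at hA
      obtain ⟨c, rfl⟩ := hA
      rw [Algebra.algebraMap_eq_smul_one, map_smul, envelopingDerivation_one, smul_zero]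
      exact zero_mem _
    | succ n ih =>
      intro A hA
      rw [pow_succ'] at hA ⊢
      induction hA using Submodule.mul_induction_on' with
      | mem_mul_mem y hy b hb =>
        obtain ⟨y, hy, rfl⟩ := hy
        rw [envelopingDerivation_mul]
        refine add_mem (Submodule.mul_mem_mul ⟨δ y, hδ y hy, ?_⟩ hb)
          (Submodule.mul_mem_mul ⟨y, hy, rfl⟩ (ih b hb))
        exact (envelopingDerivation_ι δ y).symm
      | add a _ b _ ha hb => rw [map_add]; exact add_mem ha hb
  have hp : ∀ n, R ^ n ≤ p := by
    intro n
    induction n with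
    | zero =>
      intro A hA
      rw [pow_zero, Submodule.mem_one] at hA
      obtain ⟨c, rfl⟩ := hA
      rw [Algebra.algebraMap_eq_smul_one]
      exact Submodule.smul_mem _ _ one
    | succ n ih =>
      intro A hA
      rw [pow_succ'] at hA
      induction hA using Submodule.mul_induction_on' with
      | mem_mul_mem y hy b hb =>
        obtain ⟨y, hy, rfl⟩ := hy
        exact mul y hy b (ih hb) fun δ h => ih (hδ δ h n b hb)
      | add a _ b _ ha hb => exact add_mem ha hb
  -- The sum of all R ^ n contains 1 and is stable under the generated subalgebra, which is
  -- everything.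
  have hmul : ∀ x ∈ S, ∀ B ∈ ⨆ n, R ^ n, ιᵤ K x * B ∈ ⨆ n, R ^ n := by
    intro x hx B hB
    induction hB using Submodule.iSup_induction' with
    | mem n B hB =>
      refine Submodule.mem_iSup_of_mem (n + 1) ?_
      rw [pow_succ']
      exact Submodule.mul_mem_mul ⟨x, hx, rfl⟩ hB
    | zero => simp
    | add a b _ _ ha hb => rw [mul_add]; exact add_mem ha hb
  have key : ∀ a ∈ Algebra.adjoin K (ιᵤ K '' (S : Set L)), ∀ B ∈ ⨆ n, R ^ n,
      a * B ∈ ⨆ n, R ^ n := by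
    intro a ha
    induction ha using Algebra.adjoin_induction with
    | mem x hx => obtain ⟨x, hx, rfl⟩ := hx; exact hmul x hx
    | algebraMap r =>
      intro b hb; rw [← Algebra.smul_def]; exact Submodule.smul_mem _ _ hb
    | add x y _ _ hx hy => intro b hb; rw [add_mul]; exact add_mem (hx b hb) (hy b hb)
    | mul x y _ _ hx hy => intro b hb; rw [mul_assoc]; exact hx _ (hy _ hb)
  have h := key A (by rw [hS]; trivial) 1
    (Submodule.mem_iSup_of_mem 0 (by rw [pow_zero]; exact Submodule.one_le.1 le_rfl))
  rw [mul_one] at h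
  exact iSup_le hp h

theorem adjoin_image_top :
    Algebra.adjoin K (ιᵤ K '' ((⊤ : Submodule K L) : Set L)) = ⊤ := by
  rw [Submodule.top_coe, Set.image_univ]
  exact adjoin_range_ι

/-- The coproduct of a product of primitive elements. -/
theorem comul_list_prod (l : List L) : comul (R := K) (l.map (ιᵤ K)).prod =
    ((unshuffles l).map fun p => (p.1.map (ιᵤ K)).prod ⊗ₜ[K] (p.2.map (ιᵤ K)).prod).sum := by
  induction l with
  | nil => simp [unshuffles, Algebra.TensorProduct.one_def]
  | cons x l ih =>
    rw [List.map_cons, List.prod_cons, Bialgebra.comul_mul, ih, comul_ι, unshuffles]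
    generalize unshuffles l = u
    induction u with
    | nil => simp
    | cons p u hu =>
      simp only [List.map_cons, List.sum_cons, mul_add, hu, List.flatMap_cons, List.map_append,
        List.sum_append]
      simp [add_mul]

theorem length_of_mem_unshuffles {α : Type*} {l : List α} {p : List α × List α}
    (hp : p ∈ unshuffles l) : p.1.length + p.2.length = l.length := by
  induction l generalizing p with
  | nil => simp [unshuffles] at hp; simp [hp]
  | cons x l ih =>
    simp only [unshuffles, List.mem_flatMap, List.mem_cons, List.not_mem_nil, or_false] at hp
    obtain ⟨q, hq, rfl | rfl⟩ := hp <;> have := ih hq <;> simp <;> omega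

theorem span_list_prod (a : 𝓤 K L) :
    a ∈ Submodule.span K (Set.range fun l : List L => (l.map (ιᵤ K)).prod) := by
  induction a using enveloping_induction with
  | one => exact Submodule.subset_span ⟨[], by simp⟩
  | add a b ha hb => exact add_mem ha hb
  | smul c a ha => exact Submodule.smul_mem _ _ ha
  | ι_mul x a ha =>
    induction ha using Submodule.span_induction with
    | mem a ha => obtain ⟨l, rfl⟩ := ha; exact Submodule.subset_span ⟨x :: l, by simp⟩
    | zero => simp
    | add b c _ _ hb hc => rw [mul_add]; exact add_mem hb hc
    | smul c b _ hb => rw [mul_smul_comm]; exact Submodule.smul_mem _ _ hb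

/-- A convolution idempotent of the enveloping algebra that vanishes on the unit is zero. -/
theorem eq_zero_of_convolution_idempotent (e : 𝓤 K L →ₗ[K] 𝓤 K L) (one : e 1 = 0)
    (he : ∀ A, LinearMap.mul' K (𝓤 K L) (TensorProduct.map e e (comul A)) = e A) : e = 0 := by
  have key : ∀ n, ∀ l : List L, l.length = n → e (l.map (ιᵤ K)).prod = 0 := by
    intro n
    induction n using Nat.strong_induction_on with
    | _ n ih =>
      intro l hl
      rw [← he, comul_list_prod, map_list_sum, map_list_sum]
      refine List.sum_eq_zero fun y hy => ?_
      simp only [List.map_map, List.mem_map, Function.comp_apply, TensorProduct.map_tmul,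
        LinearMap.mul'_apply] at hy
      obtain ⟨p, hp, rfl⟩ := hy
      -- Each term of the coproduct either has an empty side, killed by e 1 = 0, or has two strictly
      -- shorter sides.
      have h := length_of_mem_unshuffles hp
      by_cases h1 : p.1.length = 0
      · rw [List.length_eq_zero_iff.1 h1]; simp [one]
      by_cases h2 : p.2.length = 0
      · rw [List.length_eq_zero_iff.1 h2]; simp [one]
      rw [ih p.1.length (by omega) p.1 rfl, zero_mul]
  ext a
  induction span_list_prod a using Submodule.span_induction with
  | mem a ha => obtain ⟨l, rfl⟩ := ha; exact key _ l rfl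
  | zero => simp
  | add b c _ _ hb hc => rw [map_add, map_add, hb, hc]
  | smul c b _ hb => rw [map_smul, map_smul, hb]

section Uniqueness

variable {t : L →ₗ[K] L →ₗ[K] L} {g : 𝓤 K L →ₗ[K] 𝓤 K L →ₗ[K] 𝓤 K L}

/-- Multiplicativity with B = C = 1 makes F = (· ▷ 1) a convolution idempotent. Then 1 − F, with 1
the convolution unit, is an idempotent too, and it vanishes on the unit of 𝒰(𝔤), so it is zero. -/
theorem IsGuinOudomExtension.graft_one (hg : IsGuinOudomExtension t g) (A : 𝓤 K L) :
    g A 1 = counit (R := K) A • 1 := by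
  set F : WithConv (𝓤 K L →ₗ[K] 𝓤 K L) := WithConv.toConv (g.flip 1) with hF
  have hFF : F * F = F := by
    ext A
    have h := hg.graft_mul A 1 1
    rw [one_mul] at h
    exact h.symm
  have hI : (1 - F) * (1 - F) = 1 - F := by
    rw [mul_sub, sub_mul, sub_mul, hFF]; simp
  have h1F : ∀ A, (1 - F).ofConv A = counit (R := K) A • 1 - g A 1 := fun A => by
    rw [← Algebra.algebraMap_eq_smul_one]; rfl
  have h0 : (1 - F).ofConv = 0 := by
    apply eq_zero_of_convolution_idempotent
    · rw [h1F]; simp [hg.one_graft]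
    · intro A
      conv_rhs => rw [← hI]
      rfl
  have := h1F A
  rw [h0, LinearMap.zero_apply, eq_comm, sub_eq_zero] at this
  exact this.symm

theorem IsGuinOudomExtension.ι_graft_mul (hg : IsGuinOudomExtension t g) (x : L) (B C : 𝓤 K L) :
    g (ιᵤ K x) (B * C) = g (ιᵤ K x) B * C + B * g (ιᵤ K x) C := by
  simp [hg.graft_mul, hg.one_graft]

theorem IsGuinOudomExtension.ι_graft (hg : IsGuinOudomExtension t g) (ht : IsPostLie t) (x : L)
    (B : 𝓤 K L) : g (ιᵤ K x) B =
      envelopingDerivation (leftDerivation ht (toSubAdjacent ht x)) B := by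
  induction B using enveloping_induction with
  | one => simp [hg.graft_one]
  | add a b ha hb => rw [map_add, map_add, ha, hb]
  | smul c a ha => rw [map_smul, map_smul, ha]
  | ι_mul y a ha =>
    rw [hg.ι_graft_mul, ha, hg.extends_product, envelopingDerivation_mul, envelopingDerivation_ι]
    rfl

/-- The axiom `mul_graft` only covers right arguments in 𝔤. It spreads to products because A ▷ · is
multiplicative through the coproduct and x ▷ · is both a derivation and a coderivation. -/
theorem IsGuinOudomExtension.ι_mul_graft (hg : IsGuinOudomExtension t g) (ht : IsPostLie t) (x : L)
    (A B : 𝓤 K L) : g (ιᵤ K x * A) B =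
      g (ιᵤ K x) (g A B) - g (g (ιᵤ K x) A) B := by
  induction B using enveloping_induction generalizing A with
  | one => simp [hg.graft_one, hg.ι_graft ht]
  | add a b ha hb => simp only [map_add, ha, hb]; abel
  | smul c a ha => simp only [map_smul, ha, smul_sub]
  | ι_mul y C hC =>
    rw [hg.graft_mul, hg.graft_mul A, hg.graft_mul (g (ιᵤ K x) A), ← comul_eq_unshuffleCoproduct,
      ← comul_eq_unshuffleCoproduct, ← comul_eq_unshuffleCoproduct, hg.ι_graft ht x A,
      comul_envelopingDerivation, Bialgebra.comul_mul, comul_ι]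
    generalize comul (R := K) A = z
    induction z using TensorProduct.induction_on with
    | zero => simp
    | tmul b c =>
      simp only [add_mul, Algebra.TensorProduct.tmul_mul_tmul, one_mul, map_add,
        TensorProduct.map_tmul, LinearMap.flip_apply, LinearMap.mul'_apply, hC, hg.mul_graft,
        hg.ι_graft_mul, LinearMap.rTensor_tmul, LinearMap.lTensor_tmul, ← hg.ι_graft ht]
      noncomm_ring
    | add z z' hz hz' =>
      simp only [mul_add, map_add] at hz hz' ⊢
      linear_combination (norm := abel) hz + hz'

end Uniqueness

variable {t : L →ₗ[K] L →ₗ[K] L} (ht : IsPostLie t)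

/-- The inverse is the solution of the recursion in which x acts by left multiplication on
𝒰(`SubAdjacent`): it undoes x · A = xA + x ▷ A. -/
theorem bijective_orbitMap : Function.Bijective (orbitMap (twistedAction ht)) := by
  obtain ⟨f, hf1, hf⟩ := exists_graftRec ht
    ((Algebra.lmul K (𝓤 K (SubAdjacent ht))).toLieHom.comp (ιᵤ K)) 1
  have hl : ∀ a, f (orbitMap (twistedAction ht) a) = a := by
    intro a
    induction a using enveloping_induction with
    | one => simp [hf1]
    | add a b ha hb => rw [map_add, map_add, ha, hb]
    | smul c a ha => rw [map_smul, map_smul, ha]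
    | ι_mul x a ha =>
      rw [orbitMap_ι_mul, twistedAction_apply, map_add, hf, ha]
      simp
  -- The map f is a right inverse as well, by induction on word length: A and x ▷ A are both covered
  -- when xA is treated.
  refine ⟨Function.LeftInverse.injective hl, fun A => ⟨f A, ?_⟩⟩
  refine enveloping_derivation_induction ⊤ adjoin_image_top
    (LinearMap.eqLocus (orbitMap (twistedAction ht) ∘ₗ f) LinearMap.id) (by simp [hf1])
    (fun x _ A hA hD => ?_) A
  have h := hD (leftDerivation ht (toSubAdjacent ht x)) (fun _ _ => trivial)
  simp only [LinearMap.mem_eqLocus, LinearMap.comp_apply, LinearMap.id_apply] at hA h ⊢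
  rw [hf, map_sub, h]
  simp [orbitMap_ι_mul, hA, twistedAction_apply]

/-- The isomorphism of coalgebras from the enveloping algebra of the sub-adjacent Lie algebra to
`𝒰(𝔤)`. -/
def orbitEquiv : 𝓤 K (SubAdjacent ht) ≃ₗ[K] 𝓤 K L :=
  LinearEquiv.ofBijective _ (bijective_orbitMap ht)

theorem orbitEquiv_apply (a : 𝓤 K (SubAdjacent ht)) :
    orbitEquiv ht a = orbitMap (twistedAction ht) a := rfl

@[simp]
theorem orbitEquiv_symm_one : (orbitEquiv ht).symm 1 = 1 := by
  rw [LinearEquiv.symm_apply_eq]; simp [orbitEquiv_apply]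

theorem orbitEquiv_symm_ι_mul (x : L) (A : 𝓤 K L) : (orbitEquiv ht).symm (ιᵤ K x * A) =
    ιᵤ K (toSubAdjacent ht x) * (orbitEquiv ht).symm A -
      (orbitEquiv ht).symm (envelopingDerivation (leftDerivation ht (toSubAdjacent ht x)) A) := by
  rw [LinearEquiv.symm_apply_eq, map_sub, LinearEquiv.apply_symm_apply, orbitEquiv_apply,
    orbitMap_ι_mul, ← orbitEquiv_apply, LinearEquiv.apply_symm_apply, twistedAction_apply]
  simp

theorem orbitEquiv_ι_mul (x : SubAdjacent ht) (a : 𝓤 K (SubAdjacent ht)) :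
    orbitEquiv ht (ιᵤ K x * a) = ιᵤ K ((toSubAdjacent ht).symm x) * orbitEquiv ht a +
      envelopingDerivation (leftDerivation ht x) (orbitEquiv ht a) := by
  rw [orbitEquiv_apply, orbitMap_ι_mul, twistedAction_apply]; rfl

@[simp]
theorem orbitEquiv_symm_ι (x : L) :
    (orbitEquiv ht).symm (ιᵤ K x) = ιᵤ K (toSubAdjacent ht x) := by
  simpa using orbitEquiv_symm_ι_mul ht x 1

theorem comul_orbitEquiv_symm (A : 𝓤 K L) : comul (R := K) ((orbitEquiv ht).symm A) =
    TensorProduct.map (orbitEquiv ht).symm.toLinearMap (orbitEquiv ht).symm.toLinearMap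
      (comul A) := by
  obtain ⟨a, rfl⟩ := (orbitEquiv ht).surjective A
  rw [LinearEquiv.symm_apply_apply, orbitEquiv_apply,
    (isTwistedAction_twistedAction ht).comul_orbitMap, ← LinearMap.comp_apply,
    ← TensorProduct.map_comp]
  have : (orbitEquiv ht).symm.toLinearMap ∘ₗ orbitMap (twistedAction ht) = LinearMap.id :=
    LinearMap.ext fun a => (orbitEquiv ht).symm_apply_apply a
  rw [this, TensorProduct.map_id, LinearMap.id_apply]

theorem counit_orbitEquiv_symm (A : 𝓤 K L) :
    counit (R := K) ((orbitEquiv ht).symm A) = counit (R := K) A := by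
  obtain ⟨a, rfl⟩ := (orbitEquiv ht).surjective A
  rw [LinearEquiv.symm_apply_apply, orbitEquiv_apply,
    (isTwistedAction_twistedAction ht).counit_orbitMap]

/-- The Guin-Oudom extension of a post-Lie product. -/
def guinOudom : 𝓤 K L →ₗ[K] 𝓤 K L →ₗ[K] 𝓤 K L :=
  (envAct (leftDerivation ht)).toLinearMap ∘ₗ (orbitEquiv ht).symm.toLinearMap

theorem guinOudom_apply (A B : 𝓤 K L) :
    guinOudom ht A B = envAct (leftDerivation ht) ((orbitEquiv ht).symm A) B := rfl

/-- The axiom `mul_graft` is the recursion satisfied by the inverse orbit map, and `graft_mul` is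
the module algebra property carried over by an isomorphism of coalgebras. -/
theorem isGuinOudomExtension_guinOudom : IsGuinOudomExtension t (guinOudom ht) where
  extends_product x y := by
    rw [guinOudom_apply, orbitEquiv_symm_ι, envAct_ι, envelopingDerivation_ι]; rfl
  one_graft A := by simp [guinOudom_apply]
  mul_graft x y A := by
    simp only [guinOudom_apply]
    rw [orbitEquiv_symm_ι_mul, map_sub, map_mul]
    simp
  graft_mul A B C := by
    rw [guinOudom_apply, envAct_mul, comul_orbitEquiv_symm, ← comul_eq_unshuffleCoproduct,
      ← LinearMap.comp_apply (TensorProduct.map _ _), ← TensorProduct.map_comp]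
    rfl

/-- Any extension agrees with the derivation x ▷ · for x in 𝔤. The formula for xA ▷ B then involves
only A and x ▷ A, of smaller word length than xA. -/
theorem IsGuinOudomExtension.eq_guinOudom {g : 𝓤 K L →ₗ[K] 𝓤 K L →ₗ[K] 𝓤 K L}
    (hg : IsGuinOudomExtension t g) : g = guinOudom ht := by
  have hg' := isGuinOudomExtension_guinOudom ht
  ext1 A
  refine enveloping_derivation_induction ⊤ adjoin_image_top
    (LinearMap.eqLocus g (guinOudom ht)) ?_ (fun x _ A hA hD => ?_) A
  · ext B
    rw [hg.one_graft, hg'.one_graft]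
  · have h := hD (leftDerivation ht (toSubAdjacent ht x)) (fun _ _ => trivial)
    rw [LinearMap.mem_eqLocus] at hA h ⊢
    ext B
    rw [hg.ι_mul_graft ht, hg'.ι_mul_graft ht, hg.ι_graft ht x, hg'.ι_graft ht x, hA,
      hg.ι_graft ht x, hg'.ι_graft ht x, h]

/-- This identifies ∗ with the product of 𝒰(`SubAdjacent`), so associativity and compatibility with
Δ come for free. -/
theorem starProduct_guinOudom (A B : 𝓤 K L) : starProduct (guinOudom ht) A B =
    orbitEquiv ht ((orbitEquiv ht).symm A * (orbitEquiv ht).symm B) := by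
  rw [orbitEquiv_apply, orbitMap_mul, ← orbitEquiv_apply, LinearEquiv.apply_symm_apply,
    (isTwistedAction_twistedAction ht).lift_apply, comul_orbitEquiv_symm, starProduct,
    ← comul_eq_unshuffleCoproduct, ← LinearMap.comp_apply (TensorProduct.map _ _),
    ← TensorProduct.map_comp]
  have : orbitMap (twistedAction ht) ∘ₗ (orbitEquiv ht).symm.toLinearMap = LinearMap.id :=
    LinearMap.ext fun A => (orbitEquiv ht).apply_symm_apply A
  rw [this]
  rfl

end GuinOudomExtension

-- Pairings of tensor products

section DualPairing

variable {K : Type*} [Field K]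

section

variable {H H' H₁ H₁' V V' V₁ V₁' : Type*} [AddCommGroup H] [Module K H] [AddCommGroup H']
  [Module K H'] [AddCommGroup V] [Module K V] [AddCommGroup V'] [Module K V']
  [AddCommGroup H₁] [Module K H₁] [AddCommGroup H₁']
  [Module K H₁'] [AddCommGroup V₁] [Module K V₁] [AddCommGroup V₁'] [Module K V₁']

/-- The pairing of `H ⊗ H'` with `V ⊗ V'` induced by pairings of `H` with `V` and of `H'` with
`V'`. -/
def dualPair (P : H →ₗ[K] Module.Dual K V) (P' : H' →ₗ[K] Module.Dual K V') :
    H ⊗[K] H' →ₗ[K] Module.Dual K (V ⊗[K] V') :=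
  TensorProduct.dualDistrib K V V' ∘ₗ TensorProduct.map P P'

@[simp]
theorem dualPair_tmul (P : H →ₗ[K] Module.Dual K V) (P' : H' →ₗ[K] Module.Dual K V') (h : H)
    (h' : H') (A : V) (B : V') : dualPair P P' (h ⊗ₜ h') (A ⊗ₜ B) = P h A * P' h' B := by
  simp [dualPair]

/-- Write z in a basis of H'. Fixing A yields a combination of basis vectors annihilated by P',
hence zero; so every coefficient h in H has P h A = 0 for all A. No finite dimension is needed. -/
theorem dualPair_injective {P : H →ₗ[K] Module.Dual K V} {P' : H' →ₗ[K] Module.Dual K V'}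
    (hP : Function.Injective P) (hP' : Function.Injective P') :
    Function.Injective (dualPair P P') := by
  rw [injective_iff_map_eq_zero]
  intro z hz
  classical
  let b := Module.Basis.ofVectorSpace K H'
  obtain ⟨c, rfl⟩ := (TensorProduct.equivFinsuppOfBasisRight (M := H) b).symm.surjective z
  rw [TensorProduct.equivFinsuppOfBasisRight_symm_apply] at hz
  have h : c = 0 := by
    ext i
    apply hP
    ext A
    have h1 : Finsupp.linearCombination K b (c.mapRange (fun h => P h A) (by simp)) = 0 := by
      apply hP'
      ext B
      have := LinearMap.congr_fun hz (A ⊗ₜ B)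
      rw [Finsupp.linearCombination_apply, Finsupp.sum_mapRange_index (by simp)]
      simpa [Finsupp.sum] using this
    have h2 := b.linearIndependent
    rw [linearIndependent_iff] at h2
    simpa using DFunLike.congr_fun (h2 _ h1) i
  rw [h, map_zero]

theorem dualPair_map (P : H →ₗ[K] Module.Dual K V) (P' : H' →ₗ[K] Module.Dual K V')
    (P₁ : H₁ →ₗ[K] Module.Dual K V₁) (P₁' : H₁' →ₗ[K] Module.Dual K V₁')
    {φ : H →ₗ[K] H₁} {ψ : H' →ₗ[K] H₁'} {F : V₁ →ₗ[K] V} {G : V₁' →ₗ[K] V'}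
    (hφ : ∀ h, P₁ (φ h) = P h ∘ₗ F) (hψ : ∀ h, P₁' (ψ h) = P' h ∘ₗ G) (z : H ⊗[K] H') :
    dualPair P₁ P₁' (TensorProduct.map φ ψ z) = dualPair P P' z ∘ₗ TensorProduct.map F G := by
  apply TensorProduct.ext'
  intro A B
  induction z using TensorProduct.induction_on with
  | zero => simp
  | tmul h h' => simp [hφ, hψ]
  | add z z' hz hz' =>
    simp only [map_add, LinearMap.add_apply, LinearMap.add_comp, hz, hz']

variable {H'' V'' : Type*} [AddCommGroup H''] [Module K H''] [AddCommGroup V''] [Module K V'']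

theorem dualPair_assoc (P : H →ₗ[K] Module.Dual K V) (P' : H' →ₗ[K] Module.Dual K V')
    (P'' : H'' →ₗ[K] Module.Dual K V'') (z : (H ⊗[K] H') ⊗[K] H'') :
    dualPair P (dualPair P' P'') (TensorProduct.assoc K H H' H'' z) =
      dualPair (dualPair P P') P'' z ∘ₗ (TensorProduct.assoc K V V' V'').symm.toLinearMap := by
  apply TensorProduct.ext'
  intro A BC
  induction BC using TensorProduct.induction_on with
  | zero => simp
  | add B C hB hC => rw [TensorProduct.tmul_add, map_add, map_add, hB, hC]
  | tmul B C =>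
    induction z using TensorProduct.induction_on with
    | zero => simp
    | add z z' hz hz' => simp only [map_add, LinearMap.add_apply, LinearMap.add_comp, hz, hz']
    | tmul z h'' =>
      induction z using TensorProduct.induction_on with
      | zero => simp
      | add z z' hz hz' =>
        simp only [TensorProduct.add_tmul, map_add, LinearMap.add_apply, LinearMap.add_comp, hz,
          hz']
      | tmul h h' => simp [mul_assoc]

/-- A linear map into the target of an injective map `j`, with values in the range of `j`, factors
through `j`. -/
theorem exists_linearMap_factor {X Y : Type*} [AddCommGroup X] [Module K X] [AddCommGroup Y]
    [Module K Y] {j : X →ₗ[K] Y} (hj : Function.Injective j) (F : H →ₗ[K] Y)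
    (hF : ∀ h, ∃ x, j x = F h) : ∃ c : H →ₗ[K] X, ∀ h, j (c h) = F h := by
  refine ⟨(LinearEquiv.ofInjective j hj).symm.toLinearMap ∘ₗ
    F.codRestrict (LinearMap.range j) hF, fun h => ?_⟩
  have := (LinearEquiv.ofInjective j hj).apply_symm_apply (F.codRestrict (LinearMap.range j) hF h)
  exact congrArg Subtype.val this

end

-- Restricted duals of Hopf algebras and the cointeraction theorem

open Coalgebra (comul counit)

/-- A space of linear forms on a Hopf algebra to which all structure maps can be transposed. -/
structure RestrictedDual (K V : Type*) [Field K] [Ring V] [HopfAlgebra K V] where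
  /-- The linear forms, as a subalgebra of the convolution algebra. -/
  forms : Subalgebra K (WithConv (V →ₗ[K] K))
  antipode_mem : ∀ f ∈ forms, WithConv.toConv (f.ofConv ∘ₗ HopfAlgebra.antipode K) ∈ forms
  exists_comul : ∀ f ∈ forms, ∃ l : List (WithConv (V →ₗ[K] K) × WithConv (V →ₗ[K] K)),
    (∀ p ∈ l, p.1 ∈ forms ∧ p.2 ∈ forms) ∧
      ∀ A B : V, f (A * B) = (l.map fun p => p.1 A * p.2 B).sum

namespace RestrictedDual

variable {V : Type*} [Ring V] [HopfAlgebra K V] (D : RestrictedDual K V)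

/-- The underlying type of a restricted dual. -/
def Carrier : Type _ := D.forms

instance : Ring D.Carrier := inferInstanceAs (Ring D.forms)

instance : Algebra K D.Carrier := inferInstanceAs (Algebra K D.forms)

/-- The inclusion of a restricted dual into the dual space. -/
def eval : D.Carrier →ₗ[K] Module.Dual K V where
  toFun f := f.1.ofConv
  map_add' _ _ := rfl
  map_smul' _ _ := rfl

theorem eval_injective : Function.Injective D.eval := fun _ _ h =>
  Subtype.ext (WithConv.ofConv_injective h)

theorem mem_range_eval (f : Module.Dual K V) :
    f ∈ LinearMap.range D.eval ↔ WithConv.toConv f ∈ D.forms :=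
  ⟨fun ⟨g, hg⟩ => hg ▸ g.2, fun h => ⟨⟨_, h⟩, rfl⟩⟩

theorem eval_mul (f g : D.Carrier) (A : V) : D.eval (f * g) A =
    TensorProduct.dualDistrib K V V (D.eval f ⊗ₜ D.eval g) (comul A) := by
  change LinearMap.mul' K K (TensorProduct.map (D.eval f) (D.eval g) (comul A)) = _
  generalize comul (R := K) A = z
  induction z using TensorProduct.induction_on with
  | zero => simp
  | tmul b c => simp
  | add z z' hz hz' => rw [map_add, map_add, hz, hz', map_add]

theorem eval_one (A : V) : D.eval 1 A = counit (R := K) A := rfl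

theorem eval_mul' (z : D.Carrier ⊗[K] D.Carrier) (A : V) :
    D.eval (LinearMap.mul' K D.Carrier z) A = dualPair D.eval D.eval z (comul A) := by
  induction z using TensorProduct.induction_on with
  | zero => simp
  | tmul f g => rw [LinearMap.mul'_apply, eval_mul]; rfl
  | add z z' hz hz' => simp only [map_add, LinearMap.add_apply, hz, hz']

theorem dualPair_mul {W : Type*} [Ring W] [HopfAlgebra K W] (D' : RestrictedDual K W)
    (z w : D.Carrier ⊗[K] D'.Carrier) (A : V) (B : W) :
    dualPair D.eval D'.eval (z * w) (A ⊗ₜ B) =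
      TensorProduct.dualDistrib K (V ⊗[K] W) (V ⊗[K] W)
        (dualPair D.eval D'.eval z ⊗ₜ dualPair D.eval D'.eval w)
        (TensorProduct.tensorTensorTensorComm K V V W W (comul A ⊗ₜ comul B)) := by
  induction z using TensorProduct.induction_on with
  | zero => simp
  | add z z' hz hz' =>
    rw [add_mul, map_add, LinearMap.add_apply, hz, hz', map_add, TensorProduct.add_tmul, map_add,
      LinearMap.add_apply]
  | tmul f g =>
    induction w using TensorProduct.induction_on with
    | zero => simp
    | add z z' hz hz' =>
      rw [mul_add, map_add, LinearMap.add_apply, hz, hz', map_add, TensorProduct.tmul_add, map_add,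
        LinearMap.add_apply]
    | tmul f' g' =>
      rw [Algebra.TensorProduct.tmul_mul_tmul, dualPair_tmul, eval_mul, eval_mul]
      generalize comul (R := K) A = a
      generalize comul (R := K) B = b
      induction a using TensorProduct.induction_on with
      | zero => simp
      | add a a' ha ha' => simp only [map_add, add_mul, ha, ha', TensorProduct.add_tmul]
      | tmul a a' =>
        induction b using TensorProduct.induction_on with
        | zero => simp
        | add b b' hb hb' => simp only [map_add, mul_add, hb, hb', TensorProduct.tmul_add]
        | tmul b b' => simp; ring

/-- Finite sums of products of forms are pairings with tensors. -/
theorem exists_dualPair_eq {W : Type*} [Ring W] [HopfAlgebra K W] (D' : RestrictedDual K W)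
    (F : Module.Dual K (V ⊗[K] W))
    (hF : ∃ l : List (WithConv (V →ₗ[K] K) × WithConv (W →ₗ[K] K)),
      (∀ p ∈ l, p.1 ∈ D.forms ∧ p.2 ∈ D'.forms) ∧
        ∀ A B, F (A ⊗ₜ B) = (l.map fun p => p.1 A * p.2 B).sum) :
    ∃ z, dualPair D.eval D'.eval z = F := by
  obtain ⟨l, hl, hF⟩ := hF
  have : ∃ z, ∀ A B, dualPair D.eval D'.eval z (A ⊗ₜ B) =
      (l.map fun p => p.1 A * p.2 B).sum := by
    clear hF
    induction l with
    | nil => exact ⟨0, by simp⟩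
    | cons p l ih =>
      obtain ⟨z, hz⟩ := ih fun q hq => hl q (List.mem_cons_of_mem _ hq)
      have hp := hl p List.mem_cons_self
      let f : D.Carrier := ⟨p.1, hp.1⟩
      let g : D'.Carrier := ⟨p.2, hp.2⟩
      refine ⟨f ⊗ₜ g + z, fun A B => ?_⟩
      rw [map_add, LinearMap.add_apply, hz, dualPair_tmul, List.map_cons, List.sum_cons]
      rfl
  obtain ⟨z, hz⟩ := this
  exact ⟨z, TensorProduct.ext' fun A B => by rw [hz, hF]⟩

/-- `exists_comul` supplies a tensor for each form. Injectivity of the pairing makes it unique,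
hence linear in the form. -/
theorem exists_comulMap : ∃ c : D.Carrier →ₗ[K] D.Carrier ⊗[K] D.Carrier, ∀ f,
    dualPair D.eval D.eval (c f) =
      D.eval f ∘ₗ LinearMap.mul' K V :=
  exists_linearMap_factor (dualPair_injective D.eval_injective D.eval_injective)
    (LinearMap.lcomp K K (LinearMap.mul' K V) ∘ₗ D.eval) fun f =>
      D.exists_dualPair_eq D _ (D.exists_comul f.1 f.2)

/-- The coproduct of a restricted dual: the transpose of the product. -/
def comulMap : D.Carrier →ₗ[K] D.Carrier ⊗[K] D.Carrier := D.exists_comulMap.choose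

theorem dualPair_comulMap (f : D.Carrier) :
    dualPair D.eval D.eval (D.comulMap f) =
      D.eval f ∘ₗ LinearMap.mul' K V := D.exists_comulMap.choose_spec f

/-- The counit of a restricted dual: the evaluation at the unit. -/
def counitMap : D.Carrier →ₗ[K] K := LinearMap.applyₗ (1 : V) ∘ₗ D.eval

theorem counitMap_apply (f : D.Carrier) : D.counitMap f = D.eval f 1 := rfl

/-- The antipode of a restricted dual: the transpose of the antipode. -/
def antipodeMap : D.Carrier →ₗ[K] D.Carrier where
  toFun f := ⟨_, D.antipode_mem f.1 f.2⟩
  map_add' _ _ := rfl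
  map_smul' _ _ := rfl

theorem eval_antipodeMap (f : D.Carrier) :
    D.eval (D.antipodeMap f) = D.eval f ∘ₗ HopfAlgebra.antipode K := rfl

/-- As in the two instances below, axioms valued in D or its tensor powers are tested by pairing
with the corresponding powers of V, where they become transposes of Hopf algebra axioms of V. -/
instance : Coalgebra K D.Carrier where
  comul := D.comulMap
  counit := D.counitMap
  coassoc := by
    ext1 f
    apply dualPair_injective D.eval_injective
      (dualPair_injective D.eval_injective D.eval_injective)
    simp only [LinearMap.comp_apply, LinearEquiv.coe_coe, LinearMap.rTensor, LinearMap.lTensor]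
    rw [dualPair_assoc,
      dualPair_map D.eval D.eval _ _ D.dualPair_comulMap
        (G := LinearMap.id) (fun _ => rfl),
      dualPair_map D.eval D.eval _ _ (F := LinearMap.id) (fun _ => rfl)
        D.dualPair_comulMap,
      D.dualPair_comulMap]
    ext A B C
    simp [mul_assoc]
  rTensor_counit_comp_comul := by
    ext1 f
    apply (TensorProduct.lid K D.Carrier).injective
    apply eval_injective
    ext A
    have h : ∀ z : D.Carrier ⊗[K] D.Carrier, D.eval
        (TensorProduct.lid K D.Carrier (D.counitMap.rTensor D.Carrier z)) A =
        dualPair D.eval D.eval z (1 ⊗ₜ A) := fun z => by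
      induction z using TensorProduct.induction_on with
      | zero => simp
      | tmul f g => simp [counitMap_apply]
      | add z z' hz hz' => simp only [map_add, LinearMap.add_apply, hz, hz']
    rw [LinearMap.comp_apply, h, D.dualPair_comulMap]
    simp
  lTensor_counit_comp_comul := by
    ext1 f
    apply (TensorProduct.rid K D.Carrier).injective
    apply eval_injective
    ext A
    have h : ∀ z : D.Carrier ⊗[K] D.Carrier, D.eval
        (TensorProduct.rid K D.Carrier (D.counitMap.lTensor D.Carrier z)) A =
        dualPair D.eval D.eval z (A ⊗ₜ 1) := fun z => by
      induction z using TensorProduct.induction_on with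
      | zero => simp
      | tmul f g => simp [counitMap_apply, mul_comm]
      | add z z' hz hz' => simp only [map_add, LinearMap.add_apply, hz, hz']
    rw [LinearMap.comp_apply, h, D.dualPair_comulMap]
    simp

theorem counit_apply (f : D.Carrier) : counit (R := K) f = D.eval f 1 := rfl

theorem dualPair_comul (f : D.Carrier) :
    dualPair D.eval D.eval (comul (R := K) f) =
      D.eval f ∘ₗ LinearMap.mul' K V := D.dualPair_comulMap f

theorem map_mul'_tensorTensorTensorComm (x y : V ⊗[K] V) :
    TensorProduct.map (LinearMap.mul' K V) (LinearMap.mul' K V)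
      (TensorProduct.tensorTensorTensorComm K V V V V (x ⊗ₜ y)) = x * y := by
  induction x using TensorProduct.induction_on with
  | zero => simp
  | add a a' ha ha' => simp only [map_add, add_mul, ha, ha', TensorProduct.add_tmul]
  | tmul a a' =>
    induction y using TensorProduct.induction_on with
    | zero => simp
    | add b b' hb hb' => simp only [map_add, mul_add, hb, hb', TensorProduct.tmul_add]
    | tmul b b' => simp

theorem dualDistrib_comp {V' : Type*} [AddCommGroup V'] [Module K V'] (f g : Module.Dual K V)
    (F G : V' →ₗ[K] V) (z : V' ⊗[K] V') :
    TensorProduct.dualDistrib K V' V' ((f ∘ₗ F) ⊗ₜ (g ∘ₗ G)) z =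
      TensorProduct.dualDistrib K V V (f ⊗ₜ g) (TensorProduct.map F G z) := by
  induction z using TensorProduct.induction_on with
  | zero => simp
  | tmul a b => simp
  | add z z' hz hz' => simp only [map_add, hz, hz']

instance : Bialgebra K D.Carrier :=
  Bialgebra.mk' K D.Carrier
    (by rw [counit_apply, eval_one, Bialgebra.counit_one])
    (fun {f g} => by
      simp only [counit_apply]
      rw [eval_mul, Bialgebra.comul_one, Algebra.TensorProduct.one_def]
      simp)
    (by
      apply dualPair_injective D.eval_injective D.eval_injective
      rw [dualPair_comul]
      ext A B
      simp [Algebra.TensorProduct.one_def, eval_one])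
    (fun {f g} => by
      apply dualPair_injective D.eval_injective D.eval_injective
      ext A B
      rw [dualPair_comul]
      simp only [TensorProduct.AlgebraTensorModule.curry_apply, LinearMap.restrictScalars_self,
        TensorProduct.curry_apply]
      rw [dualPair_mul, dualPair_comul, dualPair_comul, dualDistrib_comp,
        map_mul'_tensorTensorTensorComm, LinearMap.comp_apply, LinearMap.mul'_apply, eval_mul,
        Bialgebra.comul_mul])

instance : HopfAlgebra K D.Carrier where
  antipode := D.antipodeMap
  mul_antipode_rTensor_comul := by
    ext1 f
    apply eval_injective
    ext A
    rw [LinearMap.comp_apply, LinearMap.comp_apply, eval_mul', LinearMap.rTensor,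
      dualPair_map D.eval D.eval _ _ D.eval_antipodeMap
        (G := LinearMap.id) (fun _ => rfl), dualPair_comul]
    have := HopfAlgebra.mul_antipode_rTensor_comul_apply (R := K) A
    rw [LinearMap.rTensor] at this
    simp only [LinearMap.comp_apply, this, Algebra.algebraMap_eq_smul_one, map_smul,
      counit_apply, LinearMap.smul_apply, eval_one, Algebra.linearMap_apply, smul_eq_mul]
    ring
  mul_antipode_lTensor_comul := by
    ext1 f
    apply eval_injective
    ext A
    rw [LinearMap.comp_apply, LinearMap.comp_apply, eval_mul', LinearMap.lTensor,
      dualPair_map D.eval D.eval _ _ (F := LinearMap.id) (fun _ => rfl)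
        D.eval_antipodeMap, dualPair_comul]
    have := HopfAlgebra.mul_antipode_lTensor_comul_apply (R := K) A
    rw [LinearMap.lTensor] at this
    simp only [LinearMap.comp_apply, this, Algebra.algebraMap_eq_smul_one, map_smul,
      counit_apply, LinearMap.smul_apply, eval_one, Algebra.linearMap_apply, smul_eq_mul]
    ring

variable {W : Type*} [Ring W] [HopfAlgebra K W]

/-- The transpose of the action of a Hopf algebra on a module bialgebra puts the restricted
duals in cointeraction. -/
theorem isCointeraction_of_action (D : RestrictedDual K V) (D' : RestrictedDual K W)
    (act : W →ₗ[K] V →ₗ[K] V) (act_one : ∀ B, act 1 B = B)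
    (act_mul : ∀ a b B, act (a * b) B = act a (act b B))
    (counit_act : ∀ a B, counit (R := K) (act a B) = counit (R := K) a * counit (R := K) B)
    (comul_act : ∀ a B, comul (R := K) (act a B) = TensorProduct.map₂ act act (comul a) (comul B))
    (apply_one : ∀ a, act a 1 = counit (R := K) a • 1)
    (apply_mul : ∀ a B C, act a (B * C) =
      LinearMap.mul' K V (TensorProduct.map (act.flip B) (act.flip C) (comul a)))
    (ρ : D.Carrier →ₗ[K] D'.Carrier ⊗[K] D.Carrier)
    (hρ : ∀ f, dualPair D'.eval D.eval (ρ f) =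
      D.eval f ∘ₗ TensorProduct.lift act) : IsCointeraction ρ where
  -- Each field is the transpose of one property of the action: `coassoc` of `act_mul`, `counit` of
  -- `act_one`, `map_one` of `counit_act`, `map_mul` of `comul_act`, `comp_counit` of `apply_one`,
  -- and `comp_comul` of `apply_mul`.
  coassoc := by
    ext1 f
    apply dualPair_injective D'.eval_injective
      (dualPair_injective D'.eval_injective D.eval_injective)
    simp only [LinearMap.comp_apply, LinearEquiv.coe_coe, LinearMap.rTensor, LinearMap.lTensor]
    rw [dualPair_assoc,
      dualPair_map D'.eval D.eval _ _ D'.dualPair_comul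
        (G := LinearMap.id) (fun _ => rfl),
      dualPair_map D'.eval D.eval _ _ (F := LinearMap.id) (fun _ => rfl)
        hρ, hρ]
    ext A B C
    simp [act_mul]
  counit := by
    ext1 f
    apply eval_injective
    ext A
    have h : ∀ z : D'.Carrier ⊗[K] D.Carrier, D.eval
        (TensorProduct.lid K D.Carrier ((counit (R := K) (A := D'.Carrier)).rTensor D.Carrier z)) A
            =
        dualPair D'.eval D.eval z (1 ⊗ₜ A) := fun z => by
      induction z using TensorProduct.induction_on with
      | zero => simp
      | tmul f g => simp [counit_apply]
      | add z z' hz hz' => simp only [map_add, LinearMap.add_apply, hz, hz']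
    rw [LinearMap.comp_apply, LinearMap.comp_apply, LinearEquiv.coe_coe, h, hρ]
    simp [act_one]
  map_one := by
    apply dualPair_injective D'.eval_injective D.eval_injective
    rw [hρ]
    ext A B
    simp [eval_one, counit_act]
  map_mul f g := by
    apply dualPair_injective D'.eval_injective D.eval_injective
    ext A B
    rw [hρ]
    simp only [TensorProduct.AlgebraTensorModule.curry_apply, LinearMap.restrictScalars_self,
      TensorProduct.curry_apply]
    rw [dualPair_mul, hρ, hρ, dualDistrib_comp, LinearMap.comp_apply, TensorProduct.lift.tmul,
      eval_mul, comul_act]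
    congr 1
    generalize comul (R := K) A = a
    generalize comul (R := K) B = b
    induction a using TensorProduct.induction_on with
    | zero => simp
    | add a a' ha ha' => simp only [map_add, LinearMap.add_apply, ha, ha', TensorProduct.add_tmul]
    | tmul a a' =>
      induction b using TensorProduct.induction_on with
      | zero => simp
      | add b b' hb hb' => simp only [map_add, hb, hb', TensorProduct.tmul_add]
      | tmul b b' => simp
  comp_counit f := by
    apply eval_injective
    ext A
    have h : ∀ z : D'.Carrier ⊗[K] D.Carrier, D'.eval
        (TensorProduct.rid K D'.Carrier ((counit (R := K) (A := D.Carrier)).lTensor D'.Carrier z))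
            A =
        dualPair D'.eval D.eval z (A ⊗ₜ 1) := fun z => by
      induction z using TensorProduct.induction_on with
      | zero => simp
      | tmul f g => simp [counit_apply, mul_comm]
      | add z z' hz hz' => simp only [map_add, LinearMap.add_apply, hz, hz']
    rw [h, hρ]
    simp [apply_one, eval_one, counit_apply, mul_comm]
  comp_comul := by
    ext1 f
    apply dualPair_injective D'.eval_injective
      (dualPair_injective D.eval_injective D.eval_injective)
    have h : ∀ (y : (D'.Carrier ⊗[K] D.Carrier) ⊗[K] (D'.Carrier ⊗[K] D.Carrier)) (A : W) (B C : V),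
        dualPair D'.eval (dualPair D.eval D.eval)
          (mulOneThree K D.Carrier D'.Carrier y) (A ⊗ₜ (B ⊗ₜ C)) =
        dualPair (dualPair D'.eval D.eval)
          (dualPair D'.eval D.eval) y
          (TensorProduct.tensorTensorTensorComm K W W V V (comul A ⊗ₜ (B ⊗ₜ C))) := by
      intro y A B C
      induction y using TensorProduct.induction_on with
      | zero => simp
      | add z z' hz hz' => simp only [_root_.map_add, LinearMap.add_apply, hz, hz']
      | tmul z w =>
        induction z using TensorProduct.induction_on with
        | zero => simp
        | add z z' hz hz' =>
          simp only [_root_.map_add, TensorProduct.add_tmul, LinearMap.add_apply, hz, hz']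
        | tmul b a =>
          induction w using TensorProduct.induction_on with
          | zero => simp
          | add z z' hz hz' =>
            simp only [_root_.map_add, TensorProduct.tmul_add, LinearMap.add_apply, hz, hz']
          | tmul b' a' =>
            simp only [mulOneThree, LinearMap.comp_apply, LinearEquiv.coe_coe,
              TensorProduct.tensorTensorTensorComm_tmul, LinearMap.rTensor_tmul,
              LinearMap.mul'_apply, dualPair_tmul, eval_mul]
            generalize comul (R := K) A = x
            induction x using TensorProduct.induction_on with
            | zero => simp
            | add z z' hz hz' => simp only [_root_.map_add, TensorProduct.add_tmul, add_mul, hz,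
                hz']
            | tmul x x' => simp; ring
    ext A B C
    simp only [TensorProduct.AlgebraTensorModule.curry_apply, LinearMap.restrictScalars_self,
      TensorProduct.curry_apply, LinearMap.comp_apply]
    rw [h, LinearMap.lTensor, dualPair_map D'.eval D.eval _ _
      (F := LinearMap.id) (fun _ => rfl) D.dualPair_comul, hρ,
      dualPair_map D.eval D.eval _ _ hρ hρ, dualPair_comul]
    simp only [LinearMap.comp_apply, TensorProduct.map_tmul, LinearMap.id_apply,
      LinearMap.mul'_apply, TensorProduct.lift.tmul, apply_mul]
    congr 2
    generalize comul (R := K) A = x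
    induction x using TensorProduct.induction_on with
    | zero => simp
    | add z z' hz hz' => simp only [_root_.map_add, TensorProduct.add_tmul, hz, hz']
    | tmul x x' => simp

end RestrictedDual

end DualPairing

-- Gradings of 𝒰(𝔤) by a commutative monoid; used with ℕ, with multisets, and with word length added

section Components

open Coalgebra (comul counit)
open scoped Pointwise

variable {K : Type*} [Field K] {L : Type*} [LieRing L] [LieAlgebra K L] {M : Type*} [AddCommMonoid
    M]

/-- The span of the products of elements of `X m₁, …, X mₖ` with `m₁ + ⋯ + mₖ = m`. -/
def component (K : Type*) [Field K] {L : Type*} [LieRing L] [LieAlgebra K L] {M : Type*}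
    [AddCommMonoid M] (X : M → Set L) (m : M) : Submodule K (𝓤 K L) :=
  Submodule.span K {a | ∃ l : List (M × L), (∀ p ∈ l, p.2 ∈ X p.1) ∧
    (l.map Prod.fst).sum = m ∧ a = (l.map fun p => ιᵤ K p.2).prod}

theorem one_mem_component (X : M → Set L) : (1 : 𝓤 K L) ∈ component K X 0 :=
  Submodule.subset_span ⟨[], by simp⟩

theorem ι_mul_mem_component {X : M → Set L} {m n : M} {x : L} (hx : x ∈ X m) {A : 𝓤 K L}
    (hA : A ∈ component K X n) : ιᵤ K x * A ∈ component K X (m + n) := by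
  induction hA using Submodule.span_induction with
  | mem A hA =>
    obtain ⟨l, hl, rfl, rfl⟩ := hA
    refine Submodule.subset_span ⟨(m, x) :: l, ?_, by simp, by simp⟩
    rintro p (_ | ⟨_, hp⟩)
    · exact hx
    · exact hl p hp
  | zero => simp
  | add b c _ _ hb hc => rw [mul_add]; exact add_mem hb hc
  | smul c b _ hb => rw [mul_smul_comm]; exact Submodule.smul_mem _ _ hb

theorem ι_mul_mem_component_of_span {X : M → Set L} {m n : M} {x : L}
    (hx : x ∈ Submodule.span K (X m)) {A : 𝓤 K L} (hA : A ∈ component K X n) :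
    ιᵤ K x * A ∈ component K X (m + n) := by
  induction hx using Submodule.span_induction with
  | mem x hx => exact ι_mul_mem_component hx hA
  | zero => simp
  | add x y _ _ hx hy => rw [map_add, add_mul]; exact add_mem hx hy
  | smul c x _ hx => rw [map_smul, smul_mul_assoc]; exact Submodule.smul_mem _ _ hx

theorem ι_mem_component {X : M → Set L} {m : M} {x : L} (hx : x ∈ X m) :
    ιᵤ K x ∈ component K X m := by
  simpa using ι_mul_mem_component hx (one_mem_component (K := K) X)

theorem component_induction {X : M → Set L} {p : M → 𝓤 K L → Prop} (one : p 0 1)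
    (zero : ∀ m, p m 0) (add : ∀ m a b, p m a → p m b → p m (a + b))
    (smul : ∀ m (c : K) a, p m a → p m (c • a))
    (mul : ∀ m n x A, x ∈ X m → A ∈ component K X n → p n A → p (m + n) (ιᵤ K x * A))
    {m : M} {A : 𝓤 K L} (hA : A ∈ component K X m) : p m A := by
  induction hA using Submodule.span_induction with
  | mem A hA =>
    obtain ⟨l, hl, rfl, rfl⟩ := hA
    induction l with
    | nil => exact one
    | cons q l ih =>
      rw [List.map_cons, List.map_cons, List.prod_cons, List.sum_cons]
      exact mul _ _ _ _ (hl q List.mem_cons_self)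
        (Submodule.subset_span ⟨l, fun p hp => hl p (List.mem_cons_of_mem _ hp), rfl, rfl⟩)
        (ih fun p hp => hl p (List.mem_cons_of_mem _ hp))
  | zero => exact zero _
  | add b c _ _ hb hc => exact add _ _ _ hb hc
  | smul c b _ hb => exact smul _ _ _ hb

theorem mul_mem_component {X : M → Set L} {m n : M} {A B : 𝓤 K L} (hA : A ∈ component K X m)
    (hB : B ∈ component K X n) : A * B ∈ component K X (m + n) := by
  refine component_induction (p := fun m A => A * B ∈ component K X (m + n)) (by simpa using hB)
    (fun m => by simp) (fun m a b ha hb => by rw [add_mul]; exact add_mem ha hb)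
    (fun m c a ha => by rw [smul_mul_assoc]; exact Submodule.smul_mem _ _ ha)
    (fun m k x A hx _ ih => by rw [mul_assoc, add_assoc]; exact ι_mul_mem_component hx ih) hA

theorem envelopingDerivation_mem_component {X : M → Set L} {m : M} (δ : LieDerivation K L L)
    (hδ : ∀ n, ∀ y ∈ X n, δ y ∈ Submodule.span K (X (m + n))) {n : M} {A : 𝓤 K L}
    (hA : A ∈ component K X n) : envelopingDerivation δ A ∈ component K X (m + n) := by
  refine component_induction (p := fun n A => envelopingDerivation δ A ∈ component K X (m + n))
    (by simp) (fun m => by simp) (fun m a b ha hb => by rw [map_add]; exact add_mem ha hb)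
    (fun m c a ha => by rw [map_smul]; exact Submodule.smul_mem _ _ ha)
    (fun k l x A hx hA ih => ?_) hA
  rw [envelopingDerivation_mul, envelopingDerivation_ι]
  refine add_mem ?_ ?_
  · rw [← add_assoc]; exact ι_mul_mem_component_of_span (hδ k x hx) hA
  · rw [add_left_comm]; exact ι_mul_mem_component hx ih

theorem counit_eq_zero_of_mem_component {X : M → Set L} {m : M} (hm : m ≠ 0) {A : 𝓤 K L}
    (hA : A ∈ component K X m) : counit (R := K) A = 0 := by
  revert hm
  exact component_induction (p := fun m A => m ≠ 0 → counit (R := K) A = 0) (fun h => absurd rfl h)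
    (fun m _ => by simp) (fun m a b ha hb hm => by rw [map_add, ha hm, hb hm, add_zero])
    (fun m c a ha hm => by rw [map_smul, ha hm, smul_zero]) (fun k l x A _ _ _ _ => by simp) hA

theorem antipode_mem_component {X : M → Set L} {m : M} {A : 𝓤 K L}
    (hA : A ∈ component K X m) : HopfAlgebra.antipode K A ∈ component K X m := by
  refine component_induction (p := fun m A => HopfAlgebra.antipode K A ∈ component K X m)
    (by simpa using one_mem_component X)
    (fun m => by simp) (fun m a b ha hb => by rw [map_add]; exact add_mem ha hb)
    (fun m c a ha => by rw [map_smul]; exact Submodule.smul_mem _ _ ha)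
    (fun k l x A hx hA ih => ?_) hA
  rw [antipode_ι_mul, add_comm]
  exact neg_mem (mul_mem_component ih (ι_mem_component hx))

theorem comul_mem_component {X : M → Set L} {m : M} {A : 𝓤 K L} (hA : A ∈ component K X m) :
    comul (R := K) A ∈ Submodule.span K {z : 𝓤 K L ⊗[K] 𝓤 K L | ∃ i j a b, i + j = m ∧
      a ∈ component K X i ∧ b ∈ component K X j ∧ z = a ⊗ₜ b} := by
  refine component_induction (p := fun m A => comul (R := K) A ∈
      Submodule.span K {z : 𝓤 K L ⊗[K] 𝓤 K L | ∃ i j a b, i + j = m ∧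
      a ∈ component K X i ∧ b ∈ component K X j ∧ z = a ⊗ₜ b})
    (Submodule.subset_span ⟨0, 0, 1, 1, by simp, one_mem_component X, one_mem_component X,
      by simp [Algebra.TensorProduct.one_def]⟩)
    (fun m => by simp) (fun m a b ha hb => by rw [map_add]; exact add_mem ha hb)
    (fun m c a ha => by rw [map_smul]; exact Submodule.smul_mem _ _ ha)
    (fun k l x A hx hA ih => ?_) hA
  rw [Bialgebra.comul_mul, comul_ι]
  generalize comul (R := K) A = z at ih
  induction ih using Submodule.span_induction with
  | mem z hz =>
    obtain ⟨i, j, a, b, rfl, ha, hb, rfl⟩ := hz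
    rw [add_mul, Algebra.TensorProduct.tmul_mul_tmul, Algebra.TensorProduct.tmul_mul_tmul, one_mul,
      one_mul]
    exact add_mem
      (Submodule.subset_span ⟨k + i, j, _, _, by rw [add_assoc], ι_mul_mem_component hx ha, hb,
          rfl⟩)
      (Submodule.subset_span ⟨i, k + j, _, _, by rw [add_left_comm], ha, ι_mul_mem_component hx hb,
        rfl⟩)
  | zero => simp
  | add b c _ _ hb hc => rw [mul_add]; exact add_mem hb hc
  | smul c b _ hb => rw [mul_smul_comm]; exact Submodule.smul_mem _ _ hb

/-- The linear forms vanishing on all but finitely many components. -/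
def gradedForms (K : Type*) [Field K] {L : Type*} [LieRing L] [LieAlgebra K L] {M : Type*}
    [AddCommMonoid M] (X : M → Set L) : Subalgebra K (WithConv (𝓤 K L →ₗ[K] K)) where
  carrier := {f | ∃ F : Set M, F.Finite ∧ ∀ m, m ∉ F → ∀ A ∈ component K X m, f A = 0}
  add_mem' := by
    rintro f f' ⟨F, hF, hf⟩ ⟨F', hF', hf'⟩
    refine ⟨F ∪ F', hF.union hF', fun m hm A hA => ?_⟩
    rw [Set.mem_union, not_or] at hm
    rw [WithConv.ofConv_add, LinearMap.add_apply, hf m hm.1 A hA, hf' m hm.2 A hA, add_zero]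
  algebraMap_mem' := fun c => ⟨{0}, Set.finite_singleton 0, fun m hm A hA => by
    rw [LinearMap.convAlgebraMap_apply, counit_eq_zero_of_mem_component (by simpa using hm) hA,
      map_zero, smul_zero]⟩
  mul_mem' := by
    rintro f f' ⟨F, hF, hf⟩ ⟨F', hF', hf'⟩
    -- The coproduct preserves total degree, so a convolution product is supported on sums of
    -- degrees of the two supports.
    refine ⟨F + F', hF.add hF', fun m hm A hA => ?_⟩
    rw [LinearMap.convMul_apply]
    have h := comul_mem_component hA
    generalize comul (R := K) A = z at h
    induction h using Submodule.span_induction with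
    | mem z hz =>
      obtain ⟨i, j, a, b, rfl, ha, hb, rfl⟩ := hz
      rw [TensorProduct.map_tmul, LinearMap.mul'_apply]
      by_cases hi : i ∈ F
      · by_cases hj : j ∈ F'
        · exact absurd (Set.add_mem_add hi hj) hm
        · rw [hf' j hj b hb, mul_zero]
      · rw [hf i hi a ha, zero_mul]
    | zero => simp
    | add b c _ _ hb hc => rw [map_add, map_add, hb, hc, add_zero]
    | smul c b _ hb => rw [map_smul, map_smul, hb, smul_zero]

theorem mem_gradedForms {X : M → Set L} {f : WithConv (𝓤 K L →ₗ[K] K)} :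
    f ∈ gradedForms K X ↔
      ∃ F : Set M, F.Finite ∧ ∀ m, m ∉ F → ∀ A ∈ component K X m, f A = 0 := Iff.rfl

/-- `e` is a basis of `𝒰(𝔤)` adapted to the components, with finitely many vectors in each
degree. -/
structure IsHomogeneousBasis {I : Type*} (X : M → Set L) (e : Module.Basis I K (𝓤 K L))
    (deg : I → M) : Prop where
  component_eq : ∀ m, component K X m = Submodule.span K (e '' {i | deg i = m})
  finite_fiber : ∀ m, {i | deg i = m}.Finite

theorem IsHomogeneousBasis.mem {I : Type*} {X : M → Set L} {e : Module.Basis I K (𝓤 K L)}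
    {deg : I → M} (he : IsHomogeneousBasis X e deg) (i : I) : e i ∈ component K X (deg i) := by
  rw [he.component_eq]
  exact Submodule.subset_span ⟨i, rfl, rfl⟩

theorem IsHomogeneousBasis.coord_mem {I : Type*} {X : M → Set L} {e : Module.Basis I K (𝓤 K L)}
    {deg : I → M} (he : IsHomogeneousBasis X e deg) (i : I) :
    WithConv.toConv (e.coord i) ∈ gradedForms K X := by
  refine ⟨{deg i}, Set.finite_singleton _, fun m hm A hA => ?_⟩
  rw [he.component_eq] at hA
  induction hA using Submodule.span_induction with
  | mem A hA =>
    obtain ⟨j, rfl, rfl⟩ := hA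
    have : j ≠ i := fun h => hm (by rw [h]; rfl)
    change e.repr (e j) i = 0
    rw [e.repr_self, Finsupp.single_eq_of_ne this.symm]
  | zero => exact map_zero _
  | add b c _ _ hb hc => exact (map_add (e.coord i) b c).trans (by
      rw [show e.coord i b = 0 from hb, show e.coord i c = 0 from hc, add_zero])
  | smul c b _ hb => exact (map_smul (e.coord i) c b).trans (by
      rw [show e.coord i b = 0 from hb, smul_zero])

/-- A bilinear form with finitely many nonzero coefficients is a finite sum of products of
coordinate forms. -/
theorem exists_list_of_finite {V W I J : Type*} [AddCommGroup V] [Module K V] [AddCommGroup W]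
    [Module K W] (e : Module.Basis I K V) (e' : Module.Basis J K W) (b : V →ₗ[K] W →ₗ[K] K)
    (hb : {p : I × J | b (e p.1) (e' p.2) ≠ 0}.Finite) :
    ∃ l : List (WithConv (V →ₗ[K] K) × WithConv (W →ₗ[K] K)),
      (∀ p ∈ l, (∃ (c : K) (i : I), p.1 = c • WithConv.toConv (e.coord i)) ∧
        ∃ j, p.2 = WithConv.toConv (e'.coord j)) ∧
      ∀ A B, b A B = (l.map fun p => p.1 A * p.2 B).sum := by
  classical
  refine ⟨hb.toFinset.toList.map fun p => (b (e p.1) (e' p.2) • WithConv.toConv (e.coord p.1),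
    WithConv.toConv (e'.coord p.2)), ?_, fun A B => ?_⟩
  · intro p hp
    obtain ⟨q, -, rfl⟩ := List.mem_map.1 hp
    exact ⟨⟨_, _, rfl⟩, _, rfl⟩
  · rw [List.map_map, Finset.sum_map_toList]
    -- Both bilinear forms are compared on pairs of basis vectors, where at most one summand
    -- survives.
    have h : b = ∑ p ∈ hb.toFinset, (b (e p.1) (e' p.2)) •
        (LinearMap.mul K K).compl₁₂ (e.coord p.1) (e'.coord p.2) := by
      refine e.ext fun i => e'.ext fun j => ?_
      simp only [LinearMap.sum_apply, LinearMap.smul_apply, LinearMap.compl₁₂_apply,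
        LinearMap.mul_apply', Module.Basis.coord_apply, Module.Basis.repr_self, smul_eq_mul]
      rw [Finset.sum_eq_single (i, j)]
      · simp
      · rintro ⟨i', j'⟩ - hne
        by_cases h1 : i' = i
        · by_cases h2 : j' = j
          · exact absurd (by rw [h1, h2]) hne
          · rw [Finsupp.single_eq_of_ne h2, mul_zero, mul_zero]
        · rw [Finsupp.single_eq_of_ne h1, zero_mul, mul_zero]
      · intro h
        rw [Set.Finite.mem_toFinset, Set.mem_ofPred_eq, not_not] at h
        rw [h, zero_mul]
    conv_lhs => rw [h]
    simp only [LinearMap.sum_apply, LinearMap.smul_apply, LinearMap.compl₁₂_apply,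
      LinearMap.mul_apply', smul_eq_mul]
    refine Finset.sum_congr rfl fun p _ => ?_
    simp [mul_assoc]

theorem finite_setOf_add_mem {I J : Type*} (hM : ∀ m : M, {p : M × M | p.1 + p.2 = m}.Finite)
    {deg : I → M} {deg' : J → M} (h : ∀ m, {i | deg i = m}.Finite)
    (h' : ∀ m, {i | deg' i = m}.Finite) {F : Set M} (hF : F.Finite) :
    {p : I × J | deg p.1 + deg' p.2 ∈ F}.Finite := by
  have : {p : I × J | deg p.1 + deg' p.2 ∈ F} ⊆
      ⋃ m ∈ F, ⋃ q ∈ {q : M × M | q.1 + q.2 = m}, {i | deg i = q.1} ×ˢ {i | deg' i = q.2} := by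
    intro p hp
    simp only [Set.mem_iUnion]
    exact ⟨_, hp, (deg p.1, deg' p.2), rfl, rfl, rfl⟩
  exact (hF.biUnion fun m _ => (hM m).biUnion fun q _ => (h _).prod (h' _)).subset this

/-- The form f ∘ b can be nonzero only on pairs of basis vectors whose degrees add up to one of the
finitely many degrees of f. With b the product this gives the coproduct of the dual; with b the
action it gives the coaction. -/
theorem exists_list_gradedForms {L' : Type*} [LieRing L'] [LieAlgebra K L'] {I J : Type*}
    {X : M → Set L} {X' : M → Set L'}
    {e : Module.Basis I K (𝓤 K L)} {deg : I → M} (he : IsHomogeneousBasis X e deg)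
    {e' : Module.Basis J K (𝓤 K L')} {deg' : J → M} (he' : IsHomogeneousBasis X' e' deg')
    (hM : ∀ m : M, {p : M × M | p.1 + p.2 = m}.Finite) {f : WithConv (𝓤 K L →ₗ[K] K)}
    (hf : f ∈ gradedForms K X) (b : 𝓤 K L' →ₗ[K] 𝓤 K L →ₗ[K] 𝓤 K L)
    (hb : ∀ m n A B, A ∈ component K X' m → B ∈ component K X n → b A B ∈ component K X (m + n)) :
    ∃ l : List (WithConv (𝓤 K L' →ₗ[K] K) × WithConv (𝓤 K L →ₗ[K] K)),
      (∀ p ∈ l, p.1 ∈ gradedForms K X' ∧ p.2 ∈ gradedForms K X) ∧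
        ∀ A B, f (b A B) = (l.map fun p => p.1 A * p.2 B).sum := by
  obtain ⟨F, hF, hf⟩ := mem_gradedForms.1 hf
  have hfin : {p : J × I | b.compr₂ f.ofConv (e' p.1) (e p.2) ≠ 0}.Finite := by
    refine (finite_setOf_add_mem hM he'.finite_fiber he.finite_fiber hF).subset fun p hp => ?_
    by_contra h
    exact hp (hf _ h _ (hb _ _ _ _ (he'.mem p.1) (he.mem p.2)))
  obtain ⟨l, hl, h⟩ := exists_list_of_finite e' e _ hfin
  refine ⟨l, fun p hp => ?_, h⟩
  obtain ⟨⟨c, i, h1⟩, j, h2⟩ := hl p hp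
  rw [h1, h2]
  exact ⟨Subalgebra.smul_mem _ (he'.coord_mem i) c, he.coord_mem j⟩

/-- The graded dual of an enveloping algebra. -/
def gradedRestrictedDual {I : Type*} {X : M → Set L} {e : Module.Basis I K (𝓤 K L)}
    {deg : I → M} (he : IsHomogeneousBasis X e deg)
    (hM : ∀ m : M, {p : M × M | p.1 + p.2 = m}.Finite) : RestrictedDual K (𝓤 K L) where
  forms := gradedForms K X
  antipode_mem := fun f hf => by
    obtain ⟨F, hF, hf⟩ := mem_gradedForms.1 hf
    exact mem_gradedForms.2 ⟨F, hF, fun m hm A hA => hf m hm _ (antipode_mem_component hA)⟩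
  exists_comul := fun f hf =>
    exists_list_gradedForms he he hM hf (LinearMap.mul K (𝓤 K L))
      fun _ _ _ _ => mul_mem_component

end Components

-- The orbit isomorphism preserves degrees

section GradedPostLie

variable {K : Type*} [Field K] {L : Type*} [LieRing L] [LieAlgebra K L] {M : Type*} [AddCommMonoid
    M]
  {t : L →ₗ[K] L →ₗ[K] L} (ht : IsPostLie t)

/-- Homogeneous elements, in the sub-adjacent Lie algebra. -/
def subAdjacentDegree (X : M → Set L) (m : M) : Set (SubAdjacent ht) :=
  (toSubAdjacent ht).symm ⁻¹' X m

variable {X : M → Set L}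

theorem leftDerivation_mem_span
    (hX : ∀ m n x y, x ∈ X m → y ∈ X n → t x y ∈ Submodule.span K (X (m + n))) {m : M}
    {x : SubAdjacent ht} (hx : x ∈ subAdjacentDegree ht X m) (n : M) (y : L) (hy : y ∈ X n) :
    leftDerivation ht x y ∈ Submodule.span K (X (m + n)) := by
  rw [leftDerivation_apply]
  exact hX m n _ y hx hy

theorem orbitEquiv_mem_component
    (hX : ∀ m n x y, x ∈ X m → y ∈ X n → t x y ∈ Submodule.span K (X (m + n))) {m : M}
    {a : 𝓤 K (SubAdjacent ht)} (ha : a ∈ component K (subAdjacentDegree ht X) m) :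
    orbitEquiv ht a ∈ component K X m := by
  induction ha using Submodule.span_induction with
  | mem a ha =>
    obtain ⟨l, hl, rfl, rfl⟩ := ha
    induction l with
    | nil =>
      have h : orbitEquiv ht 1 = 1 := by rw [← orbitEquiv_symm_one ht, LinearEquiv.apply_symm_apply]
      rw [List.map_nil, List.map_nil, List.prod_nil, h]
      exact one_mem_component X
    | cons q l ih =>
      have ih := ih fun p hp => hl p (List.mem_cons_of_mem _ hp)
      have hq := hl q List.mem_cons_self
      rw [List.map_cons, List.map_cons, List.prod_cons, List.sum_cons, orbitEquiv_ι_mul]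
      generalize orbitEquiv ht (l.map fun p => ιᵤ K p.2).prod = A at ih ⊢
      have hq' : (toSubAdjacent ht).symm q.2 ∈ X q.1 := hq
      exact add_mem (ι_mul_mem_component hq' ih)
        (envelopingDerivation_mem_component _ (leftDerivation_mem_span ht hX hq) ih)
  | zero => rw [map_zero]; exact zero_mem _
  | add a b _ _ ha hb => rw [map_add]; exact add_mem ha hb
  | smul c a _ ha => rw [map_smul]; exact Submodule.smul_mem _ _ ha

/-- Homogeneous elements, graded also by the number of factors. -/
def lengthDegree (X : M → Set L) (p : M × ℕ) : Set L := {x | x ∈ X p.1 ∧ p.2 = 1}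

/-- The inverse orbit map is a recursion on word length, so the length is recorded as a second
degree on which to induct. -/
theorem orbitEquiv_symm_mem_component_of_length
    (hX : ∀ m n x y, x ∈ X m → y ∈ X n → t x y ∈ Submodule.span K (X (m + n))) (k : ℕ) (m : M)
    (A : 𝓤 K L) (hA : A ∈ component K (lengthDegree X) (m, k)) :
    (orbitEquiv ht).symm A ∈ component K (subAdjacentDegree ht X) m := by
  induction k using Nat.strong_induction_on generalizing m A with
  | _ k ih =>
    induction hA using Submodule.span_induction with
    | mem A hA =>
      obtain ⟨l, hl, hm, rfl⟩ := hA
      cases l with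
      | nil =>
        obtain rfl : 0 = m := congrArg Prod.fst hm
        rw [List.map_nil, List.prod_nil, orbitEquiv_symm_one]
        exact one_mem_component _
      | cons q l =>
        obtain ⟨⟨i, j⟩, x⟩ := q
        obtain ⟨hx, rfl⟩ : x ∈ X i ∧ j = 1 := hl ((i, j), x) List.mem_cons_self
        have hA : (l.map fun p => ιᵤ K p.2).prod ∈
            component K (lengthDegree X) (l.map Prod.fst).sum :=
          Submodule.subset_span ⟨l, fun p hp => hl p (List.mem_cons_of_mem _ hp), rfl, rfl⟩
        rw [List.map_cons, List.sum_cons] at hm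
        generalize (l.map Prod.fst).sum = q at hA hm
        obtain ⟨i', j'⟩ := q
        obtain rfl : i + i' = m := congrArg Prod.fst hm
        obtain rfl : 1 + j' = k := congrArg Prod.snd hm
        rw [List.map_cons, List.prod_cons, orbitEquiv_symm_ι_mul]
        generalize (l.map fun p => ιᵤ K p.2).prod = A at hA
        -- The derivation x ▷ · has bidegree (i, 0): it adds the degree of x and keeps the number of
        -- factors.
        have hD : envelopingDerivation (leftDerivation ht (toSubAdjacent ht x)) A ∈
            component K (lengthDegree X) (i + i', j') := by
          rw [← zero_add j', ← Prod.mk_add_mk]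
          refine envelopingDerivation_mem_component (m := (i, 0)) _ ?_ hA
          rintro ⟨n, s⟩ y ⟨hy, rfl⟩
          have h := leftDerivation_mem_span ht hX (x := toSubAdjacent ht x) hx n y hy
          refine Submodule.span_mono ?_ h
          exact fun z hz => ⟨hz, rfl⟩
        have hx' : toSubAdjacent ht x ∈ subAdjacentDegree ht X i := hx
        exact sub_mem (ι_mul_mem_component hx' (ih j' (by omega) i' _ hA))
          (ih j' (by omega) (i + i') _ hD)
    | zero => rw [map_zero]; exact zero_mem _
    | add a b _ _ ha hb => rw [map_add]; exact add_mem ha hb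
    | smul c a _ ha => rw [map_smul]; exact Submodule.smul_mem _ _ ha

theorem orbitEquiv_symm_mem_component
    (hX : ∀ m n x y, x ∈ X m → y ∈ X n → t x y ∈ Submodule.span K (X (m + n))) {m : M}
    {A : 𝓤 K L} (hA : A ∈ component K X m) :
    (orbitEquiv ht).symm A ∈ component K (subAdjacentDegree ht X) m := by
  induction hA using Submodule.span_induction with
  | mem A hA =>
    obtain ⟨l, hl, rfl, rfl⟩ := hA
    refine orbitEquiv_symm_mem_component_of_length ht hX l.length _ _ (Submodule.subset_span
      ⟨l.map fun p => ((p.1, 1), p.2), ?_, ?_, ?_⟩)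
    · intro p hp
      obtain ⟨q, hq, rfl⟩ := List.mem_map.1 hp
      exact ⟨hl q hq, rfl⟩
    · clear hl
      induction l with
      | nil => rfl
      | cons q l ih =>
        rw [List.map_cons, List.map_cons, List.sum_cons, ih, List.map_cons, List.sum_cons,
          Prod.mk_add_mk, List.length_cons, add_comm 1]
    · rw [List.map_map]; rfl
  | zero => rw [map_zero]; exact zero_mem _
  | add a b _ _ ha hb => rw [map_add]; exact add_mem ha hb
  | smul c a _ ha => rw [map_smul]; exact Submodule.smul_mem _ _ ha

/-- Consequently the graded duals of 𝒰(𝔤) and of 𝒰(`SubAdjacent`) consist of the same forms, read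
through the orbit isomorphism. -/
theorem component_subAdjacentDegree
    (hX : ∀ m n x y, x ∈ X m → y ∈ X n → t x y ∈ Submodule.span K (X (m + n))) (m : M) :
    component K (subAdjacentDegree ht X) m =
      (component K X m).map (orbitEquiv ht).symm.toLinearMap := by
  apply le_antisymm
  · intro a ha
    exact ⟨_, orbitEquiv_mem_component ht hX ha, (orbitEquiv ht).symm_apply_apply a⟩
  · rintro _ ⟨A, hA, rfl⟩
    exact orbitEquiv_symm_mem_component ht hX hA

theorem IsHomogeneousBasis.subAdjacent {I : Type*} {e : Module.Basis I K (𝓤 K L)} {deg : I → M}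
    (he : IsHomogeneousBasis X e deg)
    (hX : ∀ m n x y, x ∈ X m → y ∈ X n → t x y ∈ Submodule.span K (X (m + n))) :
    IsHomogeneousBasis (subAdjacentDegree ht X) (e.map (orbitEquiv ht).symm) deg where
  component_eq m := by
    rw [component_subAdjacentDegree ht hX, he.component_eq, Submodule.map_span, Set.image_image]
    rfl
  finite_fiber := he.finite_fiber

theorem envAct_mem_component
    (hX : ∀ m n x y, x ∈ X m → y ∈ X n → t x y ∈ Submodule.span K (X (m + n))) {m n : M}
    {a : 𝓤 K (SubAdjacent ht)} (ha : a ∈ component K (subAdjacentDegree ht X) m) {B : 𝓤 K L}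
    (hB : B ∈ component K X n) : envAct (leftDerivation ht) a B ∈ component K X (m + n) := by
  induction ha using Submodule.span_induction with
  | mem a ha =>
    obtain ⟨l, hl, rfl, rfl⟩ := ha
    induction l with
    | nil => simpa using hB
    | cons q l ih =>
      have ih := ih fun p hp => hl p (List.mem_cons_of_mem _ hp)
      have hq := hl q List.mem_cons_self
      rw [List.map_cons, List.map_cons, List.prod_cons, List.sum_cons, map_mul,
        Module.End.mul_apply, envAct_ι, add_assoc]
      exact envelopingDerivation_mem_component _ (leftDerivation_mem_span ht hX hq) ih
  | zero => rw [map_zero]; exact zero_mem _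
  | add a b _ _ ha hb => rw [map_add]; exact add_mem ha hb
  | smul c a _ ha => rw [map_smul]; exact Submodule.smul_mem _ _ ha

end GradedPostLie

-- The dual of the ∗-product and the coaction dual to ▷

section GradedDuals

open Coalgebra (comul counit)

variable {K : Type*} [Field K]

theorem dualPair_comp_apply {H H' V V' V₁ : Type*} [AddCommGroup H] [Module K H]
    [AddCommGroup H'] [Module K H'] [AddCommGroup V] [Module K V] [AddCommGroup V'] [Module K V']
    [AddCommGroup V₁] [Module K V₁] (P : H →ₗ[K] Module.Dual K V) (P' : H' →ₗ[K] Module.Dual K V')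
    (Q : H →ₗ[K] Module.Dual K V₁) (T : V₁ →ₗ[K] V) (hQ : ∀ h A, Q h A = P h (T A))
    (z : H ⊗[K] H') (A : V₁) (B : V') :
    dualPair Q P' z (A ⊗ₜ B) = dualPair P P' z (T A ⊗ₜ B) := by
  induction z using TensorProduct.induction_on with
  | zero => simp
  | tmul h h' => simp [hQ]
  | add z z' hz hz' => simp only [map_add, LinearMap.add_apply, hz, hz']

theorem dualPair_comp_apply_right {H H' V V' V₁ : Type*} [AddCommGroup H] [Module K H]
    [AddCommGroup H'] [Module K H'] [AddCommGroup V] [Module K V] [AddCommGroup V'] [Module K V']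
    [AddCommGroup V₁] [Module K V₁] (P : H →ₗ[K] Module.Dual K V) (P' : H' →ₗ[K] Module.Dual K V')
    (Q : H' →ₗ[K] Module.Dual K V₁) (T : V₁ →ₗ[K] V') (hQ : ∀ h A, Q h A = P' h (T A))
    (z : H ⊗[K] H') (A : V) (B : V₁) :
    dualPair P Q z (A ⊗ₜ B) = dualPair P P' z (A ⊗ₜ T B) := by
  induction z using TensorProduct.induction_on with
  | zero => simp
  | tmul h h' => simp [hQ]
  | add z z' hz hz' => simp only [map_add, LinearMap.add_apply, hz, hz']

variable {L : Type*} [LieRing L] [LieAlgebra K L] {M : Type*} [AddCommMonoid M]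
  {t : L →ₗ[K] L →ₗ[K] L} (ht : IsPostLie t) {X : M → Set L} {I : Type*}
  {e : Module.Basis I K (𝓤 K L)} {deg : I → M}

/-- The graded dual of the enveloping algebra of the sub-adjacent Lie algebra. -/
def starRestrictedDual (he : IsHomogeneousBasis X e deg)
    (hX : ∀ m n x y, x ∈ X m → y ∈ X n → t x y ∈ Submodule.span K (X (m + n)))
    (hM : ∀ m : M, {p : M × M | p.1 + p.2 = m}.Finite) :
    RestrictedDual K (𝓤 K (SubAdjacent ht)) :=
  gradedRestrictedDual (he.subAdjacent ht hX) hM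

/-- The pairing of forms on the enveloping algebra of the sub-adjacent Lie algebra with
`𝒰(𝔤)`. -/
def starPairing (D : RestrictedDual K (𝓤 K (SubAdjacent ht))) :
    D.Carrier →ₗ[K] Module.Dual K (𝓤 K L) :=
  LinearMap.lcomp K K (orbitEquiv ht).symm.toLinearMap ∘ₗ D.eval

theorem starPairing_apply (D : RestrictedDual K (𝓤 K (SubAdjacent ht))) (f : D.Carrier)
    (A : 𝓤 K L) : starPairing ht D f A = D.eval f ((orbitEquiv ht).symm A) := rfl

theorem starPairing_injective (D : RestrictedDual K (𝓤 K (SubAdjacent ht))) :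
    Function.Injective (starPairing ht D) := by
  intro f g h
  apply D.eval_injective
  ext1 a
  simpa [starPairing_apply] using LinearMap.congr_fun h (orbitEquiv ht a)

theorem starPairing_one (D : RestrictedDual K (𝓤 K (SubAdjacent ht))) (A : 𝓤 K L) :
    starPairing ht D 1 A = counit (R := K) A := by
  rw [starPairing_apply, D.eval_one, counit_orbitEquiv_symm]

theorem starPairing_mul (D : RestrictedDual K (𝓤 K (SubAdjacent ht))) (f g : D.Carrier)
    (A : 𝓤 K L) : starPairing ht D (f * g) A =
      TensorProduct.dualDistrib K _ _ (starPairing ht D f ⊗ₜ starPairing ht D g) (comul A) := by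
  rw [starPairing_apply, D.eval_mul, comul_orbitEquiv_symm]
  exact (RestrictedDual.dualDistrib_comp _ _ _ _ _).symm

theorem counit_eq_starPairing (D : RestrictedDual K (𝓤 K (SubAdjacent ht))) (f : D.Carrier) :
    counit (R := K) f = starPairing ht D f 1 := by
  rw [D.counit_apply, starPairing_apply, orbitEquiv_symm_one]

theorem dualPair_starPairing_comul (D : RestrictedDual K (𝓤 K (SubAdjacent ht))) (f : D.Carrier)
    (A B : 𝓤 K L) :
    dualPair (starPairing ht D) (starPairing ht D) (comul (R := K) f) (A ⊗ₜ B) =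
      starPairing ht D f (starProduct (guinOudom ht) A B) := by
  rw [dualPair_comp_apply D.eval _ _ _ (starPairing_apply ht D),
    dualPair_comp_apply_right _ D.eval _ _ (starPairing_apply ht D), D.dualPair_comul,
    starProduct_guinOudom, starPairing_apply, LinearEquiv.symm_apply_apply]
  rfl

/-- Translates the defining property of the coaction, stated with A ▷ B on 𝒰(𝔤), into the transpose
of the action of 𝒰(`SubAdjacent`), the form in which the cointeraction theorem applies. -/
theorem dualPair_starPairing_eval_iff (D : RestrictedDual K (𝓤 K L))
    (D' : RestrictedDual K (𝓤 K (SubAdjacent ht)))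
    (z : D'.Carrier ⊗[K] D.Carrier) (f : D.Carrier) :
    (∀ A B, dualPair (starPairing ht D') D.eval z (A ⊗ₜ B) = D.eval f (guinOudom ht A B)) ↔
      dualPair D'.eval D.eval z =
        D.eval f ∘ₗ TensorProduct.lift (envAct (leftDerivation ht)).toLinearMap := by
  constructor
  · intro h
    refine TensorProduct.ext' fun a B => ?_
    have := h (orbitEquiv ht a) B
    rw [dualPair_comp_apply D'.eval _ _ _ (starPairing_apply ht D'), LinearEquiv.coe_coe,
      guinOudom_apply, LinearEquiv.symm_apply_apply] at this
    exact this
  · intro h A B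
    rw [dualPair_comp_apply D'.eval _ _ _ (starPairing_apply ht D'), h]
    rfl

/-- The action adds degrees, so its transpose takes values in the tensor product of the graded
duals; the module bialgebra properties then give the cointeraction. -/
theorem exists_graftCoaction (he : IsHomogeneousBasis X e deg)
    (hX : ∀ m n x y, x ∈ X m → y ∈ X n → t x y ∈ Submodule.span K (X (m + n)))
    (hM : ∀ m : M, {p : M × M | p.1 + p.2 = m}.Finite) :
    ∃ ρ : (gradedRestrictedDual he hM).Carrier →ₗ[K]
      (starRestrictedDual ht he hX hM).Carrier ⊗[K] (gradedRestrictedDual he hM).Carrier,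
      (∀ f A B, dualPair (starPairing ht (starRestrictedDual ht he hX hM))
        (gradedRestrictedDual he hM).eval (ρ f) (A ⊗ₜ B) =
          (gradedRestrictedDual he hM).eval f (guinOudom ht A B)) ∧ IsCointeraction ρ := by
  generalize hD : gradedRestrictedDual he hM = D
  generalize hD' : starRestrictedDual ht he hX hM = D'
  obtain ⟨ρ, hρ⟩ := exists_linearMap_factor
    (dualPair_injective D'.eval_injective D.eval_injective)
    (LinearMap.lcomp K K (TensorProduct.lift (envAct (leftDerivation ht)).toLinearMap) ∘ₗ D.eval)
    (fun f => D'.exists_dualPair_eq D _ (by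
      subst hD hD'
      exact exists_list_gradedForms he (he.subAdjacent ht hX) hM f.2
        (envAct (leftDerivation ht)).toLinearMap
        fun _ _ _ _ ha hB => envAct_mem_component ht hX ha hB))
  refine ⟨ρ, fun f => (dualPair_starPairing_eval_iff ht D D' _ f).2 (hρ f), ?_⟩
  refine RestrictedDual.isCointeraction_of_action D D' (envAct (leftDerivation ht)).toLinearMap
    (fun B => ?_) (fun a b B => ?_) (counit_envAct _) (comul_envAct _) (envAct_one _)
    (envAct_mul _) ρ hρ
  · rw [AlgHom.toLinearMap_apply, map_one]; rfl
  · rw [AlgHom.toLinearMap_apply, map_mul]; rfl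

end GradedDuals

-- The case of a grading by positive integers

section PostLieGrading

open Coalgebra (comul counit)

variable {K : Type*} [Field K] {L : Type*} [LieRing L] [LieAlgebra K L]
  {t : L →ₗ[K] L →ₗ[K] L} {𝒢 : ℕ → Submodule K L}

theorem component_eq_envelopingComponent (n : ℕ) :
    component K (fun n => (𝒢 n : Set L)) n = envelopingComponent 𝒢 n := rfl

/-- Vanishing outside a finite set of degrees and vanishing in all large degrees agree over ℕ, where
finite sets are the bounded ones. -/
theorem mem_gradedForms_iff_gradedDual {f : Module.Dual K (𝓤 K L)} :
    WithConv.toConv f ∈ gradedForms K (fun n => (𝒢 n : Set L)) ↔ f ∈ gradedDual 𝒢 := by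
  constructor
  · intro h
    obtain ⟨F, hF, hf⟩ := mem_gradedForms.1 h
    obtain ⟨N, hN⟩ := hF.bddAbove
    exact ⟨N + 1, fun n hn A hA => hf n (fun h => by have := hN h; omega) A hA⟩
  · rintro ⟨N, hN⟩
    exact mem_gradedForms.2 ⟨Set.Iio N, Set.finite_Iio N, fun m hm A hA =>
      hN m (not_lt.1 hm) A hA⟩

namespace IsPostLieGrading

variable (h𝒢 : IsPostLieGrading t 𝒢)

theorem iSup_eq_top (h𝒢 : IsPostLieGrading t 𝒢) : ⨆ n, 𝒢 n = ⊤ :=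
  h𝒢.isInternal.submodule_iSup_eq_top

/-- The linear map `x ↦ x Xⁿ` for `x ∈ 𝔤ₙ`. -/
def toPolynomialLinear : L →ₗ[K] Polynomial (𝓤 K L) :=
  DirectSum.toModule K ℕ _ (fun n => ((Polynomial.monomial n).restrictScalars K) ∘ₗ
    (ιᵤ K : L →ₗ⁅K⁆ 𝓤 K L).toLinearMap ∘ₗ (𝒢 n).subtype) ∘ₗ
  (LinearEquiv.ofBijective (DirectSum.coeLinearMap 𝒢) h𝒢.isInternal).symm.toLinearMap

theorem toPolynomialLinear_of_mem {n : ℕ} {x : L} (hx : x ∈ 𝒢 n) :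
    h𝒢.toPolynomialLinear x = Polynomial.monomial n (ιᵤ K x) := by
  have h : (LinearEquiv.ofBijective (DirectSum.coeLinearMap 𝒢) h𝒢.isInternal).symm x =
      DirectSum.lof K ℕ (fun n => 𝒢 n) n ⟨x, hx⟩ := by
    rw [LinearEquiv.symm_apply_eq]
    exact (DirectSum.coeLinearMap_lof 𝒢 n ⟨x, hx⟩).symm
  rw [toPolynomialLinear, LinearMap.comp_apply, LinearEquiv.coe_coe, h, DirectSum.toModule_lof]
  rfl

theorem homogeneous_induction {p : L → Prop} (mem : ∀ n, ∀ x ∈ 𝒢 n, p x) (zero : p 0)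
    (add : ∀ x y, p x → p y → p (x + y)) (h𝒢 : IsPostLieGrading t 𝒢) (x : L) : p x :=
  Submodule.iSup_induction 𝒢 (motive := p) (h𝒢.iSup_eq_top ▸ Submodule.mem_top) mem zero add

/-- The Lie algebra morphism `x ↦ x Xⁿ` for `x ∈ 𝔤ₙ`. -/
def toPolynomialLie : L →ₗ⁅K⁆ Polynomial (𝓤 K L) where
  toLinearMap := h𝒢.toPolynomialLinear
  map_lie' := by
    intro x y
    change h𝒢.toPolynomialLinear ⁅x, y⁆ = ⁅h𝒢.toPolynomialLinear x, h𝒢.toPolynomialLinear y⁆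
    refine homogeneous_induction (p := fun x => h𝒢.toPolynomialLinear ⁅x, y⁆ =
      ⁅h𝒢.toPolynomialLinear x, h𝒢.toPolynomialLinear y⁆) (fun m x hx => ?_) (by simp)
      (fun x x' h h' => by rw [add_lie, map_add, h, h', map_add, add_lie]) h𝒢 x
    refine homogeneous_induction (p := fun y => h𝒢.toPolynomialLinear ⁅x, y⁆ =
      ⁅h𝒢.toPolynomialLinear x, h𝒢.toPolynomialLinear y⁆) (fun n y hy => ?_) (by simp)
      (fun x x' h h' => by rw [lie_add, map_add, h, h', map_add, lie_add]) h𝒢 y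
    rw [toPolynomialLinear_of_mem h𝒢 hx, toPolynomialLinear_of_mem h𝒢 hy,
      toPolynomialLinear_of_mem h𝒢 (h𝒢.lie_mem m n x y hx hy), LieHom.map_lie,
      LieRing.of_associative_ring_bracket, LieRing.of_associative_ring_bracket,
      Polynomial.monomial_mul_monomial, Polynomial.monomial_mul_monomial, add_comm n m, map_sub]

/-- The algebra morphism `A ↦ A Xⁿ` for `A ∈ 𝒰(𝔤)ₙ`. -/
def toPolynomial : 𝓤 K L →ₐ[K] Polynomial (𝓤 K L) :=
  UniversalEnvelopingAlgebra.lift K h𝒢.toPolynomialLie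

/-- The polynomial variable records the degree, so coefficients of the image separate the
components. Directness of the sum follows without a basis theorem for 𝒰(𝔤). -/
theorem toPolynomial_of_mem {n : ℕ} {A : 𝓤 K L} (hA : A ∈ envelopingComponent 𝒢 n) :
    h𝒢.toPolynomial A = Polynomial.monomial n A := by
  refine component_induction (X := fun n => (𝒢 n : Set L))
    (p := fun n A => h𝒢.toPolynomial A = Polynomial.monomial n A) (by simp) (by simp)
    (fun m a b ha hb => by rw [map_add, ha, hb, map_add])
    (fun m c a ha => by rw [map_smul, ha, Polynomial.smul_monomial]) (fun m n x A hx _ ih => ?_) hA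
  rw [map_mul, ih]
  have h : h𝒢.toPolynomial (ιᵤ K x) = Polynomial.monomial m (ιᵤ K x) := by
    rw [toPolynomial, UniversalEnvelopingAlgebra.lift_ι_apply]
    exact toPolynomialLinear_of_mem h𝒢 hx
  rw [h, Polynomial.monomial_mul_monomial]

theorem iSup_envelopingComponent (h𝒢 : IsPostLieGrading t 𝒢) :
    ⨆ n, envelopingComponent 𝒢 n = ⊤ := by
  rw [eq_top_iff]
  rintro A -
  refine enveloping_induction (p := fun A => A ∈ ⨆ n, envelopingComponent 𝒢 n)
    (Submodule.mem_iSup_of_mem 0 (one_mem_component (fun n => (𝒢 n : Set L))))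
    (fun a b ha hb => add_mem ha hb) (fun c a ha => Submodule.smul_mem _ c ha)
    (fun x A hA => ?_) A
  refine homogeneous_induction (p := fun x => ιᵤ K x * A ∈ ⨆ n, envelopingComponent 𝒢 n)
    (fun m x hx => ?_) (by simp) (fun x y hx hy => by rw [map_add, add_mul]; exact add_mem hx hy)
    h𝒢 x
  refine Submodule.iSup_induction _ (motive := fun A => ιᵤ K x * A ∈ ⨆ n, envelopingComponent 𝒢 n)
    hA (fun n A hA => ?_) (by simp) (fun a b ha hb => by rw [mul_add]; exact add_mem ha hb)
  exact Submodule.mem_iSup_of_mem (m + n)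
    (ι_mul_mem_component (X := fun n => (𝒢 n : Set L)) hx hA)

theorem isInternal_envelopingComponent (h𝒢 : IsPostLieGrading t 𝒢) :
    DirectSum.IsInternal (envelopingComponent 𝒢) := by
  constructor
  · have h : ∀ z m, (h𝒢.toPolynomial (DirectSum.coeAddMonoidHom (envelopingComponent 𝒢) z)).coeff
        m = z m := by
      intro z m
      induction z using DirectSum.induction_on with
      | zero => simp
      | of n a =>
        rw [DirectSum.coeAddMonoidHom_of, toPolynomial_of_mem h𝒢 a.2, Polynomial.coeff_monomial]
        split_ifs with h
        · subst h; rw [DirectSum.of_eq_same]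
        · rw [DirectSum.of_eq_of_ne _ _ _ (Ne.symm h)]; rfl
      | add z w hz hw => simp [hz, hw]
    intro z w hzw
    ext m
    rw [← h, ← h, hzw]
  · intro A
    have hA : A ∈ ⨆ n, envelopingComponent 𝒢 n := by
      rw [h𝒢.iSup_envelopingComponent]; exact Submodule.mem_top
    rw [Submodule.iSup_eq_range_dfinsupp_lsum] at hA
    exact hA

/-- A nonempty word of degree n starts with a letter of degree m between 1 and n, because 𝔤₀ = 0
allows only the zero letter in degree 0. So 𝒰ₙ lies in K·1 + ∑ 𝔤ₘ 𝒰ₙ₋ₘ, which is finite-dimensional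
by induction. -/
theorem finite_envelopingComponent (h𝒢 : IsPostLieGrading t 𝒢) (n : ℕ) :
    (envelopingComponent 𝒢 n).FG := by
  induction n using Nat.strong_induction_on with
  | _ n ih =>
    have hfg : (Submodule.span K {1} ⊔ ⨆ m ∈ Finset.Icc 1 n,
        ((𝒢 m).map (ιᵤ K : L →ₗ⁅K⁆ 𝓤 K L).toLinearMap * envelopingComponent 𝒢 (n - m)) :
          Submodule K (𝓤 K L)).FG := by
      refine (Submodule.fg_span_singleton 1).sup (Submodule.fg_biSup _ _ fun m hm => ?_)
      rw [Finset.mem_Icc] at hm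
      have := h𝒢.finite m
      exact (Submodule.FG.map _ (Module.Finite.iff_fg.1 this)).mul (ih (n - m) (by omega))
    have hle : envelopingComponent 𝒢 n ≤ (Submodule.span K {1} ⊔ ⨆ m ∈ Finset.Icc 1 n,
        ((𝒢 m).map (ιᵤ K : L →ₗ⁅K⁆ 𝓤 K L).toLinearMap * envelopingComponent 𝒢 (n - m)) :
          Submodule K (𝓤 K L)) := by
      refine Submodule.span_le.2 ?_
      rintro _ ⟨l, hl, rfl, rfl⟩
      cases l with
      | nil => exact Submodule.mem_sup_left (Submodule.mem_span_singleton_self 1)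
      | cons q l =>
        have hq := hl q List.mem_cons_self
        rw [List.map_cons, List.map_cons, List.sum_cons, List.prod_cons]
        rcases Nat.eq_zero_or_pos q.1 with h | h
        · rw [h, h𝒢.zero, Submodule.mem_bot] at hq
          rw [hq, map_zero, zero_mul]
          exact zero_mem _
        · refine Submodule.mem_sup_right (Submodule.mem_iSup_of_mem q.1
            (Submodule.mem_iSup_of_mem (Finset.mem_Icc.2 ⟨h, by omega⟩)
              (Submodule.mul_mem_mul ⟨_, hq, rfl⟩ ?_)))
          rw [Nat.add_sub_cancel_left]
          exact Submodule.subset_span ⟨l, fun p hp => hl p (List.mem_cons_of_mem _ hp), rfl, rfl⟩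
    have : Module.Finite K (Submodule.span K {1} ⊔ ⨆ m ∈ Finset.Icc 1 n,
        ((𝒢 m).map (ιᵤ K : L →ₗ⁅K⁆ 𝓤 K L).toLinearMap * envelopingComponent 𝒢 (n - m)) :
          Submodule K (𝓤 K L)) := Module.Finite.iff_fg.2 hfg
    exact Module.Finite.iff_fg.1 (Submodule.finiteDimensional_of_le hle)

theorem exists_isHomogeneousBasis (h𝒢 : IsPostLieGrading t 𝒢) :
    ∃ e : Module.Basis (Σ n, Fin (Module.finrank K (envelopingComponent 𝒢 n))) K (𝓤 K L),
      IsHomogeneousBasis (fun n => (𝒢 n : Set L)) e Sigma.fst := by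
  have hfin : ∀ n, Module.Finite K (envelopingComponent 𝒢 n) := fun n =>
    Module.Finite.iff_fg.2 (h𝒢.finite_envelopingComponent n)
  refine ⟨h𝒢.isInternal_envelopingComponent.collectedBasis fun n => Module.finBasis K _,
    fun m => ?_, fun m => ?_⟩
  · have h := congrArg (Submodule.map (envelopingComponent 𝒢 m).subtype)
      (Module.finBasis K (envelopingComponent 𝒢 m)).span_eq
    rw [Submodule.map_top, Submodule.range_subtype, Submodule.map_span, ← Set.range_comp] at h
    rw [component_eq_envelopingComponent, ← h]
    congr 1
    ext A
    constructor
    · rintro ⟨i, rfl⟩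
      exact ⟨⟨m, i⟩, rfl, by rw [DirectSum.IsInternal.collectedBasis_coe]; rfl⟩
    · rintro ⟨⟨n, i⟩, rfl, rfl⟩
      exact ⟨i, by rw [DirectSum.IsInternal.collectedBasis_coe]; rfl⟩
  · refine (Set.finite_range fun i : Fin (Module.finrank K (envelopingComponent 𝒢 m)) =>
      (⟨m, i⟩ : Σ n, Fin (Module.finrank K (envelopingComponent 𝒢 n)))).subset ?_
    rintro ⟨n, i⟩ rfl
    exact ⟨i, rfl⟩

theorem graft_mem_span (h𝒢 : IsPostLieGrading t 𝒢) (m n : ℕ) (x y : L)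
    (hx : x ∈ (𝒢 m : Set L)) (hy : y ∈ (𝒢 n : Set L)) :
    t x y ∈ Submodule.span K (𝒢 (m + n) : Set L) :=
  Submodule.subset_span (h𝒢.graft_mem m n x y hx hy)

end IsPostLieGrading

theorem tensorPairing_eq_dualPair {H H' : Type*} [AddCommGroup H] [Module K H] [AddCommGroup H']
    [Module K H'] (p : H →ₗ[K] Module.Dual K (𝓤 K L)) (p' : H' →ₗ[K] Module.Dual K (𝓤 K L))
    (A B : 𝓤 K L) (z : H ⊗[K] H') : tensorPairing p p' A B z = dualPair p p' z (A ⊗ₜ B) := rfl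

theorem mem_range_starPairing_iff (ht : IsPostLie t)
    (D : RestrictedDual K (𝓤 K (SubAdjacent ht))) (f : Module.Dual K (𝓤 K L)) :
    f ∈ LinearMap.range (starPairing ht D) ↔
      WithConv.toConv (f ∘ₗ (orbitEquiv ht).toLinearMap) ∈ D.forms := by
  rw [← D.mem_range_eval]
  constructor
  · rintro ⟨h, rfl⟩
    exact ⟨h, by ext1 a; simp [starPairing_apply]⟩
  · rintro ⟨h, hh⟩
    exact ⟨h, by ext1 A; rw [starPairing_apply, hh]; simp⟩

/-- Uniqueness reduces g to `guinOudom`. The second Hopf algebra consists of forms on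
𝒰(`SubAdjacent`), viewed on 𝒰(𝔤) through the inverse orbit map, and ρ is unique because the pairing
of tensors is injective. -/
theorem exists_gradedDual_cointeraction {t : L →ₗ[K] L →ₗ[K] L} {𝒢 : ℕ → Submodule K L}
    {g : 𝓤 K L →ₗ[K] 𝓤 K L →ₗ[K] 𝓤 K L} (ht : IsPostLie t) (h𝒢 : IsPostLieGrading t 𝒢)
    (hg : IsGuinOudomExtension t g) :
    ∃ (D : RestrictedDual K (𝓤 K L)) (D' : RestrictedDual K (𝓤 K (SubAdjacent ht)))
      (ρ : D.Carrier →ₗ[K] D'.Carrier ⊗[K] D.Carrier),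
      IsGradedDualHopfAlgebra 𝒢 (fun A B => A * B) D.eval ∧
      IsGradedDualHopfAlgebra 𝒢 (starProduct g) (starPairing ht D') ∧
      IsGraftCoaction g D.eval (starPairing ht D') ρ ∧
      (∀ ρ' : D.Carrier →ₗ[K] D'.Carrier ⊗[K] D.Carrier,
        IsGraftCoaction g D.eval (starPairing ht D') ρ' → ρ' = ρ) ∧ IsCointeraction ρ := by
  obtain rfl := hg.eq_guinOudom ht
  obtain ⟨e, he⟩ := h𝒢.exists_isHomogeneousBasis
  have hM : ∀ m : ℕ, {p : ℕ × ℕ | p.1 + p.2 = m}.Finite := fun m =>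
    (Finset.HasAntidiagonal.antidiagonal m).finite_toSet.subset fun p hp =>
      Finset.mem_coe.2 (Finset.HasAntidiagonal.mem_antidiagonal.2 hp)
  obtain ⟨ρ, hρ, hco⟩ := exists_graftCoaction ht he h𝒢.graft_mem_span hM
  refine ⟨_, _, ρ, ?_, ?_, fun f A B => (hρ f A B).symm, fun ρ' hρ' => ?_, hco⟩
  · refine ⟨RestrictedDual.eval_injective _, ?_, fun A => rfl, fun x y A =>
      RestrictedDual.eval_mul _ x y A, fun x => rfl, fun x A B => ?_⟩
    · ext f
      rw [RestrictedDual.mem_range_eval]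
      exact mem_gradedForms_iff_gradedDual
    · rw [tensorPairing_eq_dualPair, RestrictedDual.dualPair_comul]
      rfl
  · refine ⟨starPairing_injective ht _, ?_, starPairing_one ht _, starPairing_mul ht _,
      counit_eq_starPairing ht _, fun x A B => dualPair_starPairing_comul ht _ x A B⟩
    ext f
    rw [mem_range_starPairing_iff, ← mem_gradedForms_iff_gradedDual]
    refine exists_congr fun F => and_congr_right fun _ => forall₂_congr fun m _ => ?_
    rw [component_subAdjacentDegree ht h𝒢.graft_mem_span]
    constructor
    · intro h A hA
      simpa using h _ ⟨A, hA, rfl⟩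
    · rintro h _ ⟨A, hA, rfl⟩
      simpa using h A hA
  · ext1 f
    apply dualPair_injective (starPairing_injective ht _) (RestrictedDual.eval_injective _)
    exact TensorProduct.ext' fun A B => (hρ' f A B).symm.trans (hρ f A B).symm

end PostLieGrading

-- Derivations of free Lie algebras and induction on words in the generators

section FreeLie

variable {K : Type*} [Field K]

section Tangent

variable (L : Type*) [LieRing L]

/-- The Lie algebra `𝔤 ⊕ ε 𝔤` with `ε² = 0`. -/
def TangentLie : Type _ := L × L

instance : AddCommGroup (TangentLie L) := inferInstanceAs (AddCommGroup (L × L))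

instance : LieRing (TangentLie L) where
  bracket a b := (⁅a.1, b.1⁆, ⁅a.1, b.2⁆ + ⁅a.2, b.1⁆)
  add_lie a b c := Prod.ext (add_lie a.1 b.1 c.1) (by
    change ⁅a.1 + b.1, c.2⁆ + ⁅a.2 + b.2, c.1⁆ = (⁅a.1, c.2⁆ + ⁅a.2, c.1⁆) + (⁅b.1, c.2⁆ + ⁅b.2,
        c.1⁆)
    simp only [add_lie]; abel)
  lie_add a b c := Prod.ext (lie_add a.1 b.1 c.1) (by
    change ⁅a.1, b.2 + c.2⁆ + ⁅a.2, b.1 + c.1⁆ = (⁅a.1, b.2⁆ + ⁅a.2, b.1⁆) + (⁅a.1, c.2⁆ + ⁅a.2,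
        c.1⁆)
    simp only [lie_add]; abel)
  lie_self a := Prod.ext (lie_self a.1) (by
    change ⁅a.1, a.2⁆ + ⁅a.2, a.1⁆ = 0
    rw [← lie_skew a.1 a.2, neg_add_cancel])
  leibniz_lie a b c := Prod.ext (leibniz_lie a.1 b.1 c.1) (by
    change ⁅a.1, ⁅b.1, c.2⁆ + ⁅b.2, c.1⁆⁆ + ⁅a.2, ⁅b.1, c.1⁆⁆ =
      (⁅⁅a.1, b.1⁆, c.2⁆ + ⁅⁅a.1, b.2⁆ + ⁅a.2, b.1⁆, c.1⁆) +
      (⁅b.1, ⁅a.1, c.2⁆ + ⁅a.2, c.1⁆⁆ + ⁅b.2, ⁅a.1, c.1⁆⁆)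
    simp only [lie_add, add_lie, leibniz_lie a.1 b.1 c.2, leibniz_lie a.1 b.2 c.1,
      leibniz_lie a.2 b.1 c.1]
    abel)

instance [LieAlgebra K L] : Module K (TangentLie L) := inferInstanceAs (Module K (L × L))

instance [LieAlgebra K L] : LieAlgebra K (TangentLie L) where
  lie_smul c a b := Prod.ext (lie_smul c a.1 b.1) (by
    change ⁅a.1, c • b.2⁆ + ⁅a.2, c • b.1⁆ = c • (⁅a.1, b.2⁆ + ⁅a.2, b.1⁆)
    simp only [lie_smul, smul_add])

end Tangent

variable {X : Type*}

/-- The elements satisfying p form a Lie subalgebra containing the generators, and freeness retracts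
the whole algebra onto it. -/
theorem freeLie_induction {p : FreeLieAlgebra K X → Prop} (of : ∀ x, p (FreeLieAlgebra.of K x))
    (zero : p 0) (add : ∀ a b, p a → p b → p (a + b)) (smul : ∀ (c : K) a, p a → p (c • a))
    (lie : ∀ a b, p a → p b → p ⁅a, b⁆) (a : FreeLieAlgebra K X) : p a := by
  let S : LieSubalgebra K (FreeLieAlgebra K X) :=
    { carrier := {a | p a}
      add_mem' := fun ha hb => add _ _ ha hb
      zero_mem' := zero
      smul_mem' := fun c a ha => smul c a ha
      lie_mem' := fun ha hb => lie _ _ ha hb }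
  let f : FreeLieAlgebra K X →ₗ⁅K⁆ S :=
    FreeLieAlgebra.lift K fun x => ⟨FreeLieAlgebra.of K x, of x⟩
  have h : S.incl.comp f = LieHom.id := by
    ext x
    simp [f]
  have h' := LieHom.congr_fun h a
  rw [LieHom.comp_apply, LieHom.id_apply] at h'
  rw [← h']
  exact (f a).2

theorem freeLie_derivation_ext {δ δ' : LieDerivation K (FreeLieAlgebra K X) (FreeLieAlgebra K X)}
    (h : ∀ x, δ (FreeLieAlgebra.of K x) = δ' (FreeLieAlgebra.of K x)) : δ = δ' := by
  ext a
  induction a using freeLie_induction with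
  | of x => exact h x
  | zero => simp
  | add a b ha hb => rw [map_add, map_add, ha, hb]
  | smul c a ha => rw [map_smul, map_smul, ha]
  | lie a b ha hb => rw [LieDerivation.apply_lie_eq_sub, LieDerivation.apply_lie_eq_sub, ha, hb]

/-- The morphism `a ↦ a + ε δ a` defined by the values of `δ` on the generators. -/
def freeLieTangent (f : X → FreeLieAlgebra K X) :
    FreeLieAlgebra K X →ₗ⁅K⁆ TangentLie (FreeLieAlgebra K X) :=
  FreeLieAlgebra.lift K fun x => (FreeLieAlgebra.of K x, f x)

theorem freeLieTangent_of (f : X → FreeLieAlgebra K X) (x : X) :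
    freeLieTangent f (FreeLieAlgebra.of K x) = (FreeLieAlgebra.of K x, f x) :=
  FreeLieAlgebra.lift_of_apply _ _

theorem fst_freeLieTangent (f : X → FreeLieAlgebra K X) (a : FreeLieAlgebra K X) :
    (freeLieTangent f a).1 = a := by
  induction a using freeLie_induction with
  | of x => rw [freeLieTangent_of]
  | zero => rw [map_zero]; rfl
  | add a b ha hb =>
    rw [map_add]
    exact congrArg₂ (· + ·) ha hb
  | smul c a ha =>
    rw [map_smul]
    exact congrArg (c • ·) ha
  | lie a b ha hb =>
    rw [LieHom.map_lie]
    exact congrArg₂ Bracket.bracket ha hb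

/-- The derivation of the free Lie algebra with prescribed values on the generators. -/
def freeLieDerivation (f : X → FreeLieAlgebra K X) :
    LieDerivation K (FreeLieAlgebra K X) (FreeLieAlgebra K X) where
  toFun a := (freeLieTangent f a).2
  map_add' a b := by rw [map_add]; rfl
  map_smul' c a := by rw [map_smul]; rfl
  leibniz' a b := by
    change (freeLieTangent f ⁅a, b⁆).2 = ⁅a, (freeLieTangent f b).2⁆ - ⁅b, (freeLieTangent f a).2⁆
    rw [LieHom.map_lie]
    change ⁅(freeLieTangent f a).1, (freeLieTangent f b).2⁆ +
      ⁅(freeLieTangent f a).2, (freeLieTangent f b).1⁆ = _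
    rw [fst_freeLieTangent, fst_freeLieTangent, ← lie_skew b]
    abel

@[simp]
theorem freeLieDerivation_of (f : X → FreeLieAlgebra K X) (x : X) :
    freeLieDerivation f (FreeLieAlgebra.of K x) = f x := by
  change (freeLieTangent f (FreeLieAlgebra.of K x)).2 = f x
  rw [freeLieTangent_of]

/-- A generator, in the enveloping algebra. -/
def letter (K : Type*) [Field K] {X : Type*} (x : X) : 𝓤 K (FreeLieAlgebra K X) :=
  ιᵤ K (FreeLieAlgebra.of K x)

/-- The span of the generators. -/
def letterSpan (K : Type*) [Field K] (X : Type*) : Submodule K (FreeLieAlgebra K X) :=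
  Submodule.span K (Set.range (FreeLieAlgebra.of K))

theorem adjoin_range_letter : Algebra.adjoin K (Set.range (letter K (X := X))) = ⊤ := by
  rw [← top_le_iff, ← adjoin_range_ι]
  refine Algebra.adjoin_le ?_
  rintro _ ⟨a, rfl⟩
  refine freeLie_induction (p := fun a => ιᵤ K a ∈ Algebra.adjoin K (Set.range (letter K (X := X))))
    (fun x => Algebra.subset_adjoin ⟨x, rfl⟩) (by rw [map_zero]; exact zero_mem _)
    (fun a b ha hb => by rw [map_add]; exact add_mem ha hb)
    (fun c a ha => by rw [map_smul]; exact Subalgebra.smul_mem _ ha c)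
    (fun a b ha hb => by
      rw [LieHom.map_lie, LieRing.of_associative_ring_bracket]
      exact sub_mem (mul_mem ha hb) (mul_mem hb ha)) a

theorem adjoin_letterSpan :
    Algebra.adjoin K (ιᵤ K '' (letterSpan K X : Set (FreeLieAlgebra K X))) = ⊤ := by
  rw [← top_le_iff, ← adjoin_range_letter]
  refine Algebra.adjoin_mono ?_
  rintro _ ⟨x, rfl⟩
  exact ⟨_, Submodule.subset_span ⟨x, rfl⟩, rfl⟩

/-- Induction along left multiplications by generators. -/
theorem letter_induction {p : 𝓤 K (FreeLieAlgebra K X) → Prop} (one : p 1)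
    (add : ∀ a b, p a → p b → p (a + b)) (smul : ∀ (c : K) a, p a → p (c • a))
    (letter_mul : ∀ x a, p a → p (letter K x * a)) (a : 𝓤 K (FreeLieAlgebra K X)) : p a := by
  have key : ∀ a ∈ Algebra.adjoin K (Set.range (letter K (X := X))), ∀ b, p b → p (a * b) := by
    intro a ha
    induction ha using Algebra.adjoin_induction with
    | mem x hx => obtain ⟨x, rfl⟩ := hx; exact letter_mul x
    | algebraMap r => intro b hb; rw [← Algebra.smul_def]; exact smul r b hb
    | add x y _ _ hx hy => intro b hb; rw [add_mul]; exact add _ _ (hx b hb) (hy b hb)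
    | mul x y _ _ hx hy => intro b hb; rw [mul_assoc]; exact hx _ (hy _ hb)
  have := key a (by rw [adjoin_range_letter]; trivial) 1 one
  rwa [mul_one] at this

/-- Induction on word length: in the step, the induction hypothesis is available for all
derivatives of the shorter word along derivations preserving the span of the generators. -/
theorem letter_derivation_induction (p : Submodule K (𝓤 K (FreeLieAlgebra K X))) (one : 1 ∈ p)
    (mul : ∀ x, ∀ A ∈ p, (∀ δ : LieDerivation K (FreeLieAlgebra K X) (FreeLieAlgebra K X),
      (∀ y, δ (FreeLieAlgebra.of K y) ∈ letterSpan K X) → envelopingDerivation δ A ∈ p) →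
        letter K x * A ∈ p) (A : 𝓤 K (FreeLieAlgebra K X)) : A ∈ p := by
  refine enveloping_derivation_induction (letterSpan K X) adjoin_letterSpan p one ?_ A
  intro y hy A hA hD
  have hD' : ∀ δ : LieDerivation K (FreeLieAlgebra K X) (FreeLieAlgebra K X),
      (∀ y, δ (FreeLieAlgebra.of K y) ∈ letterSpan K X) → envelopingDerivation δ A ∈ p := by
    intro δ hδ
    refine hD δ fun y hy => ?_
    induction hy using Submodule.span_induction with
    | mem y hy => obtain ⟨x, rfl⟩ := hy; exact hδ x
    | zero => rw [map_zero]; exact zero_mem _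
    | add a b _ _ ha hb => rw [map_add]; exact add_mem ha hb
    | smul c a _ ha => rw [map_smul]; exact Submodule.smul_mem _ _ ha
  induction hy using Submodule.span_induction with
  | mem y hy => obtain ⟨x, rfl⟩ := hy; exact mul x A hA hD'
  | zero => simp
  | add a b _ _ ha hb => rw [map_add, add_mul]; exact add_mem ha hb
  | smul c a _ ha => rw [map_smul, smul_mul_assoc]; exact Submodule.smul_mem _ _ ha

end FreeLie

-- Extending a product on generators to a post-Lie product on the free Lie algebra

section FreePostLie

open Coalgebra (comul counit)

variable {K : Type*} [Field K] {X : Type*}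

/-- Linear combinations of generators, in the free Lie algebra. -/
def generatorIncl (K X : Type*) [Field K] : (X →₀ K) →ₗ[K] FreeLieAlgebra K X :=
  Finsupp.linearCombination K (FreeLieAlgebra.of K)

@[simp]
theorem generatorIncl_single (x : X) :
    generatorIncl K X (Finsupp.single x 1) = FreeLieAlgebra.of K x := by
  simp [generatorIncl]

theorem generatorIncl_mem (v : X →₀ K) : generatorIncl K X v ∈ letterSpan K X := by
  rw [letterSpan, ← Finsupp.range_linearCombination]
  exact ⟨v, rfl⟩

variable (s : (X →₀ K) →ₗ[K] (X →₀ K) →ₗ[K] (X →₀ K))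

/-- The action of the free Lie algebra on itself by derivations that extends a product on the span
of the generators. -/
def generatorDerivation : FreeLieAlgebra K X →ₗ⁅K⁆
    LieDerivation K (FreeLieAlgebra K X) (FreeLieAlgebra K X) :=
  FreeLieAlgebra.lift K fun x => freeLieDerivation fun y =>
    generatorIncl K X (s (Finsupp.single x 1) (Finsupp.single y 1))

theorem generatorDerivation_of (x y : X) :
    generatorDerivation s (FreeLieAlgebra.of K x) (FreeLieAlgebra.of K y) =
      generatorIncl K X (s (Finsupp.single x 1) (Finsupp.single y 1)) := by
  rw [generatorDerivation, FreeLieAlgebra.lift_of_apply, freeLieDerivation_of]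

/-- The action of the free Lie algebra on its enveloping algebra in which a generator acts as the
sum of its left multiplication and its derivation. -/
def generatorAction : FreeLieAlgebra K X →ₗ⁅K⁆ Module.End K (𝓤 K (FreeLieAlgebra K X)) :=
  FreeLieAlgebra.lift K fun x => LinearMap.mulLeft K (letter K x) +
    envelopingDerivation (generatorDerivation s (FreeLieAlgebra.of K x))

theorem generatorAction_of (x : X) (A : 𝓤 K (FreeLieAlgebra K X)) :
    generatorAction s (FreeLieAlgebra.of K x) A = letter K x * A +
      envelopingDerivation (generatorDerivation s (FreeLieAlgebra.of K x)) A := by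
  rw [generatorAction, FreeLieAlgebra.lift_of_apply]; rfl

/-- Operators "left multiplication by an element of 𝔤 plus a derivation" are closed under linear
combinations and commutators, so it suffices that the generators act this way. -/
theorem isTwistedAction_generatorAction :
    IsTwistedAction (generatorDerivation s) (generatorAction s) := by
  intro n
  induction n using freeLie_induction with
  | of x => exact ⟨_, generatorAction_of s x⟩
  | zero => exact ⟨0, fun A => by
    rw [map_zero, map_zero, map_zero, zero_mul, ← envelopingDerivationHom_apply, map_zero,
        zero_add]⟩
  | add a b ha hb =>
    obtain ⟨x, hx⟩ := ha
    obtain ⟨y, hy⟩ := hb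
    refine ⟨x + y, fun A => ?_⟩
    rw [map_add, LinearMap.add_apply, hx, hy, map_add, map_add, ← envelopingDerivationHom_apply,
      ← envelopingDerivationHom_apply, ← envelopingDerivationHom_apply, map_add,
          LinearMap.add_apply]
    noncomm_ring
  | smul c a ha =>
    obtain ⟨x, hx⟩ := ha
    refine ⟨c • x, fun A => ?_⟩
    rw [map_smul, LinearMap.smul_apply, hx, map_smul, map_smul, ← envelopingDerivationHom_apply,
      ← envelopingDerivationHom_apply, map_smul, LinearMap.smul_apply, smul_add, smul_mul_assoc]
  | lie a b ha hb =>
    obtain ⟨x, hx⟩ := ha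
    obtain ⟨y, hy⟩ := hb
    -- The commutator of a derivation with a left multiplication is left multiplication by the
    -- derivative, which produces the last two terms.
    refine ⟨⁅x, y⁆ + generatorDerivation s a y - generatorDerivation s b x, fun A => ?_⟩
    rw [LieHom.map_lie, LieRing.of_associative_ring_bracket, LinearMap.sub_apply,
      Module.End.mul_apply, Module.End.mul_apply, hx, hy, hx, hy, LieHom.map_lie,
      ← envelopingDerivationHom_apply ⁅_, _⁆, LieHom.map_lie, LieRing.of_associative_ring_bracket,
      envelopingDerivationHom_apply, envelopingDerivationHom_apply, LinearMap.sub_apply,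
      Module.End.mul_apply, Module.End.mul_apply]
    simp only [map_add, map_sub, envelopingDerivation_mul, envelopingDerivation_ι, LieHom.map_lie,
      LieRing.of_associative_ring_bracket]
    noncomm_ring

/-- The words in the generators, in the tensor algebra. -/
def toTensorAlgebra (K X : Type*) [Field K] :
    𝓤 K (FreeLieAlgebra K X) →ₐ[K] TensorAlgebra K (X →₀ K) :=
  UniversalEnvelopingAlgebra.lift K (FreeLieAlgebra.lift K fun x =>
    TensorAlgebra.ι K (Finsupp.single x 1))

theorem toTensorAlgebra_letter (x : X) :
    toTensorAlgebra K X (letter K x) = TensorAlgebra.ι K (Finsupp.single x 1) := by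
  rw [toTensorAlgebra, letter, UniversalEnvelopingAlgebra.lift_ι_apply,
    FreeLieAlgebra.lift_of_apply]

theorem toTensorAlgebra_incl (v : X →₀ K) :
    toTensorAlgebra K X (ιᵤ K (generatorIncl K X v)) = TensorAlgebra.ι K v := by
  induction v using Finsupp.induction_linear with
  | zero => simp
  | add v w hv hw => simp only [map_add, hv, hw]
  | single y c =>
    rw [← mul_one c, ← smul_eq_mul, ← Finsupp.smul_single, map_smul, map_smul, map_smul, map_smul,
      generatorIncl_single]
    exact congrArg (c • ·) (toTensorAlgebra_letter y)

/-- The derivations attached to generators keep the span of generators stable, so the recursion can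
be run on words in the generators alone. -/
theorem toTensorAlgebra_derivation (x : X) (A : 𝓤 K (FreeLieAlgebra K X)) :
    toTensorAlgebra K X (envelopingDerivation (generatorDerivation s (FreeLieAlgebra.of K x)) A) =
      tensorDerivation s (Finsupp.single x 1) (toTensorAlgebra K X A) := by
  induction A using letter_induction with
  | one => simp
  | add a b ha hb => simp only [map_add, ha, hb]
  | smul c a ha => simp only [map_smul, ha]
  | letter_mul y a ha =>
    rw [letter, envelopingDerivation_mul, envelopingDerivation_ι, generatorDerivation_of, map_add,
      map_mul, map_mul, map_mul, ha, toTensorAlgebra_incl, ← letter, toTensorAlgebra_letter,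
      tensorDerivation_ι_mul]

/-- Same inverse as for `bijective_orbitMap`. Here the elements of the enveloping algebra are mapped
to tensors over the space of generators, so there are no relations through which the recursion must
descend. -/
theorem bijective_orbitMap_generatorAction :
    Function.Bijective (orbitMap (generatorAction s)) := by
  set f : 𝓤 K (FreeLieAlgebra K X) →ₗ[K] 𝓤 K (FreeLieAlgebra K X) :=
    graftRec s ((LinearMap.mul K _) ∘ₗ (ιᵤ K : FreeLieAlgebra K X →ₗ⁅K⁆ _).toLinearMap ∘ₗ
      generatorIncl K X) 1 ∘ₗ (toTensorAlgebra K X).toLinearMap with hfdef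
  have hf1 : f 1 = 1 := by simp [hfdef]
  have hf : ∀ x A, f (letter K x * A) = letter K x * f A -
      f (envelopingDerivation (generatorDerivation s (FreeLieAlgebra.of K x)) A) := by
    intro x A
    simp only [hfdef, LinearMap.comp_apply, AlgHom.toLinearMap_apply, map_mul,
      toTensorAlgebra_letter, graftRec_ι_mul, toTensorAlgebra_derivation, generatorIncl_single]
    rfl
  have hl : ∀ a, f (orbitMap (generatorAction s) a) = a := by
    intro a
    induction a using letter_induction with
    | one => simp [hf1]
    | add a b ha hb => rw [map_add, map_add, ha, hb]
    | smul c a ha => rw [map_smul, map_smul, ha]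
    | letter_mul x a ha =>
      rw [letter, orbitMap_ι_mul, generatorAction_of, map_add, hf, ha, letter]
      simp
  refine ⟨Function.LeftInverse.injective hl, fun A => ⟨f A, ?_⟩⟩
  refine letter_derivation_induction
    (LinearMap.eqLocus (orbitMap (generatorAction s) ∘ₗ f) LinearMap.id) (by simp [hf1])
    (fun x A hA hD => ?_) A
  have h := hD (generatorDerivation s (FreeLieAlgebra.of K x)) fun y => by
    rw [generatorDerivation_of]; exact generatorIncl_mem _
  simp only [LinearMap.mem_eqLocus, LinearMap.comp_apply, LinearMap.id_apply] at hA h ⊢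
  rw [hf, map_sub, h, letter, orbitMap_ι_mul, hA, generatorAction_of, letter]
  simp

/-- The orbit map of the unit, as an isomorphism. -/
def generatorEquiv : 𝓤 K (FreeLieAlgebra K X) ≃ₗ[K] 𝓤 K (FreeLieAlgebra K X) :=
  LinearEquiv.ofBijective _ (bijective_orbitMap_generatorAction s)

theorem generatorEquiv_apply (a : 𝓤 K (FreeLieAlgebra K X)) :
    generatorEquiv s a = orbitMap (generatorAction s) a := rfl

theorem generatorEquiv_symm_one : (generatorEquiv s).symm 1 = 1 := by
  rw [LinearEquiv.symm_apply_eq, generatorEquiv_apply, orbitMap_one]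

theorem generatorEquiv_symm_letter (x : X) :
    (generatorEquiv s).symm (letter K x) = letter K x := by
  rw [LinearEquiv.symm_apply_eq, generatorEquiv_apply, ← mul_one (letter K x), letter,
    orbitMap_ι_mul, orbitMap_one, generatorAction_of]
  simp [letter]

theorem comul_generatorEquiv_symm (a : FreeLieAlgebra K X) :
    comul (R := K) ((generatorEquiv s).symm (ιᵤ K a)) =
      (generatorEquiv s).symm (ιᵤ K a) ⊗ₜ 1 + 1 ⊗ₜ (generatorEquiv s).symm (ιᵤ K a) := by
  have h : ∀ A, comul (R := K) ((generatorEquiv s).symm A) =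
      TensorProduct.map (generatorEquiv s).symm.toLinearMap (generatorEquiv s).symm.toLinearMap
        (comul A) := by
    intro A
    obtain ⟨a, rfl⟩ := (generatorEquiv s).surjective A
    rw [LinearEquiv.symm_apply_apply, generatorEquiv_apply,
      (isTwistedAction_generatorAction s).comul_orbitMap]
    generalize comul (R := K) a = z
    induction z using TensorProduct.induction_on with
    | zero => simp
    | tmul b c => simp [← generatorEquiv_apply]
    | add z z' hz hz' => simp only [map_add, ← hz, ← hz']
  rw [h, comul_ι]
  simp [generatorEquiv_symm_one]

/-- The product on the free Lie algebra that extends a product on the span of the generators. -/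
def freePostLieProduct : FreeLieAlgebra K X →ₗ[K] FreeLieAlgebra K X →ₗ[K] FreeLieAlgebra K X :=
  (lieAct (generatorDerivation s)).toLinearMap ∘ₗ (generatorEquiv s).symm.toLinearMap ∘ₗ
    (ιᵤ K : FreeLieAlgebra K X →ₗ⁅K⁆ _).toLinearMap

theorem freePostLieProduct_apply (a b : FreeLieAlgebra K X) : freePostLieProduct s a b =
    lieAct (generatorDerivation s) ((generatorEquiv s).symm (ιᵤ K a)) b := rfl

theorem freePostLieProduct_of (x y : X) :
    freePostLieProduct s (FreeLieAlgebra.of K x) (FreeLieAlgebra.of K y) =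
      generatorIncl K X (s (Finsupp.single x 1) (Finsupp.single y 1)) := by
  rw [freePostLieProduct_apply, ← letter, generatorEquiv_symm_letter, letter, lieAct_ι,
    generatorDerivation_of]

/-- The preimage of a is primitive and its orbit value is a. Acting with it on b therefore gives ab
plus the derivation term a ▷ b. -/
theorem generatorEquiv_mul_symm (a b : FreeLieAlgebra K X) :
    (generatorEquiv s).symm (ιᵤ K a) * (generatorEquiv s).symm (ιᵤ K b) =
      (generatorEquiv s).symm (ιᵤ K a * ιᵤ K b) +
        (generatorEquiv s).symm (ιᵤ K (freePostLieProduct s a b)) := by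
  rw [← map_add, LinearEquiv.eq_symm_apply, generatorEquiv_apply, orbitMap_mul,
    ← generatorEquiv_apply, LinearEquiv.apply_symm_apply,
    (isTwistedAction_generatorAction s).lift_apply, comul_generatorEquiv_symm,
    freePostLieProduct_apply, ← envAct_ι_right]
  simp [← generatorEquiv_apply]

/-- Antisymmetrising `generatorEquiv_mul_symm` expresses the preimage of [a, b] by products of
preimages, which is the first identity. The second holds because preimages of elements of 𝔤 are
primitive and so act as derivations. -/
theorem isPostLie_freePostLieProduct : IsPostLie (freePostLieProduct s) where
  lie_left a b c := by
    have h : (generatorEquiv s).symm (ιᵤ K ⁅a, b⁆) =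
        (generatorEquiv s).symm (ιᵤ K a) * (generatorEquiv s).symm (ιᵤ K b) -
        (generatorEquiv s).symm (ιᵤ K (freePostLieProduct s a b)) -
        ((generatorEquiv s).symm (ιᵤ K b) * (generatorEquiv s).symm (ιᵤ K a) -
        (generatorEquiv s).symm (ιᵤ K (freePostLieProduct s b a))) := by
      rw [generatorEquiv_mul_symm, generatorEquiv_mul_symm, LieHom.map_lie,
        LieRing.of_associative_ring_bracket, map_sub]
      abel
    rw [freePostLieProduct_apply, h]
    simp only [map_sub, map_mul, LinearMap.sub_apply, Module.End.mul_apply,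
      ← freePostLieProduct_apply]
    abel
  lie_right a b c := by
    rw [freePostLieProduct_apply, lieAct_lie, comul_generatorEquiv_symm]
    simp [← freePostLieProduct_apply]

/-- A post-Lie product on a free Lie algebra is determined by its values on the generators, provided
that these are combinations of generators. -/
theorem IsPostLie.eq_of_generators {t t' : FreeLieAlgebra K X →ₗ[K] FreeLieAlgebra K X →ₗ[K]
      FreeLieAlgebra K X} (ht : IsPostLie t) (ht' : IsPostLie t')
    (h : ∀ x y, t (FreeLieAlgebra.of K x) (FreeLieAlgebra.of K y) =
      t' (FreeLieAlgebra.of K x) (FreeLieAlgebra.of K y))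
    (hmem : ∀ x y, t (FreeLieAlgebra.of K x) (FreeLieAlgebra.of K y) ∈ letterSpan K X) :
    t = t' := by
  have hD : ∀ x, leftDerivation ht (toSubAdjacent ht (FreeLieAlgebra.of K x)) =
      leftDerivation ht' (toSubAdjacent ht' (FreeLieAlgebra.of K x)) := fun x =>
    freeLie_derivation_ext fun y => h x y
  -- Both products are the action of the inverse orbit map. The generators act identically and
  -- preserve the span of generators, so induction on words in the generators applies.
  have key : ∀ A, A ∈ LinearMap.eqLocus
      ((lieAct (leftDerivation ht)).toLinearMap ∘ₗ (orbitEquiv ht).symm.toLinearMap)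
      ((lieAct (leftDerivation ht')).toLinearMap ∘ₗ (orbitEquiv ht').symm.toLinearMap) := by
    refine letter_derivation_induction _ (by simp) fun x A hA hδ => ?_
    have h' := hδ (leftDerivation ht (toSubAdjacent ht (FreeLieAlgebra.of K x))) (hmem x)
    simp only [LinearMap.mem_eqLocus, LinearMap.comp_apply, LinearEquiv.coe_coe,
      AlgHom.toLinearMap_apply] at hA h' ⊢
    rw [letter, orbitEquiv_symm_ι_mul, orbitEquiv_symm_ι_mul, map_sub, map_sub, map_mul, map_mul,
      hA, h', hD]
    congr 2
    ext1 y
    rw [lieAct_ι, lieAct_ι, hD]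
  ext a b
  have := LinearMap.congr_fun (key (ιᵤ K a)) b
  simp only [LinearMap.comp_apply, LinearEquiv.coe_coe, AlgHom.toLinearMap_apply,
    orbitEquiv_symm_ι, lieAct_ι] at this
  exact this

end FreePostLie

-- The basis of words in the enveloping algebra of a free Lie algebra

section Words

open Coalgebra (comul counit)

variable {K : Type*} [Field K] {X : Type*}

/-- The basis of words in the generators of the enveloping algebra of a free Lie algebra. -/
def wordBasis (K X : Type*) [Field K] : Module.Basis (List X) K (𝓤 K (FreeLieAlgebra K X)) :=
  (FreeAlgebra.basisFreeMonoid K X).map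
    (FreeLieAlgebra.universalEnvelopingEquivFreeAlgebra K X).symm.toLinearEquiv

theorem basisFreeMonoid_apply (l : List X) :
    FreeAlgebra.basisFreeMonoid K X l = (l.map (FreeAlgebra.ι K)).prod := by
  change FreeAlgebra.equivMonoidAlgebraFreeMonoid.symm
    (MonoidAlgebra.single (FreeMonoid.ofList l) (1 : K)) = _
  rw [AlgEquiv.symm_apply_eq]
  induction l with
  | nil => simp; rfl
  | cons x l ih =>
    rw [List.map_cons, List.prod_cons, map_mul, ← ih]
    simp [FreeAlgebra.equivMonoidAlgebraFreeMonoid]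

theorem wordBasis_apply (l : List X) : wordBasis K X l = (l.map (letter K)).prod := by
  have h : wordBasis K X l = (FreeLieAlgebra.universalEnvelopingEquivFreeAlgebra K X).symm
    (FreeAlgebra.basisFreeMonoid K X l) := rfl
  rw [h, basisFreeMonoid_apply, map_list_prod, List.map_map]
  congr 2
  ext x
  simp [letter]

theorem wordBasis_nil : wordBasis K X [] = 1 := by simp [wordBasis_apply]

theorem wordBasis_cons (x : X) (l : List X) :
    wordBasis K X (x :: l) = letter K x * wordBasis K X l := by
  simp [wordBasis_apply]

theorem wordBasis_append (l l' : List X) :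
    wordBasis K X (l ++ l') = wordBasis K X l * wordBasis K X l' := by
  simp [wordBasis_apply]

theorem counit_wordBasis (l : List X) :
    counit (R := K) (wordBasis K X l) = if l.isEmpty then 1 else 0 := by
  cases l with
  | nil => simp [wordBasis_nil]
  | cons x l => simp [wordBasis_cons, letter]

theorem comul_wordBasis (l : List X) : comul (R := K) (wordBasis K X l) =
    ((unshuffles l).map fun p => wordBasis K X p.1 ⊗ₜ[K] wordBasis K X p.2).sum := by
  induction l with
  | nil => simp [unshuffles, wordBasis_nil, Algebra.TensorProduct.one_def]
  | cons x l ih =>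
    rw [wordBasis_cons, Bialgebra.comul_mul, ih, letter, comul_ι, unshuffles]
    generalize unshuffles l = u
    induction u with
    | nil => simp
    | cons p u hu =>
      simp only [List.map_cons, List.sum_cons, mul_add, hu, List.flatMap_cons, List.map_append,
        List.sum_append]
      simp [add_mul, wordBasis_cons, letter]

theorem sum_map_flatMap {α β M : Type*} [AddCommMonoid M] (l : List α) (f : α → List β)
    (h : β → M) : ((l.flatMap f).map h).sum = (l.map fun a => ((f a).map h).sum).sum := by
  induction l with
  | nil => simp
  | cons a l ih => simp [ih]

end Words

-- Grafting of planar forests as the Guin-Oudom product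

section Grafting

open Coalgebra (comul counit)

variable {K : Type*} [Field K] {C : Type*}

theorem planarTree_induction {p : PlanarTree C → Prop} {q : List (PlanarTree C) → Prop}
    (node : ∀ c ts, q ts → p (.node c ts)) (nil : q [])
    (cons : ∀ τ ts, p τ → q ts → q (τ :: ts)) : (∀ τ, p τ) ∧ ∀ ts, q ts := by
  have h : ∀ τ, p τ := fun τ => PlanarTree.rec (motive_1 := p) (motive_2 := q) node nil cons τ
  refine ⟨h, fun ts => ?_⟩
  induction ts with
  | nil => exact nil
  | cons τ ts ih => exact cons τ ts (h τ) ih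

theorem graft_nil : (∀ τ : PlanarTree C, graftTree τ [] = [τ]) ∧
    ∀ ts : List (PlanarTree C), graftForest ts [] = [ts] := by
  refine planarTree_induction (fun c ts h => ?_) ?_ fun τ ts h h' => ?_
  · simp [graftTree, unshuffles, h]
  · simp [graftForest]
  · simp [graftForest, unshuffles, h, h']

theorem graftTree_singleton (c : C) (ts : List (PlanarTree C)) (σ : PlanarTree C) :
    graftTree (.node c ts) [σ] = .node c (σ :: ts) :: (graftForest ts [σ]).map (.node c) := by
  simp [graftTree, unshuffles, graft_nil.2]

theorem graftForest_cons_singleton (τ : PlanarTree C) (ts : List (PlanarTree C))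
    (σ : PlanarTree C) : graftForest (τ :: ts) [σ] =
      (graftTree τ [σ]).map (fun τ' => τ' :: ts) ++ (graftForest ts [σ]).map (fun ts' => τ :: ts')
          := by
  simp [graftForest, unshuffles, graft_nil.1, graft_nil.2, List.map_eq_flatMap]

/-- The grafting of one tree on another, extended bilinearly. -/
def treeGraft (K C : Type*) [Field K] : (PlanarTree C →₀ K) →ₗ[K] (PlanarTree C →₀ K) →ₗ[K]
    (PlanarTree C →₀ K) :=
  Finsupp.linearCombination K fun σ => Finsupp.linearCombination K fun τ =>
    ((graftTree τ [σ]).map fun τ' => Finsupp.single τ' 1).sum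

theorem isFreePostLieProduct_treeGraft :
    IsFreePostLieProduct (freePostLieProduct (treeGraft K C)) where
  toIsPostLie := isPostLie_freePostLieProduct _
  of_of σ τ := by
    rw [freePostLieProduct_of, treeGraft, Finsupp.linearCombination_single, one_smul,
      Finsupp.linearCombination_single, one_smul, map_list_sum, List.map_map]
    congr 2
    ext τ'
    simp

variable {t : LieTrees K C →ₗ[K] LieTrees K C →ₗ[K] LieTrees K C}

theorem IsFreePostLieProduct.mem_letterSpan (ht : IsFreePostLieProduct t) (σ τ : PlanarTree C) :
    t (FreeLieAlgebra.of K σ) (FreeLieAlgebra.of K τ) ∈ letterSpan K (PlanarTree C) := by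
  rw [ht.of_of]
  refine list_sum_mem fun x hx => ?_
  obtain ⟨τ', -, rfl⟩ := List.mem_map.1 hx
  exact Submodule.subset_span ⟨τ', rfl⟩

theorem IsFreePostLieProduct.unique (ht : IsFreePostLieProduct t)
    {t' : LieTrees K C →ₗ[K] LieTrees K C →ₗ[K] LieTrees K C} (ht' : IsFreePostLieProduct t') :
    t = t' :=
  ht.toIsPostLie.eq_of_generators ht'.toIsPostLie
    (fun σ τ => (ht.of_of σ τ).trans (ht'.of_of σ τ).symm) ht.mem_letterSpan

variable (ht : IsFreePostLieProduct t)

/-- The linear map attaching the trees of a forest to a new root. -/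
def rootMap (K : Type*) [Field K] {C : Type*} (c : C) :
    𝓤 K (LieTrees K C) →ₗ[K] 𝓤 K (LieTrees K C) :=
  (wordBasis K (PlanarTree C)).constr K fun ts => letter K (.node c ts)

@[simp]
theorem rootMap_wordBasis (c : C) (ts : List (PlanarTree C)) :
    rootMap K c (wordBasis K _ ts) = letter K (.node c ts) :=
  Module.Basis.constr_basis _ _ _ _

theorem guinOudom_letter_wordBasis (σ : PlanarTree C) (ts : List (PlanarTree C)) :
    guinOudom ht.toIsPostLie (letter K σ) (wordBasis K _ ts) =
      ((graftForest ts [σ]).map (wordBasis K _)).sum := by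
  have hg := isGuinOudomExtension_guinOudom ht.toIsPostLie
  induction ts with
  | nil => simp [graftForest, wordBasis_nil, hg.graft_one, letter]
  | cons τ ts ih =>
    rw [wordBasis_cons, letter, hg.ι_graft_mul, ← letter, ih, graftForest_cons_singleton,
      List.map_append, List.sum_append, List.map_map, List.map_map, letter, letter,
      hg.extends_product, ht.of_of, map_list_sum, List.map_map, ← List.sum_map_mul_right,
      ← List.sum_map_mul_left]
    congr 2
    · congr 1
      ext τ'
      simp [wordBasis_cons, letter]
    · congr 1
      ext ts'
      simp [wordBasis_cons, letter]

theorem starProduct_letter (σ : PlanarTree C) (F : 𝓤 K (LieTrees K C)) :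
    starProduct (guinOudom ht.toIsPostLie) (letter K σ) F =
      letter K σ * F + guinOudom ht.toIsPostLie (letter K σ) F := by
  have hg := isGuinOudomExtension_guinOudom ht.toIsPostLie
  rw [starProduct, letter, ← comul_eq_unshuffleCoproduct, comul_ι]
  simp [hg.one_graft]

/-- A tree grafted on B₊(F) either becomes the leftmost branch of the root, contributing σF, or is
grafted on the branches, contributing σ ▷ F. The sum is σ ∗ F. -/
theorem guinOudom_letter_rootMap (σ : PlanarTree C) (c : C) (F : 𝓤 K (LieTrees K C)) :
    guinOudom ht.toIsPostLie (letter K σ) (rootMap K c F) =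
      rootMap K c (starProduct (guinOudom ht.toIsPostLie) (letter K σ) F) := by
  have hg := isGuinOudomExtension_guinOudom ht.toIsPostLie
  have h : guinOudom ht.toIsPostLie (letter K σ) ∘ₗ rootMap K c = rootMap K c ∘ₗ
      (LinearMap.mulLeft K (letter K σ) + guinOudom ht.toIsPostLie (letter K σ)) := by
    refine (wordBasis K (PlanarTree C)).ext fun ts => ?_
    simp only [LinearMap.comp_apply, LinearMap.add_apply, LinearMap.mulLeft_apply, map_add,
      rootMap_wordBasis, ← wordBasis_cons, guinOudom_letter_wordBasis ht, map_list_sum,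
          List.map_map]
    rw [letter, letter, hg.extends_product, ht.of_of, graftTree_singleton, List.map_cons,
      List.sum_cons, map_add, map_list_sum, List.map_map, List.map_map]
    congr 3
    ext ts'
    simp [letter]
  rw [starProduct_letter ht]
  exact LinearMap.congr_fun h F

theorem starProduct_assoc {L : Type*} [LieRing L] [LieAlgebra K L] {t : L →ₗ[K] L →ₗ[K] L}
    (ht : IsPostLie t) (A B F : 𝓤 K L) :
    starProduct (guinOudom ht) (starProduct (guinOudom ht) A B) F =
      starProduct (guinOudom ht) A (starProduct (guinOudom ht) B F) := by
  simp only [starProduct_guinOudom, LinearEquiv.symm_apply_apply, mul_assoc]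

theorem starProduct_add_left {L : Type*} [LieRing L] [LieAlgebra K L] {t : L →ₗ[K] L →ₗ[K] L}
    (ht : IsPostLie t) (A B F : 𝓤 K L) : starProduct (guinOudom ht) (A + B) F =
      starProduct (guinOudom ht) A F + starProduct (guinOudom ht) B F := by
  simp only [starProduct_guinOudom, map_add, add_mul]

theorem starProduct_smul_left {L : Type*} [LieRing L] [LieAlgebra K L] {t : L →ₗ[K] L →ₗ[K] L}
    (ht : IsPostLie t) (c : K) (A F : 𝓤 K L) : starProduct (guinOudom ht) (c • A) F =
      c • starProduct (guinOudom ht) A F := by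
  simp only [starProduct_guinOudom, map_smul, smul_mul_assoc]

/-- Grafting on a tree: the roots are grafted on the root of the tree or on its branches. -/
theorem guinOudom_rootMap (c : C) (A F : 𝓤 K (LieTrees K C)) :
    guinOudom ht.toIsPostLie A (rootMap K c F) =
      rootMap K c (starProduct (guinOudom ht.toIsPostLie) A F) := by
  have hg := isGuinOudomExtension_guinOudom ht.toIsPostLie
  let p : Submodule K (𝓤 K (LieTrees K C)) :=
    { carrier := {A | ∀ F, guinOudom ht.toIsPostLie A (rootMap K c F) =
        rootMap K c (starProduct (guinOudom ht.toIsPostLie) A F)}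
      add_mem' := fun {A B} hA hB F => by
        rw [map_add, LinearMap.add_apply, hA F, hB F, starProduct_add_left, map_add]
      zero_mem' := fun F => by
        rw [← zero_smul K (0 : 𝓤 K (LieTrees K C)), starProduct_smul_left]; simp
      smul_mem' := fun a A hA F => by
        rw [map_smul, LinearMap.smul_apply, hA F, starProduct_smul_left, map_smul] }
  have hp : A ∈ p := by
    refine letter_derivation_induction p (fun F => ?_) (fun σ A hA hδ F => ?_) A
    · rw [hg.one_graft, starProduct_guinOudom]; simp
    · have h := hδ (leftDerivation ht.toIsPostLie
        (toSubAdjacent ht.toIsPostLie (FreeLieAlgebra.of K σ))) (ht.mem_letterSpan σ) F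
      rw [← hg.ι_graft, ← letter] at h
      -- Writing σA = σ ∗ A − σ ▷ A and using associativity of ∗ reduces the claim for σA to those
      -- for σ, A and σ ▷ A.
      have hs : starProduct (guinOudom ht.toIsPostLie) (letter K σ * A) F =
          starProduct (guinOudom ht.toIsPostLie) (letter K σ)
            (starProduct (guinOudom ht.toIsPostLie) A F) -
          starProduct (guinOudom ht.toIsPostLie)
            (guinOudom ht.toIsPostLie (letter K σ) A) F := by
        rw [← starProduct_assoc, starProduct_letter ht, starProduct_add_left, add_sub_cancel_right]
      rw [hs, map_sub, ← h, ← guinOudom_letter_rootMap ht, ← hA F, letter, hg.ι_mul_graft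
          ht.toIsPostLie]
  exact hp F

theorem guinOudom_wordBasis_cons (ω : List (PlanarTree C)) (x : PlanarTree C)
    (ts : List (PlanarTree C)) : guinOudom ht.toIsPostLie (wordBasis K _ ω) (wordBasis K _ (x ::
        ts)) =
      ((unshuffles ω).map fun p => guinOudom ht.toIsPostLie (wordBasis K _ p.1) (letter K x) *
        guinOudom ht.toIsPostLie (wordBasis K _ p.2) (wordBasis K _ ts)).sum := by
  rw [wordBasis_cons, (isGuinOudomExtension_guinOudom ht.toIsPostLie).graft_mul,
    ← comul_eq_unshuffleCoproduct, comul_wordBasis, map_list_sum, map_list_sum, List.map_map,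
    List.map_map]
  rfl

theorem starProduct_wordBasis (ω : List (PlanarTree C)) (F : 𝓤 K (LieTrees K C)) :
    starProduct (guinOudom ht.toIsPostLie) (wordBasis K _ ω) F =
      ((unshuffles ω).map fun p => wordBasis K _ p.1 *
        guinOudom ht.toIsPostLie (wordBasis K _ p.2) F).sum := by
  rw [starProduct, ← comul_eq_unshuffleCoproduct, comul_wordBasis, map_list_sum, map_list_sum,
    List.map_map, List.map_map]
  rfl

/-- The combinatorial recursion matches the algebraic one: `guinOudom_rootMap` splits the roots
between the root of a tree and its branches, the unshuffle rule distributes them over a forest, and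
on the empty forest only the counit remains. -/
theorem guinOudom_forest : (∀ (τ : PlanarTree C) (ω : List (PlanarTree C)),
      guinOudom ht.toIsPostLie (wordBasis K _ ω) (letter K τ) =
        ((graftTree τ ω).map (letter K)).sum) ∧
    ∀ (ts : List (PlanarTree C)) (ω : List (PlanarTree C)),
      guinOudom ht.toIsPostLie (wordBasis K _ ω) (wordBasis K _ ts) =
        ((graftForest ts ω).map (wordBasis K _)).sum := by
  have hg := isGuinOudomExtension_guinOudom ht.toIsPostLie
  refine planarTree_induction (fun c ts ih ω => ?_) (fun ω => ?_) fun τ ts hτ hts ω => ?_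
  · rw [← rootMap_wordBasis, guinOudom_rootMap ht, starProduct_wordBasis ht, map_list_sum,
      List.map_map,
      graftTree, sum_map_flatMap]
    congr 2
    ext p
    rw [Function.comp_apply, ih, ← List.sum_map_mul_left, map_list_sum, List.map_map, List.map_map]
    congr 2
    ext ts'
    simp [← wordBasis_append]
  · rw [wordBasis_nil, hg.graft_one, counit_wordBasis]
    cases ω <;> simp [graftForest, wordBasis_nil]
  · rw [guinOudom_wordBasis_cons ht, graftForest, sum_map_flatMap]
    congr 2
    ext p
    rw [hτ, hts, sum_map_flatMap, ← List.sum_map_mul_right]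
    congr 2
    ext τ'
    rw [← List.sum_map_mul_left, List.map_map]
    congr 2
    ext ts'
    simp [wordBasis_cons]

theorem starProduct_forest (ω₁ ω₂ : List (PlanarTree C)) :
    starProduct (guinOudom ht.toIsPostLie) (wordBasis K _ ω₁) (wordBasis K _ ω₂) =
      ((grossmanLarson ω₁ ω₂).map (wordBasis K _)).sum := by
  rw [starProduct_wordBasis ht, grossmanLarson, sum_map_flatMap]
  congr 2
  ext p
  rw [(guinOudom_forest ht).2, ← List.sum_map_mul_left, List.map_map]
  congr 2
  ext ω
  simp [wordBasis_append]

end Grafting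

-- Counting words and shuffles

section Multiplicity

open Coalgebra (comul counit)

variable {K : Type*} [Field K] {α : Type*}

open scoped Classical in
theorem multiplicity_cons (ω a : List α) (l : List (List α)) :
    multiplicity K ω (a :: l) = multiplicity K ω l + if a = ω then 1 else 0 := by
  simp only [multiplicity, List.count_cons, beq_iff_eq]
  split_ifs <;> simp

theorem multiplicity_nil (ω : List α) : multiplicity K ω [] = 0 := by simp [multiplicity]

theorem multiplicity_append (ω : List α) (l l' : List (List α)) :
    multiplicity K ω (l ++ l') = multiplicity K ω l + multiplicity K ω l' := by
  simp [multiplicity]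

open scoped Classical in
theorem multiplicity_map_cons (a b : α) (ω : List α) (l : List (List α)) :
    multiplicity K (a :: ω) (l.map fun w => b :: w) =
      if b = a then multiplicity K ω l else 0 := by
  induction l with
  | nil => simp [multiplicity_nil]
  | cons w l ih =>
    rw [List.map_cons, multiplicity_cons, multiplicity_cons, ih]
    by_cases h : b = a <;> simp [h]

theorem multiplicity_nil_map_cons (b : α) (l : List (List α)) :
    multiplicity K [] (l.map fun w => b :: w) = 0 := by
  induction l with
  | nil => simp [multiplicity_nil]
  | cons w l ih => rw [List.map_cons, multiplicity_cons, ih]; simp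

open scoped Classical in
theorem multiplicity_singleton (ω a : List α) :
    multiplicity K ω [a] = if a = ω then 1 else 0 := by
  rw [multiplicity_cons, multiplicity_nil, zero_add]

theorem shuffles_nil_right (l : List α) : shuffles l [] = [l] := by cases l <;> simp [shuffles]

theorem shuffles_nil_left (l : List α) : shuffles [] l = [l] := by simp [shuffles]

open scoped Classical in
/-- Shuffling is transposed to unshuffling. -/
theorem multiplicity_shuffles (u v w : List α) : multiplicity K w (shuffles u v) =
    ((unshuffles w).map fun p => (if p.1 = u then (1 : K) else 0) * if p.2 = v then 1 else 0).sum
        := by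
  induction w generalizing u v with
  | nil =>
    cases u with
    | nil =>
      rw [shuffles_nil_left, multiplicity_singleton]
      simp [unshuffles, eq_comm]
    | cons a u =>
      cases v with
      | nil =>
        rw [shuffles_nil_right, multiplicity_singleton]
        simp [unshuffles]
      | cons b v =>
        rw [shuffles, multiplicity_append, multiplicity_nil_map_cons, multiplicity_nil_map_cons]
        simp [unshuffles]
  | cons a w ih =>
    rw [unshuffles, sum_map_flatMap]
    simp only [List.map_cons, List.map_nil, List.sum_cons, List.sum_nil, add_zero,
      List.sum_map_add]
    cases u with
    | nil =>
      cases v with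
      | nil => simp [shuffles_nil_left, multiplicity_singleton]
      | cons c v =>
        have h := ih [] v
        rw [shuffles_nil_left, multiplicity_singleton] at h ⊢
        by_cases hc : a = c
        · subst hc
          simpa using h
        · simp [hc, Ne.symm hc]
    | cons b u =>
      cases v with
      | nil =>
        have h := ih u []
        rw [shuffles_nil_right, multiplicity_singleton] at h ⊢
        by_cases hc : a = b
        · subst hc
          simpa using h
        · simp [hc, Ne.symm hc]
      | cons c v =>
        rw [shuffles, multiplicity_append, multiplicity_map_cons, multiplicity_map_cons,
          ih, ih]
        congr 1
        · by_cases hc : a = b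
          · subst hc; simp
          · simp [hc, Ne.symm hc]
        · by_cases hc : a = c
          · subst hc; simp
          · simp [hc, Ne.symm hc]

theorem coord_sum_map {V : Type*} [AddCommGroup V] [Module K V] (e : Module.Basis (List α) K V)
    (ω : List α) (l : List (List α)) : e.coord ω (l.map e).sum = multiplicity K ω l := by
  classical
  induction l with
  | nil => simp [multiplicity_nil]
  | cons a l ih =>
    rw [List.map_cons, List.sum_cons, map_add, ih, multiplicity_cons, add_comm,
      Module.Basis.coord_apply, e.repr_self, Finsupp.single_apply]

end Multiplicity

-- Dual bases of spaces of forms with finite support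

section DualBases

variable {K : Type*} [Field K] {V I H : Type*} [AddCommGroup V] [Module K V] [AddCommGroup H]
  [Module K H]

/-- The preimages of the coordinate forms are independent, and they span because each form has
finitely many nonzero values on e and is therefore a finite combination of coordinates. -/
theorem exists_dualBasis {p : H →ₗ[K] Module.Dual K V} (hp : Function.Injective p)
    (e : Module.Basis I K V) (hcoord : ∀ i, e.coord i ∈ LinearMap.range p)
    (hfin : ∀ h, {i | p h (e i) ≠ 0}.Finite) :
    ∃ b : Module.Basis I K H, ∀ i, p (b i) = e.coord i := by
  classical
  choose c hc using hcoord
  have hcl : ∀ (l : I →₀ K) i, p (Finsupp.linearCombination K c l) (e i) = l i := by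
    intro l i
    induction l using Finsupp.induction_linear with
    | zero => simp
    | add v w hv hw => simp only [map_add, LinearMap.add_apply, hv, hw, Finsupp.add_apply]
    | single j a =>
      rw [Finsupp.linearCombination_single, map_smul, LinearMap.smul_apply, hc,
        Module.Basis.coord_apply, e.repr_self, Finsupp.single_apply, Finsupp.single_apply,
        smul_eq_mul]
      by_cases h : i = j <;> simp [h, eq_comm]
  let f : (I →₀ K) ≃ₗ[K] H := LinearEquiv.ofBijective (Finsupp.linearCombination K c)
    ⟨fun l l' h => by
      ext i
      rw [← hcl, ← hcl, h], fun h => by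
      refine ⟨Finsupp.ofSupportFinite (fun i => p h (e i)) (hfin h), hp (e.ext fun i => ?_)⟩
      rw [hcl]; rfl⟩
  refine ⟨Module.Basis.ofRepr f.symm, fun i => ?_⟩
  rw [← hc, Module.Basis.coe_ofRepr]
  change p (Finsupp.linearCombination K c (Finsupp.single i 1)) = _
  rw [Finsupp.linearCombination_single, one_smul]

variable {V' I' H' : Type*} [AddCommGroup V'] [Module K V'] [AddCommGroup H'] [Module K H']
  {p : H →ₗ[K] Module.Dual K V} {p' : H' →ₗ[K] Module.Dual K V'} {e : Module.Basis I K V}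
  {e' : Module.Basis I' K V'} {b : Module.Basis I K H} {b' : Module.Basis I' K H'}

theorem repr_dualBasis (hb : ∀ i, p (b i) = e.coord i) (h : H) (i : I) :
    b.repr h i = p h (e i) := by
  classical
  have : b.coord i = LinearMap.applyₗ (e i) ∘ₗ p := b.ext fun j => by
    simp only [Module.Basis.coord_apply, LinearMap.comp_apply, LinearMap.applyₗ_apply_apply, hb,
      Module.Basis.repr_self, Finsupp.single_apply, eq_comm]
  exact LinearMap.congr_fun this h

theorem repr_tensorProduct_dualBasis (hb : ∀ i, p (b i) = e.coord i)
    (hb' : ∀ i, p' (b' i) = e'.coord i) (z : H ⊗[K] H') (i : I) (j : I') :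
    (b.tensorProduct b').repr z (i, j) = dualPair p p' z (e i ⊗ₜ e' j) := by
  induction z using TensorProduct.induction_on with
  | zero => simp
  | tmul h h' =>
    rw [Module.Basis.tensorProduct_repr_tmul_apply, repr_dualBasis hb, repr_dualBasis hb',
      dualPair_tmul, smul_eq_mul, mul_comm]
  | add z z' hz hz' => simp only [map_add, LinearMap.add_apply, Finsupp.add_apply, hz, hz']

end DualBases

-- The shuffle Hopf algebra as the dual of words

section ShuffleDual

open Coalgebra (comul counit)

variable {K : Type*} [Field K] {X : Type*} {H : Type*} [Ring H] [HopfAlgebra K H]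
  {p : H →ₗ[K] Module.Dual K (𝓤 K (FreeLieAlgebra K X))} {b : Module.Basis (List X) K H}

open scoped Classical in
theorem coord_wordBasis (l w : List X) :
    (wordBasis K X).coord l (wordBasis K X w) = if w = l then 1 else 0 := by
  rw [Module.Basis.coord_apply, Module.Basis.repr_self, Finsupp.single_apply]

theorem dual_one_eq (hp : Function.Injective p) (hb : ∀ l, p (b l) = (wordBasis K X).coord l)
    (hone : ∀ A, p 1 A = counit (R := K) A) : b [] = 1 := by
  classical
  refine hp ((wordBasis K X).ext fun w => ?_)
  rw [hb, hone, coord_wordBasis, counit_wordBasis]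
  cases w <;> simp

theorem dual_counit_eq (hb : ∀ l, p (b l) = (wordBasis K X).coord l)
    (hcounit : ∀ x, counit (R := K) x = p x 1) (l : List X) :
    counit (R := K) (b l) = if l.isEmpty then 1 else 0 := by
  classical
  rw [hcounit, hb, ← wordBasis_nil, coord_wordBasis]
  cases l <;> simp

theorem dual_mul_eq (hp : Function.Injective p) (hb : ∀ l, p (b l) = (wordBasis K X).coord l)
    (hmul : ∀ x y A, p (x * y) A = TensorProduct.dualDistrib K _ _ (p x ⊗ₜ p y) (comul A))
    (l m : List X) : b l * b m = ((shuffles l m).map b).sum := by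
  classical
  refine hp ((wordBasis K X).ext fun w => ?_)
  have h : p ((shuffles l m).map b).sum (wordBasis K X w) = multiplicity K w (shuffles l m) := by
    generalize shuffles l m = s
    induction s with
    | nil => simp [multiplicity_nil]
    | cons a s ih =>
      rw [List.map_cons, List.sum_cons, map_add, LinearMap.add_apply, ih, multiplicity_cons, hb,
        coord_wordBasis, add_comm]
      simp only [eq_comm]
  rw [h, hmul, hb, hb, comul_wordBasis, map_list_sum, List.map_map, multiplicity_shuffles]
  congr 2
  ext q
  simp only [Function.comp_apply, TensorProduct.dualDistrib_apply, coord_wordBasis]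

theorem dual_comul_eq (hp : Function.Injective p) (hb : ∀ l, p (b l) = (wordBasis K X).coord l)
    (hcomul : ∀ x A B, dualPair p p (comul (R := K) x) (A ⊗ₜ B) = p x (A * B)) (l : List X) :
    comul (R := K) (b l) =
      ∑ i ∈ Finset.range (l.length + 1), b (l.take i) ⊗ₜ[K] b (l.drop i) := by
  classical
  apply dualPair_injective hp hp
  refine ((wordBasis K X).tensorProduct (wordBasis K X)).ext ?_
  rintro ⟨u, v⟩
  rw [Module.Basis.tensorProduct_apply, hcomul, hb, ← wordBasis_append, coord_wordBasis, map_sum,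
      LinearMap.sum_apply]
  simp only [dualPair_tmul, hb, coord_wordBasis]
  by_cases h : u ++ v = l
  · subst h
    -- The only cut of u ++ v with left part u is the one at the length of u.
    rw [if_pos rfl, Finset.sum_eq_single u.length]
    · simp
    · intro i hi hne
      rw [if_neg, zero_mul]
      intro hu
      have := congrArg List.length hu
      rw [List.length_take, List.length_append] at this
      rw [Finset.mem_range, List.length_append] at hi
      omega
    · intro h
      exact absurd (Finset.mem_range.2 (by rw [List.length_append]; omega)) h
  · rw [if_neg h, Finset.sum_eq_zero]
    intro i _
    by_cases hu : u = l.take i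
    · by_cases hv : v = l.drop i
      · exact absurd (by rw [hu, hv, List.take_append_drop]) h
      · rw [if_neg hv, mul_zero]
    · rw [if_neg hu, zero_mul]

end ShuffleDual

-- Grading forests by their multiset of decorations

section Degrees

variable {C : Type*}

mutual

/-- The multiset of the decorations of a planar tree. -/
def treeDegree : PlanarTree C → Multiset C
  | .node c ts => c ::ₘ forestDegree ts

/-- The multiset of the decorations of an ordered forest. -/
def forestDegree : List (PlanarTree C) → Multiset C
  | [] => 0
  | τ :: ts => treeDegree τ + forestDegree ts

end

theorem forestDegree_append (ω ω' : List (PlanarTree C)) :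
    forestDegree (ω ++ ω') = forestDegree ω + forestDegree ω' := by
  induction ω with
  | nil => simp [forestDegree]
  | cons τ ω ih => simp [forestDegree, ih, add_assoc]

theorem forestDegree_of_mem_unshuffles {ω : List (PlanarTree C)}
    {p : List (PlanarTree C) × List (PlanarTree C)} (hp : p ∈ unshuffles ω) :
    forestDegree p.1 + forestDegree p.2 = forestDegree ω := by
  induction ω generalizing p with
  | nil => simp [unshuffles] at hp; simp [hp, forestDegree]
  | cons τ ω ih =>
    simp only [unshuffles, List.mem_flatMap, List.mem_cons, List.not_mem_nil, or_false] at hp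
    obtain ⟨q, hq, rfl | rfl⟩ := hp
    · simp only [forestDegree, ← ih hq, add_assoc]
    · simp only [forestDegree, ← ih hq, add_left_comm]

theorem degree_of_mem_graft :
    (∀ (τ : PlanarTree C) (ω : List (PlanarTree C)), ∀ τ' ∈ graftTree τ ω,
      treeDegree τ' = forestDegree ω + treeDegree τ) ∧
    ∀ (ts : List (PlanarTree C)) (ω : List (PlanarTree C)), ∀ ts' ∈ graftForest ts ω,
      forestDegree ts' = forestDegree ω + forestDegree ts := by
  refine planarTree_induction (fun c ts ih ω τ' hτ' => ?_) (fun ω ts' hts' => ?_)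
    fun τ ts hτ hts ω ts' hts' => ?_
  · rw [graftTree] at hτ'
    simp only [List.mem_flatMap, List.mem_map] at hτ'
    obtain ⟨p, hp, ts', hts', rfl⟩ := hτ'
    rw [treeDegree, treeDegree, forestDegree_append, ih _ _ hts',
      ← forestDegree_of_mem_unshuffles hp, Multiset.add_cons, add_assoc]
  · cases ω with
    | nil => simp [graftForest] at hts'; simp [hts', forestDegree]
    | cons σ ω => simp [graftForest] at hts'
  · rw [graftForest] at hts'
    simp only [List.mem_flatMap, List.mem_map] at hts'
    obtain ⟨p, hp, τ', hτ', σ', hσ', rfl⟩ := hts'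
    rw [forestDegree, forestDegree, hτ _ _ hτ', hts _ _ hσ', ← forestDegree_of_mem_unshuffles hp]
    abel

theorem finite_setOf_add_eq (m : Multiset C) :
    {p : Multiset C × Multiset C | p.1 + p.2 = m}.Finite :=
  (Multiset.antidiagonal m).finite_toSet.subset fun _ hp => Multiset.mem_antidiagonal.2 hp

/-- In a nonempty forest, remove the root of the first tree: its branches and the remaining trees
share the decorations left after erasing that root, so both have a strictly smaller multiset.
Counting vertices alone would not give finite fibers when C is infinite. -/
theorem finite_forestDegree_fiber (m : Multiset C) :
    {ω : List (PlanarTree C) | forestDegree ω = m}.Finite := by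
  classical
  induction m using Multiset.strongInductionOn with
  | ih m ih =>
    have hfin : (⋃ c ∈ {c | c ∈ m}, ⋃ p ∈ {p : Multiset C × Multiset C | p.1 + p.2 = m.erase c},
        (fun q : List (PlanarTree C) × List (PlanarTree C) => PlanarTree.node c q.1 :: q.2) ''
          ({ω | forestDegree ω = p.1} ×ˢ {ω | forestDegree ω = p.2})).Finite := by
      refine m.finite_toSet.biUnion fun c hc => (finite_setOf_add_eq _).biUnion fun p hp => ?_
      have hlt : m.erase c < m := Multiset.erase_lt.2 hc
      have h1 : p.1 ≤ m.erase c := hp ▸ Multiset.le_add_right _ _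
      have h2 : p.2 ≤ m.erase c := hp ▸ Multiset.le_add_left _ _
      exact ((ih _ (h1.trans_lt hlt)).prod (ih _ (h2.trans_lt hlt))).image _
    refine (hfin.insert []).subset ?_
    rintro ω rfl
    cases ω with
    | nil => exact Set.mem_insert _ _
    | cons τ ω =>
      obtain ⟨c, ts⟩ := τ
      refine Set.mem_insert_of_mem _ ?_
      simp only [Set.mem_iUnion]
      refine ⟨c, ?_, (forestDegree ts, forestDegree ω), ?_, (ts, ω), ⟨rfl, rfl⟩, rfl⟩
      · simp [forestDegree, treeDegree]
      · simp [forestDegree, treeDegree]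

variable {K : Type*} [Field K]

/-- The trees with given decorations, as elements of the free Lie algebra. -/
def treesOfDegree (K C : Type*) [Field K] (m : Multiset C) : Set (LieTrees K C) :=
  {x | ∃ τ, treeDegree τ = m ∧ x = FreeLieAlgebra.of K τ}

theorem isHomogeneousBasis_wordBasis :
    IsHomogeneousBasis (treesOfDegree K C) (wordBasis K (PlanarTree C)) forestDegree where
  component_eq m := by
    refine congrArg (Submodule.span K) (Set.ext fun A => ?_)
    constructor
    · rintro ⟨l, hl, rfl, rfl⟩
      suffices h : ∃ ω : List (PlanarTree C), forestDegree ω = (l.map Prod.fst).sum ∧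
          wordBasis K _ ω = (l.map fun p => ιᵤ K p.2).prod from h
      induction l with
      | nil => exact ⟨[], by simp [forestDegree], by simp [wordBasis_nil]⟩
      | cons q l ih =>
        obtain ⟨ω, h1, h2⟩ := ih fun p hp => hl p (List.mem_cons_of_mem _ hp)
        obtain ⟨τ, h3, h4⟩ := hl q List.mem_cons_self
        exact ⟨τ :: ω, by simp [forestDegree, h1, h3], by simp [wordBasis_cons, h2, h4, letter]⟩
    · rintro ⟨ω, rfl, rfl⟩
      refine ⟨ω.map fun τ => (treeDegree τ, FreeLieAlgebra.of K τ), ?_, ?_, ?_⟩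
      · intro p hp
        obtain ⟨τ, -, rfl⟩ := List.mem_map.1 hp
        exact ⟨τ, rfl, rfl⟩
      · induction ω with
        | nil => simp [forestDegree]
        | cons τ ω ih => simp only [List.map_cons, List.sum_cons, ih, forestDegree]
      · rw [wordBasis_apply, List.map_map]; rfl
  finite_fiber := finite_forestDegree_fiber

theorem IsFreePostLieProduct.mem_span_treesOfDegree
    {t : LieTrees K C →ₗ[K] LieTrees K C →ₗ[K] LieTrees K C} (ht : IsFreePostLieProduct t)
    (m n : Multiset C) (x y : LieTrees K C) (hx : x ∈ treesOfDegree K C m)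
    (hy : y ∈ treesOfDegree K C n) : t x y ∈ Submodule.span K (treesOfDegree K C (m + n)) := by
  obtain ⟨σ, rfl, rfl⟩ := hx
  obtain ⟨τ, rfl, rfl⟩ := hy
  rw [ht.of_of]
  refine list_sum_mem fun x hx => ?_
  obtain ⟨τ', hτ', rfl⟩ := List.mem_map.1 hx
  refine Submodule.subset_span ⟨τ', ?_, rfl⟩
  rw [degree_of_mem_graft.1 _ _ _ hτ']
  simp [forestDegree]

end Degrees

-- The cointeraction of the shuffle and Munthe-Kaas-Wright Hopf algebras

section FreeCase

open Coalgebra (comul counit)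

variable {K : Type*} [Field K] {C : Type*}

theorem finite_support_gradedForms {L M I : Type*} [LieRing L] [LieAlgebra K L] [AddCommMonoid M]
    {X : M → Set L} {e : Module.Basis I K (𝓤 K L)} {deg : I → M} (he : IsHomogeneousBasis X e deg)
    {f : WithConv (𝓤 K L →ₗ[K] K)} (hf : f ∈ gradedForms K X) : {i | f (e i) ≠ 0}.Finite := by
  obtain ⟨F, hF, hf⟩ := mem_gradedForms.1 hf
  refine (hF.biUnion fun m _ => he.finite_fiber m).subset fun i hi => ?_
  by_contra h
  refine hi (hf (deg i) (fun hm => h ?_) _ (he.mem i))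
  exact Set.mem_biUnion hm rfl

/-- Both restricted duals have the basis dual to forests in 𝒰(Lie(𝒫𝒯)), the second one through the
orbit isomorphism. In these bases the coefficients of the coproduct and of ρ are multiplicities in
`grossmanLarson` and `graftForest`. -/
theorem exists_forest_cointeraction {t : LieTrees K C →ₗ[K] LieTrees K C →ₗ[K] LieTrees K C}
    (ht : IsFreePostLieProduct t) :
    ∃ (D : RestrictedDual K (𝓤 K (LieTrees K C)))
      (D' : RestrictedDual K (𝓤 K (SubAdjacent ht.toIsPostLie)))
      (bT : Module.Basis (List (PlanarTree C)) K D.Carrier)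
      (b : Module.Basis (List (PlanarTree C)) K D'.Carrier)
      (ρ : D.Carrier →ₗ[K] D'.Carrier ⊗[K] D.Carrier),
      IsShuffleHopfAlgebra bT ∧ IsMKWHopfAlgebra b ∧ IsForestGraftCoaction bT b ρ ∧
        IsCointeraction ρ := by
  have he := isHomogeneousBasis_wordBasis (K := K) (C := C)
  have hX := ht.mem_span_treesOfDegree
  obtain ⟨ρ, hρ, hco⟩ := exists_graftCoaction ht.toIsPostLie he hX finite_setOf_add_eq
  have hD : ∀ f, f ∈ (gradedRestrictedDual he finite_setOf_add_eq).forms ↔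
    f ∈ gradedForms K (treesOfDegree K C) := fun _ => Iff.rfl
  have hD' : ∀ f, f ∈ (starRestrictedDual ht.toIsPostLie he hX finite_setOf_add_eq).forms ↔
    f ∈ gradedForms K (subAdjacentDegree ht.toIsPostLie (treesOfDegree K C)) := fun _ => Iff.rfl
  generalize gradedRestrictedDual he finite_setOf_add_eq = D at ρ hρ hco hD
  generalize starRestrictedDual ht.toIsPostLie he hX finite_setOf_add_eq = D' at ρ hρ hco hD'
  obtain ⟨bT, hbT⟩ := exists_dualBasis D.eval_injective (wordBasis K (PlanarTree C))
    (fun i => (D.mem_range_eval _).2 ((hD _).2 (he.coord_mem i)))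
    (fun f => finite_support_gradedForms he ((hD _).1 f.2))
  have he' := he.subAdjacent ht.toIsPostLie hX
  obtain ⟨b, hb⟩ := exists_dualBasis (starPairing_injective ht.toIsPostLie D')
    (wordBasis K (PlanarTree C))
    (fun i => (mem_range_starPairing_iff ht.toIsPostLie D' _).2 ((hD' _).2 (he'.coord_mem i)))
    (fun f => finite_support_gradedForms he' ((hD' _).1 f.2))
  refine ⟨D, D', bT, b, ρ, ?_, ?_, ?_, hco⟩
  · exact ⟨dual_one_eq D.eval_injective hbT D.eval_one, dual_mul_eq D.eval_injective hbT D.eval_mul,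
      dual_counit_eq hbT D.counit_apply, dual_comul_eq D.eval_injective hbT fun x A B => by
        rw [D.dualPair_comul]; rfl⟩
  · refine ⟨dual_one_eq (starPairing_injective _ D') hb (starPairing_one _ D'),
      dual_mul_eq (starPairing_injective _ D') hb (starPairing_mul _ D'),
      dual_counit_eq hb (counit_eq_starPairing _ D'), fun ω ω₁ ω₂ => ?_⟩
    rw [repr_tensorProduct_dualBasis hb hb, dualPair_starPairing_comul, starProduct_forest ht, hb,
      coord_sum_map]
  · intro ω ω₁ ω₂
    rw [repr_tensorProduct_dualBasis hb hbT, hρ, (guinOudom_forest ht).2, hbT, coord_sum_map]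

end FreeCase

end PostLieCointeraction

end

theorem mainTheorem3 :
    -- every post-Lie product extends uniquely to the enveloping algebra
    (∀ (K : Type u) [Field K] (L : Type v) [LieRing L] [LieAlgebra K L]
      (t : L →ₗ[K] L →ₗ[K] L), IsPostLie t →
      ∃! g : UniversalEnvelopingAlgebra K L →ₗ[K] UniversalEnvelopingAlgebra K L →ₗ[K]
        UniversalEnvelopingAlgebra K L, IsGuinOudomExtension t g) ∧
    -- the graded dual Hopf algebras are in cointeraction
    (∀ (K : Type u) [Field K] (L : Type v) [LieRing L] [LieAlgebra K L]
      (t : L →ₗ[K] L →ₗ[K] L) (𝒢 : ℕ → Submodule K L)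
      (g : UniversalEnvelopingAlgebra K L →ₗ[K] UniversalEnvelopingAlgebra K L →ₗ[K]
        UniversalEnvelopingAlgebra K L),
      IsPostLie t → IsPostLieGrading t 𝒢 → IsGuinOudomExtension t g →
      ∃ (HT H : Type (max u v)) (_ : Ring HT) (_ : HopfAlgebra K HT) (_ : Ring H)
        (_ : HopfAlgebra K H)
        (pT : HT →ₗ[K] Module.Dual K (UniversalEnvelopingAlgebra K L))
        (p : H →ₗ[K] Module.Dual K (UniversalEnvelopingAlgebra K L)),
        IsGradedDualHopfAlgebra 𝒢 (fun A B => A * B) pT ∧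
        IsGradedDualHopfAlgebra 𝒢 (starProduct g) p ∧
        ∃ ρ : HT →ₗ[K] H ⊗[K] HT,
          IsGraftCoaction g pT p ρ ∧
          (∀ ρ' : HT →ₗ[K] H ⊗[K] HT, IsGraftCoaction g pT p ρ' → ρ' = ρ) ∧
          IsCointeraction ρ) ∧
    -- the free case
    (∀ (K : Type u) [Field K] (C : Type w),
      ∃ (t : LieTrees K C →ₗ[K] LieTrees K C →ₗ[K] LieTrees K C)
        (g : UniversalEnvelopingAlgebra K (LieTrees K C) →ₗ[K]
          UniversalEnvelopingAlgebra K (LieTrees K C) →ₗ[K]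
            UniversalEnvelopingAlgebra K (LieTrees K C))
        (β : Module.Basis (List (PlanarTree C)) K
          (UniversalEnvelopingAlgebra K (LieTrees K C))),
        IsFreePostLieProduct t ∧ (∀ t', IsFreePostLieProduct t' → t' = t) ∧
        IsGuinOudomExtension t g ∧
        (∀ ω, β ω = forestElement K ω) ∧
        (∀ ω₁ ω₂, g (β ω₁) (β ω₂) = ((graftForest ω₂ ω₁).map β).sum) ∧
        ∃ (HT H : Type (max u w)) (_ : Ring HT) (_ : HopfAlgebra K HT) (_ : Ring H)
          (_ : HopfAlgebra K H) (bT : Module.Basis (List (PlanarTree C)) K HT)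
          (b : Module.Basis (List (PlanarTree C)) K H),
          IsShuffleHopfAlgebra bT ∧ IsMKWHopfAlgebra b ∧
          ∃ ρ : HT →ₗ[K] H ⊗[K] HT, IsForestGraftCoaction bT b ρ ∧ IsCointeraction ρ) := by
  refine ⟨fun K _ L _ _ t ht => ⟨guinOudom ht, isGuinOudomExtension_guinOudom ht,
    fun g hg => hg.eq_guinOudom ht⟩, fun K _ L _ _ t 𝒢 g ht h𝒢 hg => ?_, fun K _ C => ?_⟩
  · obtain ⟨D, D', ρ, h⟩ := exists_gradedDual_cointeraction ht h𝒢 hg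
    exact ⟨D.Carrier, D'.Carrier, inferInstance, inferInstance, inferInstance, inferInstance,
      D.eval, starPairing ht D', h.1, h.2.1, ρ, h.2.2⟩
  · have ht := isFreePostLieProduct_treeGraft (K := K) (C := C)
    obtain ⟨D, D', bT, b, ρ, hT, hb, h⟩ := exists_forest_cointeraction ht
    exact ⟨_, guinOudom ht.toIsPostLie, wordBasis K (PlanarTree C), ht, fun t' ht' => ht'.unique ht,
      isGuinOudomExtension_guinOudom ht.toIsPostLie, wordBasis_apply,
      fun ω₁ ω₂ => (guinOudom_forest ht).2 ω₂ ω₁, D.Carrier, D'.Carrier, inferInstance,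
      inferInstance, inferInstance, inferInstance, bT, b, hT, hb, ρ, h⟩
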